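/- For an integer $N\ge 2$ let $\Omega_N=\{x=(x_1,\dots,x_{N-1})\in\mathbb R^{N-1}: 0\le x_1\le\dots\le x_{N-1}\le N\}$, with the convention $x_0=0$, $x_N=N$. For $\alpha>0$ let $\rho_\alpha(u)=\frac{\Gamma(2\alpha)}{\Gamma(\alpha)^2}[u(1-u)]^{\alpha-1}$, $u\in(0,1)$, be the density of the symmetric Beta distribution of parameter $\alpha$, and consider the continuous time Markov chain on $\Omega_N$ with generator $$(\mathcal L_{N,\alpha}f)(x)=\sum_{i=1}^{N-1}\int_0^1\bigl(f(x^{(i,u)})-f(x)\bigr)\rho_\alpha(u)\,du ,$$ where $x^{(i,u)}$ is obtained from $x$ by replacing the coordinate $x_i$ with $u\,x_{i-1}+(1-u)\,x_{i+1}$. Let $P_t^x$ be the law at time $t$ of the chain started at $x$, and let $$\pi_{N,\alpha}(dx)=\frac{\Gamma(N\alpha)}{\Gamma(\alpha)^N N^{N\alpha-1}}\prod_{i=1}^N(x_i-x_{i-1})^{\alpha-1}\,dx$$ be its equilibrium distribution on $\Omega_N$. The separation distance to equilibrium at time $t$ is $$d^{\mathrm{sep}}_{N,\alpha}(t)=1-\inf_{A,B}\frac{P_t(A,B)}{\pi_{N,\alpha}(A)\,\pi_{N,\alpha}(B)},\qquad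 P_t(A,B)=\int_A P^x_t(B)\,\pi_{N,\alpha}(dx),$$ where the infimum is over all Borel sets $A,B\subset\Omega_N$ of positive Lebesgue measure. The separation mixing time is $T^{\mathrm{sep}}_{N,\alpha}(\varepsilon)=\inf\{t\ge 0: d^{\mathrm{sep}}_{N,\alpha}(t)<\varepsilon\}$, with $\inf\emptyset=+\infty$. **Proposition.** For every $\varepsilon\in(0,1)$ there is an integer $N_\varepsilon\ge 2$ such that for every $\alpha>0$ there is a constant $C_{\alpha,\varepsilon}>0$ such that for all $N\ge N_\varepsilon$ $$T^{\mathrm{sep}}_{N,\alpha}(\varepsilon)\ \ge\ N^2\Bigl(\frac{2}{\pi^2}\log N-C_{\alpha,\varepsilon}\log\log N\Bigr).$$ -/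

import Mathlib

open MeasureTheory ProbabilityTheory
open scoped ENNReal

namespace AdjacentWalk

/-- The height `x_k`, `0 ≤ k ≤ N`, of the interface attached to `x = (x_1, …, x_{N-1})`, with the
boundary convention `x_0 = 0`, `x_N = N`. The coordinate `x_k`, `1 ≤ k ≤ N - 1`, is stored at the
index `k - 1` of `Fin (N - 1)`. -/
noncomputable def height (N : ℕ) (x : Fin (N - 1) → ℝ) (k : ℕ) : ℝ :=
  if k = 0 then 0 else if h : k - 1 < N - 1 then x ⟨k - 1, h⟩ else (N : ℝ)

/-- The simplex `Ω_N = {0 ≤ x_1 ≤ … ≤ x_{N-1} ≤ N}`. -/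
def simplex (N : ℕ) : Set (Fin (N - 1) → ℝ) :=
  {x | ∀ k < N, height N x k ≤ height N x (k + 1)}

/-- The configuration `x^{(i,u)}`: the particle at the index `i : Fin (N - 1)`, which is the particle
number `i + 1`, is moved to `u x_{i} + (1 - u) x_{i + 2}`; its neighbours are the particles number
`i` and `i + 2`. -/
noncomputable def resample (N : ℕ) (x : Fin (N - 1) → ℝ) (i : Fin (N - 1)) (u : ℝ) :
    Fin (N - 1) → ℝ :=
  Function.update x i (u * height N x i + (1 - u) * height N x (i + 2))

/-- The generator
`(L f)(x) = ∑_i ∫_0^1 (f (x^{(i,u)}) - f x) ρ_α(u) du`, where `ρ_α(u) du` is the symmetric Beta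
distribution of parameter `α` on `[0,1]`. -/
noncomputable def generator (N : ℕ) (α : ℝ) (f : (Fin (N - 1) → ℝ) → ℝ) (x : Fin (N - 1) → ℝ) : ℝ :=
  ∑ i : Fin (N - 1), ∫ u, (f (resample N x i u) - f x) ∂(betaMeasure α α)

theorem measurable_height (N k : ℕ) : Measurable fun x : Fin (N - 1) → ℝ => height N x k := by
  unfold height
  split_ifs
  · exact measurable_const
  · exact measurable_pi_apply _
  · exact measurable_const

theorem measurable_resample (N : ℕ) (i : Fin (N - 1)) :
    Measurable fun p : (Fin (N - 1) → ℝ) × ℝ => resample N p.1 i p.2 := by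
  have h0 : Measurable fun p : (Fin (N - 1) → ℝ) × ℝ => height N p.1 i :=
    (measurable_height N i).comp measurable_fst
  have h2 : Measurable fun p : (Fin (N - 1) → ℝ) × ℝ => height N p.1 (i + 2) :=
    (measurable_height N (i + 2)).comp measurable_fst
  refine measurable_pi_lambda _ fun j => ?_
  by_cases hj : j = i
  · subst hj
    simp only [resample, Function.update_self]
    exact (measurable_snd.mul h0).add ((measurable_const.sub measurable_snd).mul h2)
  · simp only [resample, Function.update_of_ne hj]
    exact (measurable_pi_apply j).comp measurable_fst

/-- The resampling kernel of the particle at the index `i`: the law of `x^{(i,U)}` when `U` has the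
symmetric Beta distribution of parameter `α`. -/
noncomputable def resampleKernel (N : ℕ) (α : ℝ) (i : Fin (N - 1)) :
    Kernel (Fin (N - 1) → ℝ) (Fin (N - 1) → ℝ) :=
  (Kernel.id ×ₖ Kernel.const (Fin (N - 1) → ℝ) (betaMeasure α α)).map
    fun p => resample N p.1 i p.2

/-- The sum of the resampling kernels over all ordered choices of the particles updated in `n`
successive updates; its total mass is `(N - 1) ^ n`. -/
noncomputable def updateKernel (N : ℕ) (α : ℝ) : ℕ → Kernel (Fin (N - 1) → ℝ) (Fin (N - 1) → ℝ)
  | 0 => Kernel.id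
  | n + 1 => (∑ i, resampleKernel N α i) ∘ₖ updateKernel N α n

/-- The law `P_t^x` at time `t` of the adjacent walk started at `x`. Each of the `N - 1` particles is
updated at the times of an independent Poisson clock of rate `1`, so that a given sequence of `n`
successive updates is the one performed up to time `t` with probability `e^{-(N-1)t} t^n / n!`.
Equivalently this is `exp (t L)` for the bounded generator `L`; see `law_zero` and
`hasDerivAt_integral_law`. -/
noncomputable def law (N : ℕ) (α t : ℝ) (x : Fin (N - 1) → ℝ) : Measure (Fin (N - 1) → ℝ) :=
  Measure.sum fun n : ℕ =>
    ENNReal.ofReal (Real.exp (-(((N - 1 : ℕ) : ℝ) * t)) * (t ^ n / (n.factorial : ℝ))) •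
      updateKernel N α n x

theorem resampleKernel_apply (N : ℕ) (α : ℝ) (hα : 0 < α) (i : Fin (N - 1)) (x : Fin (N - 1) → ℝ) :
    resampleKernel N α i x = (betaMeasure α α).map (resample N x i) := by
  have := isProbabilityMeasureBeta hα hα
  rw [resampleKernel, Kernel.map_apply _ (measurable_resample N i), Kernel.prod_apply,
    Kernel.id_apply, Kernel.const_apply, Measure.dirac_prod,
    Measure.map_map (measurable_resample N i) measurable_prodMk_left]
  rfl

theorem updateKernel_univ (N : ℕ) (α : ℝ) (hα : 0 < α) (n : ℕ) (x : Fin (N - 1) → ℝ) :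
    updateKernel N α n x Set.univ = ((N - 1 : ℕ) : ℝ≥0∞) ^ n := by
  have := isProbabilityMeasureBeta hα hα
  induction n with
  | zero => simp [updateKernel]
  | succ n ih =>
    have h : ∀ y, (∑ i, resampleKernel N α i) y Set.univ = ((N - 1 : ℕ) : ℝ≥0∞) := by
      intro y
      rw [Kernel.finsetSum_apply']
      have : ∀ i, resampleKernel N α i y Set.univ = 1 := by
        intro i
        rw [resampleKernel_apply N α hα, Measure.map_apply _ MeasurableSet.univ]
        · simp
        · exact (measurable_resample N i).comp measurable_prodMk_left
      simp [this]
    rw [updateKernel, Kernel.comp_apply' _ _ _ MeasurableSet.univ]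
    simp_rw [h]
    rw [lintegral_const, ih, pow_succ, mul_comm]

theorem isProbabilityMeasure_law (N : ℕ) (α : ℝ) (hα : 0 < α) (t : ℝ) (ht : 0 ≤ t)
    (x : Fin (N - 1) → ℝ) : IsProbabilityMeasure (law N α t x) := by
  constructor
  rw [law, Measure.sum_apply _ MeasurableSet.univ]
  simp_rw [Measure.smul_apply, updateKernel_univ N α hα, smul_eq_mul]
  set m : ℝ := ((N - 1 : ℕ) : ℝ) with hm
  have hm0 : 0 ≤ m := Nat.cast_nonneg _
  have h1 : ∀ n : ℕ, ENNReal.ofReal (Real.exp (-(m * t)) * (t ^ n / (n.factorial : ℝ))) *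
      ((N - 1 : ℕ) : ℝ≥0∞) ^ n =
      ENNReal.ofReal (Real.exp (-(m * t)) * ((m * t) ^ n / (n.factorial : ℝ))) := by
    intro n
    rw [← ENNReal.ofReal_natCast, ← hm, ← ENNReal.ofReal_pow hm0,
      ← ENNReal.ofReal_mul (by positivity)]
    congr 1
    rw [mul_pow]
    ring
  simp_rw [h1]
  have hs := NormedSpace.expSeries_div_hasSum_exp (𝔸 := ℝ) (m * t)
  rw [← Real.exp_eq_exp_ℝ] at hs
  have hs' := hs.mul_left (Real.exp (-(m * t)))
  rw [← ENNReal.ofReal_tsum_of_nonneg (fun n => by positivity) hs'.summable, hs'.tsum_eq,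
    ← Real.exp_add]
  simp

/-- Integrals against `P_t^x` are given by the Poisson series. -/
theorem integral_law (N : ℕ) (α : ℝ) (hα : 0 < α) (f : (Fin (N - 1) → ℝ) → ℝ) (hf : Measurable f)
    (K : ℝ) (hK : ∀ y, |f y| ≤ K) (t : ℝ) (ht : 0 ≤ t) (x : Fin (N - 1) → ℝ) :
    ∫ y, f y ∂law N α t x = Real.exp (-(((N - 1 : ℕ) : ℝ) * t)) *
      ∑' n : ℕ, t ^ n / (n.factorial : ℝ) * ∫ y, f y ∂updateKernel N α n x := by
  have := isProbabilityMeasure_law N α hα t ht x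
  have hi : Integrable f (law N α t x) :=
    Integrable.of_bound hf.aestronglyMeasurable K (Filter.Eventually.of_forall hK)
  rw [law, integral_sum_measure hi, ← tsum_mul_left]
  refine tsum_congr fun n => ?_
  rw [integral_smul_measure, ENNReal.toReal_ofReal (by positivity), smul_eq_mul, mul_assoc]

theorem law_zero (N : ℕ) (α : ℝ) (x : Fin (N - 1) → ℝ) : law N α 0 x = Measure.dirac x := by
  ext s hs
  rw [law, Measure.sum_apply _ hs, tsum_eq_single 0]
  · simp [updateKernel, Kernel.id_apply]
  · intro n hn
    simp [hn]

theorem integral_updateKernel_succ (N : ℕ) (α : ℝ) (hα : 0 < α) (f : (Fin (N - 1) → ℝ) → ℝ)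
    (hf : Measurable f) (K : ℝ) (hK : ∀ y, |f y| ≤ K) (n : ℕ) (x : Fin (N - 1) → ℝ) :
    ∫ y, f y ∂updateKernel N α (n + 1) x =
      ∫ y, (generator N α f y + ((N - 1 : ℕ) : ℝ) * f y) ∂updateKernel N α n x := by
  have hβ := isProbabilityMeasureBeta hα hα
  have hfin : ∀ n, IsFiniteMeasure (updateKernel N α n x) := fun n =>
    ⟨by rw [updateKernel_univ N α hα]; exact ENNReal.pow_lt_top (ENNReal.natCast_lt_top _)⟩
  have hint : Integrable f (updateKernel N α (n + 1) x) :=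
    Integrable.of_bound hf.aestronglyMeasurable K (Filter.Eventually.of_forall hK)
  have hr : ∀ i y, Measurable (resample N y i) := fun i y =>
    (measurable_resample N i).comp measurable_prodMk_left
  rw [updateKernel] at hint ⊢
  rw [Kernel.integral_comp hint]
  refine integral_congr_ae (Filter.Eventually.of_forall fun y => ?_)
  have h1 : (∑ i, resampleKernel N α i) y = ∑ i, (betaMeasure α α).map (resample N y i) := by
    rw [sum_apply]
    exact Finset.sum_congr rfl fun i _ => resampleKernel_apply N α hα i y
  have hI : ∀ i, Integrable (fun u => f (resample N y i u)) (betaMeasure α α) := fun i =>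
    Integrable.of_bound (hf.comp (hr i y)).aestronglyMeasurable K
      (Filter.Eventually.of_forall fun u => hK _)
  simp only [h1, generator]
  rw [integral_finsetSum_measure]
  · simp_rw [integral_sub (hI _) (integrable_const _)]
    rw [Finset.sum_sub_distrib]
    have : ∀ i, ∫ z, f z ∂(betaMeasure α α).map (resample N y i) =
        ∫ u, f (resample N y i u) ∂betaMeasure α α := fun i =>
      integral_map (hr i y).aemeasurable hf.aestronglyMeasurable
    simp [this]
  · intro i _
    exact (integrable_map_measure hf.aestronglyMeasurable (hr i y).aemeasurable).2 (hI i)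

theorem measurable_generator (N : ℕ) (α : ℝ) (hα : 0 < α) (f : (Fin (N - 1) → ℝ) → ℝ)
    (hf : Measurable f) : Measurable (generator N α f) := by
  have hβ := isProbabilityMeasureBeta hα hα
  refine Finset.measurable_sum _ fun i _ => StronglyMeasurable.measurable ?_
  refine StronglyMeasurable.integral_prod_right' (f := fun p : (Fin (N - 1) → ℝ) × ℝ =>
    f (resample N p.1 i p.2) - f p.1) ?_
  exact ((hf.comp (measurable_resample N i)).sub (hf.comp measurable_fst)).stronglyMeasurable

theorem abs_generator_le (N : ℕ) (α : ℝ) (hα : 0 < α) (f : (Fin (N - 1) → ℝ) → ℝ) (K : ℝ)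
    (hK : ∀ y, |f y| ≤ K) (x : Fin (N - 1) → ℝ) :
    |generator N α f x| ≤ ((N - 1 : ℕ) : ℝ) * (2 * K) := by
  have hβ := isProbabilityMeasureBeta hα hα
  refine (Finset.abs_sum_le_sum_abs _ _).trans ?_
  have : ∀ i : Fin (N - 1),
      |∫ u, (f (resample N x i u) - f x) ∂(betaMeasure α α)| ≤ 2 * K := by
    intro i
    have h := norm_integral_le_of_norm_le_const (μ := betaMeasure α α)
      (f := fun u => f (resample N x i u) - f x) (C := 2 * K)
      (Filter.Eventually.of_forall fun u => by
        have h1 := abs_sub (f (resample N x i u)) (f x)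
        rw [Real.norm_eq_abs]
        linarith [hK (resample N x i u), hK x])
    simpa using h
  simpa using Finset.sum_le_sum fun i (_ : i ∈ Finset.univ) => this i

/-- Kolmogorov's equation `d/dt P_t f = P_t (L f)` for bounded measurable `f`: the laws `P_t^x` are
those of the continuous time Markov chain with generator `L`. -/
theorem hasDerivAt_integral_law (N : ℕ) (α : ℝ) (hα : 0 < α) (f : (Fin (N - 1) → ℝ) → ℝ)
    (hf : Measurable f) (K : ℝ) (hK : ∀ y, |f y| ≤ K) (x : Fin (N - 1) → ℝ) (t : ℝ) (ht : 0 ≤ t) :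
    HasDerivWithinAt (fun s => ∫ y, f y ∂law N α s x)
      (∫ y, generator N α f y ∂law N α t x) (Set.Ici 0) t := by
  have hfin : ∀ n, IsFiniteMeasure (updateKernel N α n x) := fun n =>
    ⟨by rw [updateKernel_univ N α hα]; exact ENNReal.pow_lt_top (ENNReal.natCast_lt_top _)⟩
  have hK0 : 0 ≤ K := (abs_nonneg _).trans (hK x)
  set m : ℝ := ((N - 1 : ℕ) : ℝ) with hm
  have hm0 : 0 ≤ m := Nat.cast_nonneg _
  set a : ℕ → ℝ := fun n => ∫ y, f y ∂updateKernel N α n x with ha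
  set b : ℕ → ℝ := fun n => ∫ y, generator N α f y ∂updateKernel N α n x with hb
  have hab : ∀ n, a (n + 1) = b n + m * a n := by
    intro n
    simp only [ha, hb]
    rw [integral_updateKernel_succ N α hα f hf K hK, integral_add, integral_const_mul]
    · exact Integrable.of_bound (measurable_generator N α hα f hf).aestronglyMeasurable _
        (Filter.Eventually.of_forall (abs_generator_le N α hα f K hK))
    · exact (Integrable.of_bound hf.aestronglyMeasurable K
        (Filter.Eventually.of_forall hK)).const_mul _
  have habs : ∀ n, |a n| ≤ K * m ^ n := by
    intro n
    have h := norm_integral_le_of_norm_le_const (μ := updateKernel N α n x) (f := f) (C := K)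
      (Filter.Eventually.of_forall hK)
    rw [Measure.real, updateKernel_univ N α hα, ENNReal.toReal_pow, ENNReal.toReal_natCast] at h
    exact h
  have hsum : ∀ s : ℝ, Summable fun n : ℕ => s ^ n / (n.factorial : ℝ) * a n := by
    intro s
    refine Summable.of_norm_bounded
      (g := fun n : ℕ => K * ((|s| * m) ^ n / (n.factorial : ℝ)))
      ((Real.summable_pow_div_factorial _).mul_left K) fun n => ?_
    rw [norm_mul, norm_div, norm_pow, Real.norm_eq_abs, Real.norm_eq_abs, Real.norm_eq_abs,
      Nat.abs_cast, mul_pow]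
    calc |s| ^ n / (n.factorial : ℝ) * |a n| ≤ |s| ^ n / (n.factorial : ℝ) * (K * m ^ n) := by
          gcongr; exact habs n
      _ = _ := by ring
  have hsum' : ∀ s : ℝ, Summable fun n : ℕ => s ^ n / (n.factorial : ℝ) * a (n + 1) := by
    intro s
    refine Summable.of_norm_bounded
      (g := fun n : ℕ => K * m * ((|s| * m) ^ n / (n.factorial : ℝ)))
      ((Real.summable_pow_div_factorial _).mul_left (K * m)) fun n => ?_
    rw [norm_mul, norm_div, norm_pow, Real.norm_eq_abs, Real.norm_eq_abs, Real.norm_eq_abs,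
      Nat.abs_cast, mul_pow]
    calc |s| ^ n / (n.factorial : ℝ) * |a (n + 1)|
          ≤ |s| ^ n / (n.factorial : ℝ) * (K * m ^ (n + 1)) := by
          gcongr; exact habs _
      _ = _ := by ring
  have hder : HasDerivAt (fun s : ℝ => ∑' n : ℕ, s ^ n / (n.factorial : ℝ) * a n)
      (∑' n : ℕ, t ^ n / (n.factorial : ℝ) * a (n + 1)) t := by
    set r : ℝ := |t| + 1 with hr
    have hr0 : 0 ≤ r := by positivity
    have key := hasDerivAt_tsum_of_isPreconnected
      (u := fun n : ℕ => (n : ℝ) * r ^ (n - 1) / (n.factorial : ℝ) * (K * m ^ n))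
      (g := fun (n : ℕ) (s : ℝ) => s ^ n / (n.factorial : ℝ) * a n)
      (g' := fun (n : ℕ) (s : ℝ) => (n : ℝ) * s ^ (n - 1) / (n.factorial : ℝ) * a n)
      (t := Metric.ball (0 : ℝ) r) (y₀ := t) (y := t) ?_ Metric.isOpen_ball
      (convex_ball _ _).isPreconnected ?_ ?_ ?_ (hsum t) ?_
    · have hs0 : Summable fun n : ℕ => (n : ℝ) * t ^ (n - 1) / (n.factorial : ℝ) * a n := by
        rw [← summable_nat_add_iff 1]
        refine (hsum' t).congr fun n => ?_
        rw [Nat.factorial_succ, Nat.add_sub_cancel]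
        push_cast
        field_simp
      have hs1 : ∑' n : ℕ, (n : ℝ) * t ^ (n - 1) / (n.factorial : ℝ) * a n =
          ∑' n : ℕ, t ^ n / (n.factorial : ℝ) * a (n + 1) := by
        rw [hs0.tsum_eq_zero_add]
        simp only [Nat.cast_zero, zero_mul, zero_div, zero_add]
        refine tsum_congr fun n => ?_
        rw [Nat.factorial_succ, Nat.add_sub_cancel]
        push_cast
        field_simp
      rw [← hs1]
      exact key
    · rw [← summable_nat_add_iff 1]
      refine ((Real.summable_pow_div_factorial (r * m)).mul_left (K * m)).congr fun n => ?_
      rw [Nat.factorial_succ, Nat.add_sub_cancel, mul_pow]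
      push_cast
      field_simp
      ring
    · intro n s _
      exact ((hasDerivAt_pow n s).div_const _).mul_const _
    · intro n s hs
      have hs' : |s| ≤ r := by simpa using (Metric.mem_ball.1 hs).le
      rw [norm_mul, norm_div, norm_mul, norm_pow, Real.norm_eq_abs, Real.norm_eq_abs,
        Real.norm_eq_abs, Real.norm_eq_abs, Nat.abs_cast, Nat.abs_cast]
      gcongr
      exact habs n
    · simp [hr]
    · simp [hr]
  have hexp : HasDerivAt (fun s : ℝ => Real.exp (-(m * s))) (-m * Real.exp (-(m * t))) t := by
    have h := ((hasDerivAt_id t).const_mul m).neg.exp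
    simpa [mul_comm] using h
  have hmul := (hexp.mul hder).hasDerivWithinAt (s := Set.Ici 0)
  have hval : ∫ y, generator N α f y ∂law N α t x = -m * Real.exp (-(m * t)) *
      (∑' n : ℕ, t ^ n / (n.factorial : ℝ) * a n) + Real.exp (-(m * t)) *
      (∑' n : ℕ, t ^ n / (n.factorial : ℝ) * a (n + 1)) := by
    rw [integral_law N α hα _ (measurable_generator N α hα f hf) _
      (abs_generator_le N α hα f K hK) t ht]
    have h2 : ∑' n : ℕ, t ^ n / (n.factorial : ℝ) * b n =
        (∑' n : ℕ, t ^ n / (n.factorial : ℝ) * a (n + 1)) -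
          m * ∑' n : ℕ, t ^ n / (n.factorial : ℝ) * a n := by
      rw [← tsum_mul_left, ← (hsum' t).tsum_sub ((hsum t).mul_left m)]
      refine tsum_congr fun n => ?_
      rw [hab]
      ring
    rw [← hm, h2]
    ring
  rw [hval]
  refine hmul.congr_of_mem (fun s hs => ?_) ht
  exact integral_law N α hα f hf K hK s hs x

/-- The equilibrium distribution
`π_{N,α}(dx) = Γ(Nα) / (Γ(α)^N N^{Nα-1}) ∏_{i=1}^N (x_i - x_{i-1})^{α-1} dx` on `Ω_N`. -/
noncomputable def equilibrium (N : ℕ) (α : ℝ) : Measure (Fin (N - 1) → ℝ) :=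
  (volume.restrict (simplex N)).withDensity fun x => ENNReal.ofReal
    (Real.Gamma (N * α) / (Real.Gamma α ^ N * (N : ℝ) ^ ((N : ℝ) * α - 1)) *
      ∏ k ∈ Finset.range N, (height N x (k + 1) - height N x k) ^ (α - 1))

/-- `P_t(A, B) = ∫_A P_t^x(B) π_{N,α}(dx)`. -/
noncomputable def flow (N : ℕ) (α t : ℝ) (A B : Set (Fin (N - 1) → ℝ)) : ℝ :=
  (∫⁻ x in A, law N α t x B ∂equilibrium N α).toReal

/-- The separation distance to equilibrium at time `t`. -/
noncomputable def sepDist (N : ℕ) (α t : ℝ) : ℝ :=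
  1 - sInf {r : ℝ | ∃ A B : Set (Fin (N - 1) → ℝ),
    A ⊆ simplex N ∧ MeasurableSet A ∧ 0 < volume A ∧
    B ⊆ simplex N ∧ MeasurableSet B ∧ 0 < volume B ∧
    r = flow N α t A B / ((equilibrium N α).real A * (equilibrium N α).real B)}

/-- The separation mixing time `inf {t ≥ 0 : d^sep(t) < ε}`; the infimum of the empty set is `+∞`. -/
noncomputable def sepMixingTime (N : ℕ) (α ε : ℝ) : EReal :=
  sInf ((fun t : ℝ => (t : EReal)) '' {t : ℝ | 0 ≤ t ∧ sepDist N α t < ε})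

end AdjacentWalk

/-!
The separation distance at time `t = 2 s` is at least `1 - P_t(A, B) / (π(A) π(B))` for the two
extremal events `A = {x ≥ h⁺}` and `B = {x ≤ h⁻}`, where `h^±_k = k ± (N / 8) sin (π k / N)`. By
reversibility `P_{2s}(A, B) = ∫ P_s 1_A · P_s 1_B dπ` (`setLIntegral_law_two_mul`), and since the
walk preserves the coordinatewise order, `P_s 1_A` is increasing and `P_s 1_B` is decreasing.

Let `D` and `E` be the events that the middle particle is above a low quantile, respectively below
a high quantile, of its equilibrium law. They cover the space and have probability at least
`1 / 2`. The measure `π` conditioned on `D` or on `E` satisfies Harris' inequality, so that the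
integral of the product over `D` is at most `2 ∫_D P_s 1_A dπ ∫_D P_s 1_B dπ`. By reversibility
again, `∫_D P_s 1_B dπ = ∫_B P_s^x(D) π(dx)`, which by monotonicity is at most `P_s^{h⁻}(D) π(B)`;
the same holds for `E`, with `A` and `h⁺` (`setLIntegral_law_two_mul_le`). Hence the ratio is small
as soon as the walk started from `h⁺` is still above the high quantile, and the one started from
`h⁻` below the low quantile, with high probability.

Harris' inequality (`associated_equilibrium_restrict`) has to hold for all `α > 0`, including
`α < 1`, where the density of `π` is not log-concave. It comes from writing `π` as the law of an
increasing function of independent Beta variables, the position of the middle particle being a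
function of one of them (`equilibrium_eq_map`): Harris' inequality holds on a linear order and
passes to products and monotone images.

The sine profile is an eigenvector of the heat equation solved by the mean heights, with eigenvalue
`1 - cos (π / N) ≤ π² / (2 N²)`. The second moments of the increments remain bounded along the walk
(`integral_increment_mul_le`), so that the covariances of the heights are at most a multiple of the
Green function of the discrete Laplacian (`integral_centeredHeight_mul_le`), which is at most
`N / 4`. The middle particle thus stays, up to fluctuations of order `√N`, at the distance
`(N / 8) e^{-(1 - cos (π / N)) s}` from its equilibrium mean. At `t` just below the claimed bound
this distance is at least of order `√N log N`, whereas the quantiles are at distance `√(N / α)`.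
-/

namespace AdjacentWalk

/-! ### Beta distributions -/

theorem lintegral_betaMeasure (p q : ℝ) {f : ℝ → ℝ≥0∞} (hf : Measurable f) :
    ∫⁻ u, f u ∂betaMeasure p q = ∫⁻ u in Set.Ioo (0 : ℝ) 1,
      ENNReal.ofReal (1 / beta p q * u ^ (p - 1) * (1 - u) ^ (q - 1)) * f u := by
  have hm : Measurable (betaPDF p q) := (measurable_betaPDFReal p q).ennreal_ofReal
  rw [betaMeasure, lintegral_withDensity_eq_lintegral_mul _ hm hf,
    ← lintegral_indicator measurableSet_Ioo]
  refine lintegral_congr fun u => ?_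
  by_cases hu : u ∈ Set.Ioo (0 : ℝ) 1
  · rw [Set.indicator_of_mem hu, Pi.mul_apply, betaPDF_of_pos_lt_one hu.1 hu.2]
  · rw [Set.indicator_of_notMem hu, Pi.mul_apply, betaPDF_eq,
      if_neg (c := 0 < u ∧ u < 1) hu]
    simp

theorem ae_mem_Ioo_betaMeasure (p q : ℝ) : ∀ᵐ u ∂betaMeasure p q, u ∈ Set.Ioo (0 : ℝ) 1 := by
  have h : betaMeasure p q (Set.Ioo (0 : ℝ) 1)ᶜ = 0 := by
    rw [← lintegral_indicator_one measurableSet_Ioo.compl,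
      lintegral_betaMeasure p q (measurable_one.indicator measurableSet_Ioo.compl)]
    refine (setLIntegral_congr_fun measurableSet_Ioo fun u hu => ?_).trans lintegral_zero
    rw [Set.indicator_of_notMem (by simpa using hu), mul_zero]
  exact h

/-- The weight `d ^ (p - 1)` of an increment `d ≥ 0`; negative increments get weight `0`. -/
noncomputable def incrWeight (p d : ℝ) : ℝ≥0∞ :=
  if 0 ≤ d then ENNReal.ofReal (d ^ (p - 1)) else 0

@[fun_prop]
theorem measurable_incrWeight (p : ℝ) : Measurable (incrWeight p) :=
  Measurable.ite measurableSet_Ici (by fun_prop) measurable_const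

/-- The affine substitution `t = a + (b - a) u` in Euler's Beta integral. -/
theorem lintegral_incrWeight_mul_incrWeight {p q : ℝ} (hp : 0 < p) (hq : 0 < q) {a b : ℝ}
    (hab : a ≠ b) {f : ℝ → ℝ≥0∞} (hf : Measurable f) :
    ∫⁻ t, incrWeight p (t - a) * incrWeight q (b - t) * f t =
      incrWeight (p + q) (b - a) * ENNReal.ofReal (beta p q) *
        ∫⁻ u, f (a + (b - a) * u) ∂betaMeasure p q := by
  rcases lt_or_gt_of_ne hab with hab | hab
  · have h1 : ∫⁻ t, incrWeight p (t - a) * incrWeight q (b - t) * f t =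
        ∫⁻ t in Set.Ioo a b, ENNReal.ofReal ((t - a) ^ (p - 1) * (b - t) ^ (q - 1)) * f t := by
      rw [setLIntegral_congr Ioo_ae_eq_Icc, ← lintegral_indicator measurableSet_Icc]
      refine lintegral_congr fun t => ?_
      by_cases h : t ∈ Set.Icc a b
      · rw [Set.indicator_of_mem h, incrWeight, incrWeight, if_pos (by linarith [h.1]),
          if_pos (by linarith [h.2]), ENNReal.ofReal_mul]
        exact Real.rpow_nonneg (by linarith [h.1]) _
      · rw [Set.indicator_of_notMem h]
        simp only [Set.mem_Icc, not_and_or, not_le] at h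
        rcases h with h | h
        · rw [incrWeight, if_neg (by linarith)]; simp
        · rw [incrWeight, incrWeight, if_neg (c := 0 ≤ b - t) (by linarith)]; simp
    have him : (fun u : ℝ => a + (b - a) * u) '' Set.Ioo 0 1 = Set.Ioo a b := by
      have : (fun u : ℝ => a + (b - a) * u) = (fun u => a + u) ∘ (fun u => (b - a) * u) := rfl
      rw [this, Set.image_comp, Set.image_mul_left_Ioo (by linarith), Set.image_const_add_Ioo]
      simp
    have hd : ∀ u ∈ Set.Ioo (0 : ℝ) 1,
        HasDerivWithinAt (fun u : ℝ => a + (b - a) * u) (b - a) (Set.Ioo 0 1) u := by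
      intro u _
      have := (((hasDerivAt_id u).const_mul (b - a)).const_add a).hasDerivWithinAt
        (s := Set.Ioo (0 : ℝ) 1)
      simpa using this
    have hinj : Set.InjOn (fun u : ℝ => a + (b - a) * u) (Set.Ioo 0 1) := by
      intro u _ v _ h
      have h' : (b - a) * u = (b - a) * v := by simpa using h
      exact mul_left_cancel₀ (by linarith) h'
    rw [h1, ← him, lintegral_image_eq_lintegral_abs_deriv_mul measurableSet_Ioo hd hinj,
      lintegral_betaMeasure p q (f := fun u => f (a + (b - a) * u)) (by fun_prop),
      incrWeight, if_pos (by linarith),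
      ← lintegral_const_mul' _ _ (ENNReal.mul_ne_top ENNReal.ofReal_ne_top ENNReal.ofReal_ne_top)]
    refine setLIntegral_congr_fun measurableSet_Ioo fun u hu => ?_
    have hba : 0 < b - a := by linarith
    have hB := beta_pos hp hq
    rw [← mul_assoc, ← mul_assoc, ← ENNReal.ofReal_mul (abs_nonneg _),
      ← ENNReal.ofReal_mul (by positivity), ← ENNReal.ofReal_mul (by positivity)]
    congr 2
    rw [abs_of_pos hba, show a + (b - a) * u - a = (b - a) * u by ring,
      show b - (a + (b - a) * u) = (b - a) * (1 - u) by ring,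
      Real.mul_rpow hba.le hu.1.le, Real.mul_rpow hba.le (by linarith [hu.2]),
      show p + q - 1 = 1 + (p - 1) + (q - 1) by ring, Real.rpow_add hba, Real.rpow_add hba,
      Real.rpow_one]
    field_simp
  · rw [incrWeight, if_neg (by linarith), zero_mul, zero_mul]
    refine (lintegral_congr fun t => ?_).trans lintegral_zero
    rcases lt_or_ge t a with h | h
    · rw [incrWeight, if_neg (by linarith)]; simp
    · rw [incrWeight, incrWeight, if_neg (c := 0 ≤ b - t) (by linarith)]; simp

/-- Multiplying the Beta density by `u ^ k (1 - u) ^ l` shifts its parameters. -/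
theorem integral_rpow_betaMeasure {p q k l : ℝ} (hp : 0 < p) (hq : 0 < q) (hk : 0 ≤ k)
    (hl : 0 ≤ l) :
    ∫ u, u ^ k * (1 - u) ^ l ∂betaMeasure p q = beta (p + k) (q + l) / beta p q := by
  have hB := beta_pos hp hq
  have hB' := beta_pos (add_pos_of_pos_of_nonneg hp hk) (add_pos_of_pos_of_nonneg hq hl)
  rw [integral_eq_lintegral_of_nonneg_ae]
  · rw [lintegral_betaMeasure p q (by fun_prop)]
    have h := isProbabilityMeasureBeta (add_pos_of_pos_of_nonneg hp hk)
      (add_pos_of_pos_of_nonneg hq hl)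
    have h1 : ∫⁻ _u, 1 ∂betaMeasure (p + k) (q + l) = 1 := by simp
    rw [lintegral_betaMeasure _ _ measurable_const] at h1
    have h2 : ∫⁻ u in Set.Ioo (0 : ℝ) 1,
        ENNReal.ofReal (1 / beta p q * u ^ (p - 1) * (1 - u) ^ (q - 1)) *
          ENNReal.ofReal (u ^ k * (1 - u) ^ l) =
        ∫⁻ u in Set.Ioo (0 : ℝ) 1, ENNReal.ofReal (beta (p + k) (q + l) / beta p q) *
          (ENNReal.ofReal (1 / beta (p + k) (q + l) * u ^ (p + k - 1) *
            (1 - u) ^ (q + l - 1)) * 1) := by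
      refine setLIntegral_congr_fun measurableSet_Ioo fun u hu => ?_
      have h0 : 0 < 1 - u := by linarith [hu.2]
      have h0' := hu.1
      rw [mul_one, ← ENNReal.ofReal_mul (by positivity), ← ENNReal.ofReal_mul (by positivity)]
      congr 1
      rw [show p + k - 1 = (p - 1) + k by ring, show q + l - 1 = (q - 1) + l by ring,
        Real.rpow_add hu.1, Real.rpow_add h0]
      field_simp
    rw [h2, lintegral_const_mul' _ _ ENNReal.ofReal_ne_top, h1, mul_one,
      ENNReal.toReal_ofReal (by positivity)]
  · filter_upwards [ae_mem_Ioo_betaMeasure p q] with u hu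
    exact mul_nonneg (Real.rpow_nonneg hu.1.le _) (Real.rpow_nonneg (by linarith [hu.2]) _)
  · exact Measurable.aestronglyMeasurable (by fun_prop)

theorem integral_id_betaMeasure {p q : ℝ} (hp : 0 < p) (hq : 0 < q) :
    ∫ u, u ∂betaMeasure p q = p / (p + q) := by
  have h := integral_rpow_betaMeasure hp hq zero_le_one le_rfl
  simp only [Real.rpow_one, Real.rpow_zero, mul_one, add_zero] at h
  have h1 := Real.Gamma_pos_of_pos hp
  have h2 := Real.Gamma_pos_of_pos hq
  have h3 := Real.Gamma_pos_of_pos (add_pos hp hq)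
  rw [h, beta, beta, show p + 1 + q = p + q + 1 by ring, Real.Gamma_add_one hp.ne',
    Real.Gamma_add_one (by positivity)]
  field_simp

theorem integral_sq_betaMeasure {p q : ℝ} (hp : 0 < p) (hq : 0 < q) :
    ∫ u, u ^ 2 ∂betaMeasure p q = p * (p + 1) / ((p + q) * (p + q + 1)) := by
  have h := integral_rpow_betaMeasure hp hq zero_le_two le_rfl
  simp only [Real.rpow_two, Real.rpow_zero, mul_one, add_zero] at h
  have h1 := Real.Gamma_pos_of_pos hp
  have h2 := Real.Gamma_pos_of_pos hq
  have h3 := Real.Gamma_pos_of_pos (add_pos hp hq)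
  rw [h, beta, beta, show p + 2 + q = p + q + 1 + 1 by ring, show p + 2 = p + 1 + 1 by ring,
    Real.Gamma_add_one (s := p + 1) (by positivity), Real.Gamma_add_one hp.ne',
    Real.Gamma_add_one (s := p + q + 1) (by positivity), Real.Gamma_add_one (by positivity)]
  field_simp

/-- The symmetric Beta distribution is invariant under `u ↦ 1 - u`. -/
theorem lintegral_one_sub_betaMeasure (α : ℝ) {f : ℝ → ℝ≥0∞} (hf : Measurable f) :
    ∫⁻ u, f (1 - u) ∂betaMeasure α α = ∫⁻ u, f u ∂betaMeasure α α := by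
  rw [lintegral_betaMeasure _ _ (f := fun u => f (1 - u)) (by fun_prop), lintegral_betaMeasure _ _ hf,
    ← lintegral_indicator measurableSet_Ioo, ← lintegral_indicator measurableSet_Ioo,
    ← lintegral_sub_left_eq_self _ (1 : ℝ)]
  refine lintegral_congr fun u => ?_
  by_cases hu : u ∈ Set.Ioo (0 : ℝ) 1
  · have hu' : 1 - u ∈ Set.Ioo (0 : ℝ) 1 := ⟨by linarith [hu.2], by linarith [hu.1]⟩
    rw [Set.indicator_of_mem hu, Set.indicator_of_mem hu', sub_sub_cancel]
    ring_nf
  · rw [Set.indicator_of_notMem hu, Set.indicator_of_notMem]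
    exact fun h => hu ⟨by linarith [h.2], by linarith [h.1]⟩

/-! ### Association and Harris' inequality -/

/-- Harris' correlation inequality for the measure `μ`, written without subtraction: a monotone and
an antitone function are negatively correlated under `μ`. -/
def Associated {X : Type*} [MeasurableSpace X] [Preorder X] (μ : Measure X) : Prop :=
  ∀ F G : X → ℝ≥0∞, Measurable F → Measurable G → Monotone F → Antitone G →
    μ Set.univ * ∫⁻ x, F x * G x ∂μ ≤ (∫⁻ x, F x ∂μ) * ∫⁻ x, G x ∂μ

/-- Chebyshev's inequality: on a linear order every measure is associated. -/
theorem associated_of_linearOrder {X : Type*} [MeasurableSpace X] [LinearOrder X]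
    (μ : Measure X) [SFinite μ] : Associated μ := by
  intro F G hF hG hFm hGa
  have key : ∀ x y, x ≤ y → F x * G x + F y * G y ≤ F x * G y + F y * G x := by
    intro x y h
    obtain ⟨d, hd⟩ := exists_add_of_le (hFm h)
    obtain ⟨e, he⟩ := exists_add_of_le (hGa h)
    rw [hd, he]
    calc F x * (G y + e) + (F x + d) * G y
        ≤ F x * (G y + e) + (F x + d) * G y + d * e := le_self_add
      _ = _ := by ring
  have hpt : ∀ x y, F x * G x + F y * G y ≤ F x * G y + F y * G x := by
    intro x y
    rcases le_total x y with h | h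
    · exact key x y h
    · rw [add_comm (F x * G x), add_comm (F x * G y)]
      exact key y x h
  have h2 : ∫⁻ x, ∫⁻ y, (F x * G x + F y * G y) ∂μ ∂μ ≤
      ∫⁻ x, ∫⁻ y, (F x * G y + F y * G x) ∂μ ∂μ :=
    lintegral_mono fun x => lintegral_mono fun y => hpt x y
  have e1 : ∫⁻ x, ∫⁻ y, (F x * G x + F y * G y) ∂μ ∂μ =
      2 * (μ Set.univ * ∫⁻ x, F x * G x ∂μ) := by
    have : ∀ x, ∫⁻ y, (F x * G x + F y * G y) ∂μ =
        F x * G x * μ Set.univ + ∫⁻ y, F y * G y ∂μ := fun x => by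
      rw [lintegral_add_left measurable_const, lintegral_const]
    simp_rw [this]
    rw [lintegral_add_right _ measurable_const, lintegral_mul_const _ (by fun_prop),
      lintegral_const]
    ring
  have e2 : ∫⁻ x, ∫⁻ y, (F x * G y + F y * G x) ∂μ ∂μ =
      2 * ((∫⁻ x, F x ∂μ) * ∫⁻ x, G x ∂μ) := by
    have : ∀ x, ∫⁻ y, (F x * G y + F y * G x) ∂μ =
        F x * (∫⁻ y, G y ∂μ) + (∫⁻ y, F y ∂μ) * G x := fun x => by
      rw [lintegral_add_left (hG.const_mul _), lintegral_const_mul _ hG, lintegral_mul_const _ hF]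
    simp_rw [this]
    rw [lintegral_add_left (hF.mul_const _), lintegral_mul_const _ hF, lintegral_const_mul _ hG]
    ring
  rw [e1, e2] at h2
  exact (ENNReal.mul_le_mul_iff_right two_ne_zero ENNReal.ofNat_ne_top).1 h2

theorem Associated.prod {X Y : Type*} [MeasurableSpace X] [Preorder X] [MeasurableSpace Y]
    [Preorder Y] {μ : Measure X} {ν : Measure Y} [SFinite μ] [SFinite ν] (hμ : Associated μ)
    (hν : Associated ν) : Associated (μ.prod ν) := by
  intro F G hF hG hFm hGa
  set f : X → ℝ≥0∞ := fun x => ∫⁻ y, F (x, y) ∂ν with hf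
  set g : X → ℝ≥0∞ := fun x => ∫⁻ y, G (x, y) ∂ν with hg
  have h1 : ∀ x, ν Set.univ * ∫⁻ y, F (x, y) * G (x, y) ∂ν ≤ f x * g x := fun x =>
    hν _ _ (hF.comp measurable_prodMk_left) (hG.comp measurable_prodMk_left)
      (fun y y' h => hFm ⟨le_rfl, h⟩) (fun y y' h => hGa ⟨le_rfl, h⟩)
  have h2 := hμ f g hF.lintegral_prod_right' hG.lintegral_prod_right'
    (fun x x' h => lintegral_mono fun y => hFm ⟨h, le_rfl⟩)
    (fun x x' h => lintegral_mono fun y => hGa ⟨h, le_rfl⟩)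
  rw [lintegral_prod _ hF.aemeasurable, lintegral_prod _ hG.aemeasurable,
    lintegral_prod (fun p => F p * G p) (by fun_prop), ← Set.univ_prod_univ, Measure.prod_prod]
  refine le_trans ?_ h2
  rw [mul_assoc, ← lintegral_const_mul _ (Measurable.lintegral_prod_right'
    (f := fun p => F p * G p) (by fun_prop))]
  refine mul_le_mul_right (lintegral_mono fun x => ?_) _
  exact h1 x

theorem Associated.map {X Y : Type*} [MeasurableSpace X] [Preorder X] [MeasurableSpace Y]
    [Preorder Y] {μ : Measure X} (hμ : Associated μ) {φ : X → Y} (hφ : Measurable φ)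
    (hm : Monotone φ) : Associated (μ.map φ) := by
  intro F G hF hG hFm hGa
  rw [Measure.map_apply hφ MeasurableSet.univ,
    lintegral_map (f := fun y => F y * G y) (by fun_prop) hφ, lintegral_map hF hφ,
    lintegral_map hG hφ]
  exact hμ _ _ (hF.comp hφ) (hG.comp hφ) (hFm.comp hm) (hGa.comp_monotone hm)

theorem measurable_snoc (n : ℕ) :
    Measurable fun p : ℝ × (Fin n → ℝ) => (Fin.snoc p.2 p.1 : Fin (n + 1) → ℝ) := by
  refine measurable_pi_lambda _ fun j => ?_
  refine Fin.lastCases ?_ (fun j => ?_) j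
  · simpa using measurable_fst
  · simp only [Fin.snoc_castSucc]
    fun_prop

theorem snoc_le_snoc {n : ℕ} {x x' : Fin n → ℝ} {t t' : ℝ} (hx : x ≤ x') (ht : t ≤ t') :
    (Fin.snoc x t : Fin (n + 1) → ℝ) ≤ Fin.snoc x' t' := by
  intro j
  refine Fin.lastCases ?_ (fun j => ?_) j
  · simpa using ht
  · simpa using hx j

/-- Splitting the last coordinate off a product measure. -/
theorem map_snoc_pi (n : ℕ) (μ : Fin (n + 1) → Measure ℝ) [∀ i, SigmaFinite (μ i)] :
    ((μ (Fin.last n)).prod (Measure.pi fun i => μ (Fin.castSucc i))).map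
      (fun p : ℝ × (Fin n → ℝ) => (Fin.snoc p.2 p.1 : Fin (n + 1) → ℝ)) = Measure.pi μ := by
  have h := (measurePreserving_piFinSuccAbove μ (Fin.last n)).symm
  have h' := h.map_eq
  simp only [Fin.succAbove_last] at h'
  convert h' using 2
  ext p j
  simp [MeasurableEquiv.piFinSuccAbove]

theorem lintegral_snoc (n : ℕ) {F : (Fin (n + 1) → ℝ) → ℝ≥0∞} (hF : Measurable F) :
    ∫⁻ x, F x = ∫⁻ t : ℝ, ∫⁻ x : Fin n → ℝ, F (Fin.snoc x t) := by
  rw [volume_pi, ← map_snoc_pi, lintegral_map hF (measurable_snoc n),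
    lintegral_prod (fun p : ℝ × (Fin n → ℝ) => F (Fin.snoc p.2 p.1))
      (hF.comp (measurable_snoc n)).aemeasurable]
  rfl

theorem measurable_append {m n : ℕ} :
    Measurable fun p : (Fin m → ℝ) × (Fin n → ℝ) => (Fin.append p.1 p.2 : Fin (m + n) → ℝ) := by
  refine measurable_pi_lambda _ fun j => ?_
  refine Fin.addCases (fun j => ?_) (fun j => ?_) j
  · simp only [Fin.append_left]
    fun_prop
  · simp only [Fin.append_right]
    fun_prop

theorem append_le_append {m n : ℕ} {x x' : Fin m → ℝ} {y y' : Fin n → ℝ} (hx : x ≤ x')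
    (hy : y ≤ y') : Fin.append x y ≤ Fin.append x' y' := by
  intro j
  refine Fin.addCases (fun j => ?_) (fun j => ?_) j
  · simpa using hx j
  · simpa using hy j

theorem lintegral_append (m n : ℕ) {F : (Fin (m + n) → ℝ) → ℝ≥0∞} (hF : Measurable F) :
    ∫⁻ x, F x = ∫⁻ x : Fin m → ℝ, ∫⁻ y : Fin n → ℝ, F (Fin.append x y) := by
  induction n with
  | zero =>
    refine lintegral_congr fun x => ?_
    rw [lintegral_unique]
    rw [Fin.append_right_nil _ _ rfl, volume_pi, Measure.pi_of_empty (x := default), measure_univ,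
      mul_one]
    rfl
  | succ n ih =>
    have h1 : Measurable fun p : (Fin m → ℝ) × ℝ × (Fin n → ℝ) =>
        F (Fin.append p.1 (Fin.snoc p.2.2 p.2.1)) := by
      simp_rw [Fin.append_snoc]
      refine hF.comp ((measurable_snoc (m + n)).comp (f := fun p : (Fin m → ℝ) × ℝ × (Fin n → ℝ) =>
        (p.2.1, Fin.append p.1 p.2.2)) ?_)
      exact measurable_snd.fst.prodMk (measurable_append.comp
        (f := fun p : (Fin m → ℝ) × ℝ × (Fin n → ℝ) => (p.1, p.2.2)) (by fun_prop))
    have h2 : ∀ x : Fin m → ℝ, ∫⁻ y : Fin (n + 1) → ℝ, F (Fin.append x y) =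
        ∫⁻ t : ℝ, ∫⁻ y : Fin n → ℝ, F (Fin.append x (Fin.snoc y t)) := fun x =>
      lintegral_snoc n (hF.comp (measurable_append.comp measurable_prodMk_left))
    simp_rw [h2]
    rw [lintegral_lintegral_swap]
    · refine (lintegral_snoc (m + n) hF).trans ?_
      refine lintegral_congr fun t => ?_
      have hm : Measurable fun x : Fin (m + n) → ℝ => F (Fin.snoc x t) :=
        hF.comp ((measurable_snoc (m + n)).comp (measurable_prodMk_left (x := t)))
      rw [ih hm]
      simp_rw [Fin.append_snoc]
    · exact (Measurable.lintegral_prod_right' (f := fun p : ((Fin m → ℝ) × ℝ) × (Fin n → ℝ) =>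
        F (Fin.append p.1.1 (Fin.snoc p.2 p.1.2)))
        (h1.comp (g := fun p : (Fin m → ℝ) × ℝ × (Fin n → ℝ) =>
          F (Fin.append p.1 (Fin.snoc p.2.2 p.2.1)))
          (f := fun p : ((Fin m → ℝ) × ℝ) × (Fin n → ℝ) => (p.1.1, p.1.2, p.2))
          (by fun_prop))).aemeasurable

theorem associated_pi (n : ℕ) (μ : Fin n → Measure ℝ) [∀ i, SigmaFinite (μ i)] :
    Associated (Measure.pi μ) := by
  induction n with
  | zero =>
    intro F G _ _ _ _
    rw [Measure.pi_of_empty (x := default)]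
    simp [lintegral_dirac]
  | succ n ih =>
    rw [← map_snoc_pi]
    refine ((associated_of_linearOrder _).prod (ih _)).map (measurable_snoc n) ?_
    intro p p' h
    exact snoc_le_snoc h.2 h.1

/-! ### The equilibrium distribution as a chain of Beta variables -/

/-- The density `∏ (x_{k+1} - x_k) ^ (α - 1)` of an ordered chain of `n` points
`a ≤ x_1 ≤ … ≤ x_n ≤ b` with ends pinned at `x_0 = a` and `x_{n+1} = b`. -/
noncomputable def chainWeight (α : ℝ) : (n : ℕ) → ℝ → ℝ → (Fin n → ℝ) → ℝ≥0∞
  | 0, a, b, _ => incrWeight α (b - a)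
  | n + 1, a, b, x =>
    chainWeight α n a (x (Fin.last n)) (Fin.init x) * incrWeight α (b - x (Fin.last n))

/-- The point of the segment between `a` and `b` at the fraction `u` of its length; clamping `u` to
`[0, 1]` and sorting the ends make it monotone in all three arguments. -/
noncomputable def between (a b u : ℝ) : ℝ :=
  (1 - max 0 (min u 1)) * min a b + max 0 (min u 1) * max a b

/-- The chain on `[a, b]` built from the fractions `y`: the last point `x_n` is put at the fraction
`y_n` of `[a, b]`, then `x_{n-1}` at the fraction `y_{n-1}` of `[a, x_n]`, and so on. -/
noncomputable def chainMap : (n : ℕ) → ℝ → ℝ → (Fin n → ℝ) → Fin n → ℝ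
  | 0, _, _, y => y
  | n + 1, a, b, y =>
    Fin.snoc (chainMap n a (between a b (y (Fin.last n))) (Fin.init y))
      (between a b (y (Fin.last n)))

/-- The law of the fractions of a chain of `n` points: independent Beta variables. -/
noncomputable def chainLaw (α : ℝ) (n : ℕ) : Measure (Fin n → ℝ) :=
  Measure.pi fun j : Fin n => betaMeasure (((j : ℕ) + 1) * α) α

theorem between_mono {a a' b b' u u' : ℝ} (ha : a ≤ a') (hb : b ≤ b') (hu : u ≤ u') :
    between a b u ≤ between a' b' u' := by
  unfold between
  have h1 : max 0 (min u 1) ≤ max 0 (min u' 1) := by gcongr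
  have h2 : min a b ≤ min a' b' := by gcongr
  have h3 : max a b ≤ max a' b' := by gcongr
  have h4 : min a b ≤ max a b := min_le_max
  have h5 : 0 ≤ max 0 (min u 1) := le_max_left _ _
  have h6 : max 0 (min u' 1) ≤ 1 := by simp
  nlinarith

@[fun_prop]
theorem measurable_between : Measurable fun p : ℝ × ℝ × ℝ => between p.1 p.2.1 p.2.2 := by
  unfold between
  fun_prop

theorem between_eq {a b u : ℝ} (hab : a ≤ b) (hu : u ∈ Set.Ioo (0 : ℝ) 1) :
    between a b u = a + (b - a) * u := by
  rw [between, min_eq_left hu.2.le, max_eq_right hu.1.le, min_eq_left hab, max_eq_right hab]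
  ring

theorem measurable_init (n : ℕ) :
    Measurable fun y : Fin (n + 1) → ℝ => (Fin.init y : Fin n → ℝ) :=
  measurable_pi_lambda _ fun j => measurable_pi_apply (Fin.castSucc j)

theorem measurable_chainWeight (α : ℝ) (n : ℕ) (a : ℝ) :
    Measurable fun p : ℝ × (Fin n → ℝ) => chainWeight α n a p.1 p.2 := by
  induction n with
  | zero => simp only [chainWeight]; fun_prop
  | succ n ih =>
    simp only [chainWeight]
    refine Measurable.mul (ih.comp (f := fun p : ℝ × (Fin (n + 1) → ℝ) =>
      (p.2 (Fin.last n), (Fin.init p.2 : Fin n → ℝ))) ?_) (by fun_prop)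
    exact Measurable.prodMk (by fun_prop) ((measurable_init n).comp measurable_snd)

theorem measurable_chainMap (n : ℕ) :
    Measurable fun p : ℝ × ℝ × (Fin n → ℝ) => chainMap n p.1 p.2.1 p.2.2 := by
  induction n with
  | zero => simp only [chainMap]; fun_prop
  | succ n ih =>
    simp only [chainMap]
    have hb : Measurable fun p : ℝ × ℝ × (Fin (n + 1) → ℝ) =>
        between p.1 p.2.1 (p.2.2 (Fin.last n)) :=
      measurable_between.comp (f := fun p : ℝ × ℝ × (Fin (n + 1) → ℝ) =>
        (p.1, p.2.1, p.2.2 (Fin.last n))) (by fun_prop)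
    refine (measurable_snoc n).comp (f := fun p : ℝ × ℝ × (Fin (n + 1) → ℝ) =>
      (between p.1 p.2.1 (p.2.2 (Fin.last n)),
        chainMap n p.1 (between p.1 p.2.1 (p.2.2 (Fin.last n))) (Fin.init p.2.2))) ?_
    refine hb.prodMk (ih.comp (f := fun p : ℝ × ℝ × (Fin (n + 1) → ℝ) =>
      (p.1, between p.1 p.2.1 (p.2.2 (Fin.last n)), (Fin.init p.2.2 : Fin n → ℝ))) ?_)
    exact measurable_fst.prodMk (hb.prodMk ((measurable_init n).comp measurable_snd.snd))

theorem chainMap_mono (n : ℕ) {a a' b b' : ℝ} {y y' : Fin n → ℝ} (ha : a ≤ a') (hb : b ≤ b')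
    (hy : y ≤ y') : chainMap n a b y ≤ chainMap n a' b' y' := by
  induction n generalizing b b' with
  | zero => exact hy
  | succ n ih =>
    have h := between_mono ha hb (hy (Fin.last n))
    exact snoc_le_snoc (ih h fun j => hy (Fin.castSucc j)) h

theorem isProbabilityMeasure_chainLaw {α : ℝ} (hα : 0 < α) (n : ℕ) :
    IsProbabilityMeasure (chainLaw α n) := by
  have : ∀ j : Fin n, IsProbabilityMeasure (betaMeasure (((j : ℕ) + 1) * α) α) := fun j =>
    isProbabilityMeasureBeta (by positivity) hα
  rw [chainLaw]
  infer_instance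

theorem lintegral_chainLaw_succ {α : ℝ} (hα : 0 < α) (n : ℕ) {F : (Fin (n + 1) → ℝ) → ℝ≥0∞}
    (hF : Measurable F) :
    ∫⁻ y, F y ∂chainLaw α (n + 1) =
      ∫⁻ u, ∫⁻ y, F (Fin.snoc y u) ∂chainLaw α n ∂betaMeasure ((n + 1) * α) α := by
  have : ∀ j : Fin (n + 1), IsProbabilityMeasure (betaMeasure (((j : ℕ) + 1) * α) α) := fun j =>
    isProbabilityMeasureBeta (by positivity) hα
  have h := isProbabilityMeasure_chainLaw hα n
  rw [chainLaw, ← map_snoc_pi, lintegral_map hF (measurable_snoc n)]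
  exact lintegral_prod (fun p : ℝ × (Fin n → ℝ) => F (Fin.snoc p.2 p.1))
    (hF.comp (measurable_snoc n)).aemeasurable

/-- Peeling off the last point of a chain leaves a scaled chain of one point less, so that a chain is
built from independent Beta variables. -/
theorem lintegral_chainWeight_mul {α : ℝ} (hα : 0 < α) (n : ℕ) {a b : ℝ} (hab : a ≠ b)
    {F : (Fin n → ℝ) → ℝ≥0∞} (hF : Measurable F) :
    ∫⁻ x, chainWeight α n a b x * F x =
      incrWeight ((n + 1) * α) (b - a) *
        ENNReal.ofReal (Real.Gamma α ^ (n + 1) / Real.Gamma ((n + 1) * α)) *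
        ∫⁻ y, F (chainMap n a b y) ∂chainLaw α n := by
  induction n generalizing b with
  | zero =>
    have := isProbabilityMeasure_chainLaw hα 0
    rw [volume_pi, Measure.pi_of_empty (x := default), lintegral_unique, lintegral_unique,
      measure_univ, measure_univ]
    simp [chainWeight, chainMap, (Real.Gamma_pos_of_pos hα).ne']
  | succ n ih =>
    have := isProbabilityMeasure_chainLaw hα n
    have hmeas : Measurable fun x : Fin (n + 1) → ℝ => chainWeight α (n + 1) a b x * F x :=
      ((measurable_chainWeight α (n + 1) a).comp measurable_prodMk_left).mul hF
    have hs : Measurable fun p : ℝ × (Fin n → ℝ) => F (Fin.snoc (chainMap n a p.1 p.2) p.1) :=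
      hF.comp ((measurable_snoc n).comp (measurable_fst.prodMk
        ((measurable_chainMap n).comp (measurable_const.prodMk
          (measurable_fst.prodMk measurable_snd)))))
    set f : ℝ → ℝ≥0∞ := fun t => ∫⁻ y, F (Fin.snoc (chainMap n a t y) t) ∂chainLaw α n with hf
    have hfm : Measurable f := hs.lintegral_prod_right'
    set C : ℝ≥0∞ := ENNReal.ofReal (Real.Gamma α ^ (n + 1) / Real.Gamma ((n + 1) * α)) with hC
    have h1 : ∫⁻ x, chainWeight α (n + 1) a b x * F x =
        ∫⁻ t, C * (incrWeight ((n + 1) * α) (t - a) * incrWeight α (b - t) * f t) := by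
      rw [lintegral_snoc n hmeas]
      refine lintegral_congr_ae ?_
      have hne : ∀ᵐ t : ℝ, t ≠ a := by simp [ae_iff, measure_singleton]
      filter_upwards [hne] with t ht
      have hFt : Measurable fun x : Fin n → ℝ => F (Fin.snoc x t) :=
        hF.comp ((measurable_snoc n).comp (measurable_prodMk_left (x := t)))
      have h := ih (Ne.symm ht) hFt
      have e : ∀ x : Fin n → ℝ, chainWeight α (n + 1) a b (Fin.snoc x t) * F (Fin.snoc x t) =
          chainWeight α n a t x * F (Fin.snoc x t) * incrWeight α (b - t) := by
        intro x
        simp only [chainWeight, Fin.snoc_last, Fin.init_snoc]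
        ring
      simp_rw [e]
      rw [lintegral_mul_const, h]
      · simp only [hf]
        ring
      · exact ((measurable_chainWeight α n a).comp measurable_prodMk_left).mul hFt
    rw [h1, lintegral_const_mul _ (by fun_prop),
      lintegral_incrWeight_mul_incrWeight (by positivity) hα hab hfm, lintegral_chainLaw_succ hα]
    · have hadd : ((n : ℝ) + 1) * α + α = (((n + 1 : ℕ) : ℝ) + 1) * α := by push_cast; ring
      rw [hadd]
      have hconst : C * ENNReal.ofReal (beta ((n + 1) * α) α) = ENNReal.ofReal
          (Real.Gamma α ^ (n + 1 + 1) / Real.Gamma ((((n + 1 : ℕ) : ℝ) + 1) * α)) := by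
        have g1 := Real.Gamma_pos_of_pos hα
        have g2 := Real.Gamma_pos_of_pos (show 0 < ((n : ℝ) + 1) * α by positivity)
        rw [hC, ← ENNReal.ofReal_mul (by positivity), beta, hadd]
        congr 1
        field_simp
        ring
      rw [← hconst]
      rcases lt_or_gt_of_ne hab with h | h
      · have : ∫⁻ u, ∫⁻ y, F (chainMap (n + 1) a b (Fin.snoc y u)) ∂chainLaw α n
            ∂betaMeasure ((n + 1) * α) α =
            ∫⁻ u, f (a + (b - a) * u) ∂betaMeasure ((n + 1) * α) α := by
          refine lintegral_congr_ae ?_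
          filter_upwards [ae_mem_Ioo_betaMeasure ((n + 1) * α) α] with u hu
          simp only [chainMap, Fin.snoc_last, Fin.init_snoc, between_eq h.le hu, hf]
        rw [this]
        ring
      · rw [incrWeight, if_neg (by linarith)]
        simp
    · exact hF.comp ((measurable_chainMap (n + 1)).comp
        (measurable_const.prodMk (measurable_const.prodMk measurable_id)))

theorem chainWeight_append_snoc (α : ℝ) (p q : ℕ) (a z b : ℝ) (x : Fin p → ℝ) (y : Fin q → ℝ) :
    chainWeight α (p + 1 + q) a b (Fin.append (Fin.snoc x z : Fin (p + 1) → ℝ) y) =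
      chainWeight α p a z x * chainWeight α q z b y := by
  induction q generalizing b with
  | zero =>
    rw [Fin.append_right_nil _ _ rfl]
    change chainWeight α (p + 1) a b (Fin.snoc x z) = _
    simp [chainWeight]
  | succ q ih =>
    rw [← Fin.snoc_init_self y, Fin.append_snoc]
    change chainWeight α (p + 1 + q + 1) a b (Fin.snoc _ _) = _
    simp only [chainWeight, Fin.snoc_last, Fin.init_snoc]
    rw [ih, mul_assoc]

theorem chainWeight_eq_prod (α : ℝ) (n : ℕ) (a b : ℝ) (x : Fin n → ℝ) (H : ℕ → ℝ) (h0 : H 0 = a)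
    (hx : ∀ j : Fin n, H (j + 1) = x j) (hb : H (n + 1) = b) :
    chainWeight α n a b x = ∏ k ∈ Finset.range (n + 1), incrWeight α (H (k + 1) - H k) := by
  induction n generalizing b with
  | zero => simp [chainWeight, h0, ← hb]
  | succ n ih =>
    have h1 := hx (Fin.last n)
    rw [chainWeight, Finset.prod_range_succ, hb, ih (x (Fin.last n)) (Fin.init x)
      (fun j => hx (Fin.castSucc j)) h1, ← h1]
    simp

theorem measurableSet_simplex (N : ℕ) : MeasurableSet (simplex N) := by
  have : simplex N = ⋂ k, ⋂ (_ : k < N), {x | height N x k ≤ height N x (k + 1)} := by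
    ext x; simp [simplex]
  rw [this]
  exact MeasurableSet.iInter fun k => MeasurableSet.iInter fun _ =>
    measurableSet_le (measurable_height N k) (measurable_height N (k + 1))

theorem lintegral_equilibrium (n : ℕ) {α : ℝ} (hα : 0 < α) {F : (Fin n → ℝ) → ℝ≥0∞}
    (hF : Measurable F) :
    ∫⁻ x, F x ∂equilibrium (n + 1) α =
      ENNReal.ofReal (Real.Gamma ((n + 1) * α) /
        (Real.Gamma α ^ (n + 1) * ((n : ℝ) + 1) ^ (((n : ℝ) + 1) * α - 1))) *
      ∫⁻ x : Fin n → ℝ, chainWeight α n 0 (n + 1) x * F x := by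
  have hg := Real.Gamma_pos_of_pos hα
  have hg' := Real.Gamma_pos_of_pos (show 0 < ((n : ℝ) + 1) * α by positivity)
  set c : ℝ := Real.Gamma ((n + 1) * α) /
    (Real.Gamma α ^ (n + 1) * ((n : ℝ) + 1) ^ (((n : ℝ) + 1) * α - 1)) with hc
  have hc0 : 0 ≤ c := by positivity
  have hh : ∀ k, Measurable fun x : Fin n → ℝ => height (n + 1) x k := measurable_height (n + 1)
  have hS : MeasurableSet (simplex (n + 1) : Set (Fin n → ℝ)) := measurableSet_simplex (n + 1)
  have hd : Measurable fun x : Fin n → ℝ => ENNReal.ofReal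
    (Real.Gamma ((n + 1 : ℕ) * α) / (Real.Gamma α ^ (n + 1) *
      ((n + 1 : ℕ) : ℝ) ^ (((n + 1 : ℕ) : ℝ) * α - 1)) *
      ∏ k ∈ Finset.range (n + 1), (height (n + 1) x (k + 1) - height (n + 1) x k) ^ (α - 1)) := by
    refine Measurable.ennreal_ofReal (Measurable.const_mul (Finset.measurable_prod _ fun k _ => ?_) _)
    exact ((hh (k + 1)).sub (hh k)).pow_const _
  have hw : ∀ x : Fin n → ℝ, chainWeight α n 0 (n + 1) x =
      ∏ k ∈ Finset.range (n + 1), incrWeight α (height (n + 1) x (k + 1) - height (n + 1) x k) := by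
    intro x
    refine chainWeight_eq_prod α n 0 _ x _ (by simp [height]) (fun j => ?_) ?_
    · simp [height]
    · simp [height]
  have hcw : Measurable fun x : Fin n → ℝ => chainWeight α n 0 (n + 1) x * F x :=
    ((measurable_chainWeight α n 0).comp measurable_prodMk_left).mul hF
  rw [← lintegral_const_mul _ hcw]
  refine (lintegral_withDensity_eq_lintegral_mul _ hd hF).trans ?_
  refine (lintegral_indicator hS _).symm.trans ?_
  refine lintegral_congr fun x => ?_
  by_cases hx : x ∈ (simplex (n + 1) : Set (Fin n → ℝ))
  · rw [Set.indicator_of_mem hx, Pi.mul_apply, hw, ← mul_assoc, hc]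
    congr 1
    push_cast
    rw [ENNReal.ofReal_mul hc0, ENNReal.ofReal_prod_of_nonneg]
    · congr 1
      refine Finset.prod_congr rfl fun k hk => ?_
      rw [incrWeight, if_pos (sub_nonneg.2 (hx k (Finset.mem_range.1 hk)))]
    · intro k hk
      exact Real.rpow_nonneg (sub_nonneg.2 (hx k (Finset.mem_range.1 hk))) _
  · rw [Set.indicator_of_notMem hx, hw]
    have : ∃ k < n + 1, height (n + 1) x (k + 1) < height (n + 1) x k := by
      simpa [simplex] using hx
    obtain ⟨k, hk, hlt⟩ := this
    rw [Finset.prod_eq_zero (Finset.mem_range.2 hk)]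
    · simp
    · rw [incrWeight, if_neg (by linarith)]

/-- The configuration whose coordinate number `p + 1` sits at the fraction `u` of the total height,
while the `p` coordinates below and the `q` coordinates above it form chains with fractions `y`. -/
noncomputable def profileMap (p q : ℕ) (w : ℝ × (Fin p → ℝ) × (Fin q → ℝ)) :
    Fin (p + 1 + q) → ℝ :=
  Fin.append
    (Fin.snoc (chainMap p 0 (between 0 ((p + 1 + q : ℕ) + 1) w.1) w.2.1)
      (between 0 ((p + 1 + q : ℕ) + 1) w.1) : Fin (p + 1) → ℝ)
    (chainMap q (between 0 ((p + 1 + q : ℕ) + 1) w.1) ((p + 1 + q : ℕ) + 1) w.2.2)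

theorem measurable_profileMap (p q : ℕ) : Measurable (profileMap p q) := by
  unfold profileMap
  have hb : Measurable fun w : ℝ × (Fin p → ℝ) × (Fin q → ℝ) =>
      between 0 ((p + 1 + q : ℕ) + 1) w.1 :=
    measurable_between.comp (f := fun w : ℝ × (Fin p → ℝ) × (Fin q → ℝ) =>
      ((0 : ℝ), (((p + 1 + q : ℕ) : ℝ) + 1), w.1)) (by fun_prop)
  refine measurable_append.comp (f := fun w : ℝ × (Fin p → ℝ) × (Fin q → ℝ) =>
    ((Fin.snoc (chainMap p 0 (between 0 ((p + 1 + q : ℕ) + 1) w.1) w.2.1)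
      (between 0 ((p + 1 + q : ℕ) + 1) w.1) : Fin (p + 1) → ℝ),
    chainMap q (between 0 ((p + 1 + q : ℕ) + 1) w.1) ((p + 1 + q : ℕ) + 1) w.2.2))
    (Measurable.prodMk ((measurable_snoc p).comp (hb.prodMk ((measurable_chainMap p).comp
      (measurable_const.prodMk (hb.prodMk measurable_snd.fst))))) ((measurable_chainMap q).comp
      (hb.prodMk (measurable_const.prodMk measurable_snd.snd))))

theorem profileMap_mono (p q : ℕ) : Monotone (profileMap p q) := by
  intro w w' h
  have hb := between_mono (le_refl (0 : ℝ)) (le_refl (((p + 1 + q : ℕ) : ℝ) + 1)) h.1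
  exact append_le_append (snoc_le_snoc (chainMap_mono p le_rfl hb h.2.1) hb)
    (chainMap_mono q hb le_rfl h.2.2)

theorem profileMap_apply (p q : ℕ) (w : ℝ × (Fin p → ℝ) × (Fin q → ℝ)) :
    profileMap p q w (Fin.castAdd q (Fin.last p)) = between 0 ((p + 1 + q : ℕ) + 1) w.1 := by
  simp [profileMap]

/-- The equilibrium distribution is the law of a monotone function of independent Beta variables. -/
theorem equilibrium_eq_map {α : ℝ} (hα : 0 < α) (p q : ℕ) :
    equilibrium (p + 1 + q + 1) α =
      ((betaMeasure ((p + 1) * α) ((q + 1) * α)).prod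
        ((chainLaw α p).prod (chainLaw α q))).map (profileMap p q) := by
  have h1 := isProbabilityMeasure_chainLaw hα p
  have h2 := isProbabilityMeasure_chainLaw hα q
  have h3 := isProbabilityMeasureBeta (show 0 < ((p : ℝ) + 1) * α by positivity)
    (show 0 < ((q : ℝ) + 1) * α by positivity)
  refine Measure.ext_of_lintegral _ fun F (hF : Measurable (F : (Fin (p + 1 + q) → ℝ) → ℝ≥0∞)) => ?_
  set N : ℝ := ((p + 1 + q : ℕ) : ℝ) + 1 with hN
  have hN0 : 0 < N := by positivity
  set c : ℝ := Real.Gamma (N * α) / (Real.Gamma α ^ (p + 1 + q + 1) * N ^ (N * α - 1)) with hc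
  set Cp : ℝ := Real.Gamma α ^ (p + 1) / Real.Gamma ((p + 1) * α) with hCp
  set Cq : ℝ := Real.Gamma α ^ (q + 1) / Real.Gamma ((q + 1) * α) with hCq
  have hcw : Measurable fun x : Fin (p + 1 + q) → ℝ => chainWeight α (p + 1 + q) 0 N x * F x :=
    ((measurable_chainWeight α (p + 1 + q) 0).comp measurable_prodMk_left).mul hF
  -- the integrand once the two chains around the distinguished coordinate `z` are normalised
  set G : ℝ → (Fin p → ℝ) → (Fin q → ℝ) → ℝ≥0∞ := fun z y y' =>
    F (Fin.append (Fin.snoc (chainMap p 0 z y) z : Fin (p + 1) → ℝ) (chainMap q z N y')) with hG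
  have hGm : Measurable fun w : (ℝ × (Fin p → ℝ)) × (Fin q → ℝ) => G w.1.1 w.1.2 w.2 :=
    hF.comp (measurable_append.comp (Measurable.prodMk
      ((measurable_snoc p).comp (measurable_fst.fst.prodMk ((measurable_chainMap p).comp
        (measurable_const.prodMk measurable_fst))))
      ((measurable_chainMap q).comp
        (measurable_fst.fst.prodMk (measurable_const.prodMk measurable_snd)))))
  set g : ℝ → ℝ≥0∞ := fun z => ∫⁻ y, ∫⁻ y', G z y y' ∂chainLaw α q ∂chainLaw α p with hg
  have hgm : Measurable g := hGm.lintegral_prod_right'.lintegral_prod_right'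
  have key : ∫⁻ x, chainWeight α (p + 1 + q) 0 N x * F x =
      ∫⁻ z, ENNReal.ofReal (Cp * Cq) *
        (incrWeight ((p + 1) * α) (z - 0) * incrWeight ((q + 1) * α) (N - z) * g z) := by
    have happ : ∀ x : Fin (p + 1) → ℝ, Measurable fun y : Fin q → ℝ => F (Fin.append x y) :=
      fun x => hF.comp (measurable_append.comp measurable_prodMk_left)
    rw [lintegral_append (p + 1) q hcw, lintegral_snoc p]
    · refine lintegral_congr_ae ?_
      have hne : ∀ᵐ z : ℝ, z ≠ 0 := by simp [ae_iff, measure_singleton]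
      have hne' : ∀ᵐ z : ℝ, z ≠ N := by simp [ae_iff, measure_singleton]
      filter_upwards [hne, hne'] with z hz hz'
      simp_rw [chainWeight_append_snoc, mul_assoc]
      have e1 : ∀ x : Fin p → ℝ, ∫⁻ y : Fin q → ℝ, chainWeight α p 0 z x *
          (chainWeight α q z N y * F (Fin.append (Fin.snoc x z : Fin (p + 1) → ℝ) y)) =
          chainWeight α p 0 z x * (incrWeight ((q + 1) * α) (N - z) * ENNReal.ofReal Cq *
            ∫⁻ y', F (Fin.append (Fin.snoc x z : Fin (p + 1) → ℝ) (chainMap q z N y'))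
              ∂chainLaw α q) := fun x => by
        have hm : Measurable fun y : Fin q → ℝ =>
            chainWeight α q z N y * F (Fin.append (Fin.snoc x z : Fin (p + 1) → ℝ) y) :=
          ((measurable_chainWeight α q z).comp measurable_prodMk_left).mul (happ _)
        rw [lintegral_const_mul _ hm, lintegral_chainWeight_mul hα q hz' (happ _)]
      simp_rw [e1]
      rw [lintegral_chainWeight_mul hα p hz.symm (F := fun x : Fin p → ℝ =>
        incrWeight ((q + 1) * α) (N - z) * ENNReal.ofReal Cq *
            ∫⁻ y', F (Fin.append (Fin.snoc x z : Fin (p + 1) → ℝ) (chainMap q z N y'))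
              ∂chainLaw α q), lintegral_const_mul, ENNReal.ofReal_mul]
      · simp only [hg, hG, hCp]
        ring
      · have := Real.Gamma_pos_of_pos hα
        have := Real.Gamma_pos_of_pos (show 0 < ((p : ℝ) + 1) * α by positivity)
        positivity
      · exact (hGm.comp (f := fun w : (Fin p → ℝ) × (Fin q → ℝ) => ((z, w.1), w.2))
          (by fun_prop)).lintegral_prod_right'
      · refine Measurable.const_mul (Measurable.lintegral_prod_right'
          (f := fun w : (Fin p → ℝ) × (Fin q → ℝ) =>
            F (Fin.append (Fin.snoc w.1 z : Fin (p + 1) → ℝ) (chainMap q z N w.2))) ?_) _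
        exact hF.comp (measurable_append.comp (Measurable.prodMk
          ((measurable_snoc p).comp (measurable_const.prodMk measurable_fst))
          ((measurable_chainMap q).comp
            (measurable_const.prodMk (measurable_const.prodMk measurable_snd)))))
    · exact Measurable.lintegral_prod_right' (f := fun w : (Fin (p + 1) → ℝ) × (Fin q → ℝ) =>
        chainWeight α (p + 1 + q) 0 N (Fin.append w.1 w.2) * F (Fin.append w.1 w.2))
        (hcw.comp measurable_append)
  have hL : ∫⁻ x, F x ∂equilibrium (p + 1 + q + 1) α =
      ENNReal.ofReal c * ∫⁻ x, chainWeight α (p + 1 + q) 0 N x * F x :=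
    lintegral_equilibrium (p + 1 + q) hα hF
  have hR : ∫⁻ w, F (profileMap p q w) ∂(betaMeasure ((p + 1) * α) ((q + 1) * α)).prod
      ((chainLaw α p).prod (chainLaw α q)) =
      ∫⁻ u, g (0 + (N - 0) * u) ∂betaMeasure ((p + 1) * α) ((q + 1) * α) := by
    have hm : Measurable fun w => F (profileMap p q w) := hF.comp (measurable_profileMap p q)
    rw [lintegral_prod _ hm.aemeasurable]
    refine lintegral_congr_ae ?_
    filter_upwards [ae_mem_Ioo_betaMeasure ((p + 1) * α) ((q + 1) * α)] with u hu
    have hmu : Measurable fun y => F (profileMap p q (u, y)) := hm.comp measurable_prodMk_left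
    rw [lintegral_prod _ hmu.aemeasurable]
    simp only [profileMap, hg, hG, ← hN, between_eq hN0.le hu]
  refine hL.trans (Eq.trans ?_ ((lintegral_map hF (measurable_profileMap p q)).trans hR).symm)
  rw [key, lintegral_const_mul _ (by fun_prop),
    lintegral_incrWeight_mul_incrWeight (by positivity) (by positivity) hN0.ne hgm, incrWeight,
    if_pos (by linarith), ← mul_assoc, ← mul_assoc]
  have g1 := Real.Gamma_pos_of_pos hα
  have g2 := Real.Gamma_pos_of_pos (show 0 < ((p : ℝ) + 1) * α by positivity)
  have g3 := Real.Gamma_pos_of_pos (show 0 < ((q : ℝ) + 1) * α by positivity)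
  have g4 := Real.Gamma_pos_of_pos (show 0 < N * α by positivity)
  have hadd : ((p : ℝ) + 1) * α + (q + 1) * α = N * α := by rw [hN]; push_cast; ring
  have hone : ENNReal.ofReal c * ENNReal.ofReal (Cp * Cq) *
      (ENNReal.ofReal ((N - 0) ^ (((p : ℝ) + 1) * α + (q + 1) * α - 1)) *
        ENNReal.ofReal (beta ((p + 1) * α) ((q + 1) * α))) = 1 := by
    rw [← ENNReal.ofReal_mul (by positivity), ← ENNReal.ofReal_mul (by rw [sub_zero]; positivity),
      ← ENNReal.ofReal_mul (by positivity), hadd, beta, hadd, sub_zero, ← ENNReal.ofReal_one]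
    congr 1
    have := Real.rpow_pos_of_pos hN0 (N * α - 1)
    rw [hc, hCp, hCq, show p + 1 + q + 1 = (p + 1) + (q + 1) by ring, pow_add (Real.Gamma α)]
    field_simp
  rw [hone, one_mul]

theorem isProbabilityMeasure_equilibrium {α : ℝ} (hα : 0 < α) (p q : ℕ) :
    IsProbabilityMeasure (equilibrium (p + 1 + q + 1) α) := by
  have h1 := isProbabilityMeasure_chainLaw hα p
  have h2 := isProbabilityMeasure_chainLaw hα q
  have h3 := isProbabilityMeasureBeta (show 0 < ((p : ℝ) + 1) * α by positivity)
    (show 0 < ((q : ℝ) + 1) * α by positivity)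
  rw [equilibrium_eq_map hα]
  exact Measure.isProbabilityMeasure_map (measurable_profileMap p q).aemeasurable

/-- The equilibrium distribution conditioned on the position of one coordinate is associated: its
remaining coordinates form two independent chains. No log-concavity, hence no bound on `α`, is
needed. -/
theorem associated_equilibrium_restrict {α : ℝ} (hα : 0 < α) (p q : ℕ) {S : Set ℝ}
    (hS : MeasurableSet S) :
    Associated ((equilibrium (p + 1 + q + 1) α).restrict
      {x : Fin (p + 1 + q) → ℝ | x (Fin.castAdd q (Fin.last p)) ∈ S}) := by
  have h1 := isProbabilityMeasure_chainLaw hα p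
  have h2 := isProbabilityMeasure_chainLaw hα q
  have h3 := isProbabilityMeasureBeta (show 0 < ((p : ℝ) + 1) * α by positivity)
    (show 0 < ((q : ℝ) + 1) * α by positivity)
  set S' : Set ℝ := {u | between 0 ((p + 1 + q : ℕ) + 1) u ∈ S} with hS'
  have hpre : profileMap p q ⁻¹' {x : Fin (p + 1 + q) → ℝ | x (Fin.castAdd q (Fin.last p)) ∈ S} =
      S' ×ˢ Set.univ := by
    ext w
    simp [profileMap_apply, hS']
  have hms : MeasurableSet {x : Fin (p + 1 + q) → ℝ | x (Fin.castAdd q (Fin.last p)) ∈ S} :=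
    measurable_pi_apply _ hS
  have h4 : ∀ (n : ℕ) (j : Fin n), IsProbabilityMeasure (betaMeasure (((j : ℕ) + 1) * α) α) :=
    fun n j => isProbabilityMeasureBeta (by positivity) hα
  have heq : (equilibrium (p + 1 + q + 1) α).restrict
      {x : Fin (p + 1 + q) → ℝ | x (Fin.castAdd q (Fin.last p)) ∈ S} =
      (((betaMeasure ((p + 1) * α) ((q + 1) * α)).restrict S').prod
        ((chainLaw α p).prod (chainLaw α q))).map (profileMap p q) := by
    rw [equilibrium_eq_map hα]
    refine (Measure.restrict_map (measurable_profileMap p q) hms).trans ?_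
    rw [hpre, ← Measure.prod_restrict, Measure.restrict_univ]
  rw [heq]
  refine Associated.map ?_ (measurable_profileMap p q) (profileMap_mono p q)
  have := h4 p
  have := h4 q
  exact (associated_of_linearOrder _).prod ((associated_pi p _).prod (associated_pi q _))

/-! ### Reversibility -/

theorem height_update (N : ℕ) (x : Fin (N - 1) → ℝ) (i : Fin (N - 1)) (t : ℝ) (k : ℕ) :
    height N (Function.update x i t) k = if k = i + 1 then t else height N x k := by
  unfold height
  by_cases h0 : k = 0
  · simp [h0]
  rw [if_neg h0, if_neg h0]
  by_cases h : k - 1 < N - 1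
  · rw [dif_pos h, dif_pos h, Function.update_apply]
    have : (⟨k - 1, h⟩ : Fin (N - 1)) = i ↔ k = i + 1 := by
      rw [Fin.ext_iff]
      simp only
      omega
    simp only [this]
  · have := i.isLt
    rw [dif_neg h, dif_neg h, if_neg (by omega)]

theorem height_resample (N : ℕ) (x : Fin (N - 1) → ℝ) (i : Fin (N - 1)) (u : ℝ) (k : ℕ) :
    height N (resample N x i u) k =
      if k = i + 1 then u * height N x i + (1 - u) * height N x (i + 2) else height N x k :=
  height_update N x i _ k

theorem resample_update (N : ℕ) (x : Fin (N - 1) → ℝ) (i : Fin (N - 1)) (t u : ℝ) :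
    resample N (Function.update x i t) i u = resample N x i u := by
  rw [resample, resample, height_update, height_update, if_neg (by omega), if_neg (by omega),
    Function.update_idem]

theorem measurable_resample_right (N : ℕ) (x : Fin (N - 1) → ℝ) (i : Fin (N - 1)) :
    Measurable (resample N x i) :=
  (measurable_resample N i).comp measurable_prodMk_left

/-- The sum over the particles of their resampling operators, acting on `ℝ≥0∞`-valued functions. Its
powers are the duals of the kernels `updateKernel`. -/
noncomputable def updateOp (N : ℕ) (α : ℝ) (f : (Fin (N - 1) → ℝ) → ℝ≥0∞) (x : Fin (N - 1) → ℝ) :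
    ℝ≥0∞ :=
  ∑ i, ∫⁻ u, f (resample N x i u) ∂betaMeasure α α

theorem measurable_lintegral_resample (N : ℕ) {α : ℝ} (hα : 0 < α) (i : Fin (N - 1))
    {f : (Fin (N - 1) → ℝ) → ℝ≥0∞} (hf : Measurable f) :
    Measurable fun x => ∫⁻ u, f (resample N x i u) ∂betaMeasure α α := by
  have := isProbabilityMeasureBeta hα hα
  exact (hf.comp (measurable_resample N i)).lintegral_prod_right'

theorem measurable_updateOp (N : ℕ) {α : ℝ} (hα : 0 < α) {f : (Fin (N - 1) → ℝ) → ℝ≥0∞}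
    (hf : Measurable f) : Measurable (updateOp N α f) :=
  Finset.measurable_sum _ fun i _ => measurable_lintegral_resample N hα i hf

theorem measurable_iterate_updateOp (N : ℕ) {α : ℝ} (hα : 0 < α) {f : (Fin (N - 1) → ℝ) → ℝ≥0∞}
    (hf : Measurable f) (n : ℕ) : Measurable ((updateOp N α)^[n] f) := by
  induction n with
  | zero => exact hf
  | succ n ih => rw [Function.iterate_succ_apply']; exact measurable_updateOp N hα ih

theorem lintegral_updateKernel (N : ℕ) {α : ℝ} (hα : 0 < α) {f : (Fin (N - 1) → ℝ) → ℝ≥0∞}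
    (hf : Measurable f) (n : ℕ) (x : Fin (N - 1) → ℝ) :
    ∫⁻ y, f y ∂updateKernel N α n x = (updateOp N α)^[n] f x := by
  induction n generalizing f with
  | zero => simp [updateKernel, Kernel.id_apply, lintegral_dirac' x hf]
  | succ n ih =>
    rw [Function.iterate_succ_apply, ← ih (measurable_updateOp N hα hf), updateKernel,
      Kernel.lintegral_comp _ _ _ hf]
    refine lintegral_congr fun y => ?_
    rw [FunLike.coe_sum, Finset.sum_apply, lintegral_finsetSum_measure]
    refine Finset.sum_congr rfl fun i _ => ?_
    rw [resampleKernel_apply N α hα, lintegral_map hf (measurable_resample_right N y i)]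

/-- The Poisson weight of `n` updates up to time `t`. -/
noncomputable def poissonWeight (N : ℕ) (t : ℝ) (n : ℕ) : ℝ≥0∞ :=
  ENNReal.ofReal (Real.exp (-(((N - 1 : ℕ) : ℝ) * t)) * (t ^ n / (n.factorial : ℝ)))

theorem lintegral_law (N : ℕ) {α : ℝ} (hα : 0 < α) {f : (Fin (N - 1) → ℝ) → ℝ≥0∞}
    (hf : Measurable f) (t : ℝ) (x : Fin (N - 1) → ℝ) :
    ∫⁻ y, f y ∂law N α t x = ∑' n, poissonWeight N t n * (updateOp N α)^[n] f x := by
  rw [law, lintegral_sum_measure]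
  refine tsum_congr fun n => ?_
  rw [lintegral_smul_measure, lintegral_updateKernel N hα hf, smul_eq_mul, poissonWeight]

theorem measurable_lintegral_law (N : ℕ) {α : ℝ} (hα : 0 < α) {f : (Fin (N - 1) → ℝ) → ℝ≥0∞}
    (hf : Measurable f) (t : ℝ) : Measurable fun x => ∫⁻ y, f y ∂law N α t x := by
  simp_rw [lintegral_law N hα hf]
  exact Measurable.tsum fun n => (measurable_iterate_updateOp N hα hf n).const_mul _

theorem sum_antidiagonal_poissonWeight (N : ℕ) {s : ℝ} (hs : 0 ≤ s) (k : ℕ) :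
    ∑ p ∈ Finset.HasAntidiagonal.antidiagonal k, poissonWeight N s p.1 * poissonWeight N s p.2 =
      poissonWeight N (2 * s) k := by
  have h : ∀ n, 0 ≤ Real.exp (-(((N - 1 : ℕ) : ℝ) * s)) * (s ^ n / (n.factorial : ℝ)) :=
    fun n => by positivity
  simp only [poissonWeight]
  simp_rw [← ENNReal.ofReal_mul (h _)]
  rw [← ENNReal.ofReal_sum_of_nonneg fun p _ => mul_nonneg (h _) (h _)]
  congr 1
  have h1 : Real.exp (-(((N - 1 : ℕ) : ℝ) * (2 * s))) =
      Real.exp (-(((N - 1 : ℕ) : ℝ) * s)) * Real.exp (-(((N - 1 : ℕ) : ℝ) * s)) := by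
    rw [← Real.exp_add]; ring_nf
  rw [h1, two_mul, (Commute.all s s).add_pow', Finset.sum_div, Finset.mul_sum]
  refine Finset.sum_congr rfl fun p hp => ?_
  have hp' := Finset.HasAntidiagonal.mem_antidiagonal.1 hp
  have hc := Nat.choose_mul_factorial_mul_factorial (show p.1 ≤ k by omega)
  rw [show k - p.1 = p.2 by omega] at hc
  have hc' : ((k.choose p.1 : ℕ) : ℝ) * p.1.factorial * p.2.factorial = k.factorial := by
    exact_mod_cast hc
  have f1 : ((k.factorial : ℕ) : ℝ) ≠ 0 := by positivity
  have f2 : ((p.1.factorial : ℕ) : ℝ) ≠ 0 := by positivity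
  have f3 : ((p.2.factorial : ℕ) : ℝ) ≠ 0 := by positivity
  rw [nsmul_eq_mul]
  field_simp
  rw [← hc']
  ring

/-- One coordinate of the equilibrium density, its neighbours being fixed, is a scaled symmetric
Beta density. -/
theorem lintegral_chainWeight_update {α : ℝ} (hα : 0 < α) (n : ℕ) (i : Fin n) (x : Fin n → ℝ) :
    ∃ K : ℝ≥0∞, ∀ f : (Fin n → ℝ) → ℝ≥0∞, Measurable f →
      ∫⁻ t, chainWeight α n 0 (n + 1) (Function.update x i t) * f (Function.update x i t) =
        K * ∫⁻ u, f (resample (n + 1) x i u) ∂betaMeasure α α := by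
  set l := height (n + 1) x i with hl
  set r := height (n + 1) x (i + 2) with hr
  set R : ℝ≥0∞ := ∏ k ∈ ((Finset.range (n + 1)).erase i).erase (i + 1),
    incrWeight α (height (n + 1) x (k + 1) - height (n + 1) x k) with hR
  have hw : ∀ t, chainWeight α n 0 (n + 1) (Function.update x i t) =
      R * (incrWeight α (t - l) * incrWeight α (r - t)) := by
    intro t
    have e : ∀ k, height (n + 1) (Function.update x i t : Fin n → ℝ) k =
      if k = i + 1 then t else height (n + 1) x k := height_update (n + 1) x i t
    rw [chainWeight_eq_prod α n 0 _ _ (height (n + 1) (Function.update x i t : Fin n → ℝ))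
      (by simp [height]) (fun j => by simp [height]) (by simp [height])]
    have hi := i.isLt
    rw [← Finset.mul_prod_erase _ _ (Finset.mem_range.2 (show (i : ℕ) < n + 1 by omega)),
      ← Finset.mul_prod_erase _ _ (Finset.mem_erase.2 ⟨show (i : ℕ) + 1 ≠ i by omega,
        Finset.mem_range.2 (show (i : ℕ) + 1 < n + 1 by omega)⟩), e, e, e,
      if_pos rfl, if_neg (by omega), if_neg (by omega), ← mul_assoc, mul_comm]
    congr 1
    refine Finset.prod_congr rfl fun k hk => ?_
    simp only [Finset.mem_erase] at hk
    rw [e, e, if_neg (by omega), if_neg (by omega)]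
  have hres : ∀ u, resample (n + 1) x i u = Function.update x i (u * l + (1 - u) * r) := fun u => rfl
  have hupd : Measurable fun t : ℝ => (Function.update x i t : Fin n → ℝ) :=
    measurable_update x
  by_cases hlr : l = r
  · refine ⟨0, fun f hf => ?_⟩
    rw [zero_mul]
    have hne : ∀ᵐ t : ℝ, t ≠ l := by simp [ae_iff, measure_singleton]
    refine (lintegral_congr_ae ?_).trans lintegral_zero
    filter_upwards [hne] with t ht
    rw [hw, ← hlr]
    rcases lt_or_gt_of_ne ht with h | h
    · rw [incrWeight, if_neg (by linarith)]; simp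
    · rw [incrWeight, incrWeight, if_neg (c := 0 ≤ l - t) (by linarith)]; simp
  · refine ⟨R * (incrWeight (α + α) (r - l) * ENNReal.ofReal (beta α α)), fun f hf => ?_⟩
    simp_rw [hw, mul_assoc R]
    have hfu : Measurable fun t => f (Function.update x i t) := hf.comp hupd
    rw [lintegral_const_mul _ (by fun_prop), lintegral_incrWeight_mul_incrWeight hα hα hlr hfu,
      ← lintegral_one_sub_betaMeasure α (f := fun u => f (Function.update x i (l + (r - l) * u)))
        (by fun_prop)]
    refine congrArg (R * ·) (congrArg (_ * ·) (lintegral_congr fun u => ?_))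
    rw [hres]
    congr 2
    ring

/-- The equilibrium distribution is reversible for the resampling of one particle. -/
theorem lintegral_mul_resample_comm {α : ℝ} (hα : 0 < α) (n : ℕ) (i : Fin n)
    {f g : (Fin n → ℝ) → ℝ≥0∞} (hf : Measurable f) (hg : Measurable g) :
    ∫⁻ x, f x * (∫⁻ u, g (resample (n + 1) x i u) ∂betaMeasure α α) ∂equilibrium (n + 1) α =
      ∫⁻ x, (∫⁻ u, f (resample (n + 1) x i u) ∂betaMeasure α α) * g x ∂equilibrium (n + 1) α := by
  have hRf : Measurable fun x : Fin n → ℝ => ∫⁻ u, f (resample (n + 1) x i u) ∂betaMeasure α α :=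
    measurable_lintegral_resample (n + 1) hα i hf
  have hRg : Measurable fun x : Fin n → ℝ => ∫⁻ u, g (resample (n + 1) x i u) ∂betaMeasure α α :=
    measurable_lintegral_resample (n + 1) hα i hg
  have hupd : ∀ x : Fin n → ℝ, Measurable fun t : ℝ => (Function.update x i t : Fin n → ℝ) :=
    fun x => measurable_update x
  have hW : Measurable fun x : Fin n → ℝ => chainWeight α n 0 (n + 1) x :=
    (measurable_chainWeight α n 0).comp measurable_prodMk_left
  refine (lintegral_equilibrium n hα (hf.mul hRg)).trans (Eq.trans ?_
    (lintegral_equilibrium n hα (hRf.mul hg)).symm)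
  congr 1
  refine lintegral_eq_of_lmarginal_eq {i} (hW.mul (hf.mul hRg)) (hW.mul (hRf.mul hg)) ?_
  rw [lmarginal_singleton, lmarginal_singleton]
  funext x
  obtain ⟨K, hK⟩ := lintegral_chainWeight_update hα n i x
  have e : ∀ (t u : ℝ), resample (n + 1) (Function.update x i t : Fin n → ℝ) i u =
    resample (n + 1) x i u := resample_update (n + 1) x i
  simp only [Pi.mul_apply, e]
  have hfu : Measurable fun t => chainWeight α n 0 (n + 1) (Function.update x i t) *
      f (Function.update x i t) := (hW.comp (hupd x)).mul (hf.comp (hupd x))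
  have hgu : Measurable fun t => chainWeight α n 0 (n + 1) (Function.update x i t) *
      g (Function.update x i t) := (hW.comp (hupd x)).mul (hg.comp (hupd x))
  simp_rw [← mul_assoc]
  rw [lintegral_mul_const _ hfu, hK f hf]
  simp_rw [mul_right_comm _ (∫⁻ u, f (resample (n + 1) x i u) ∂betaMeasure α α)]
  rw [lintegral_mul_const _ hgu, hK g hg]

theorem lintegral_mul_updateOp_comm {α : ℝ} (hα : 0 < α) (n : ℕ)
    {f g : (Fin n → ℝ) → ℝ≥0∞} (hf : Measurable f) (hg : Measurable g) :
    ∫⁻ x, f x * updateOp (n + 1) α g x ∂equilibrium (n + 1) α =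
      ∫⁻ x, updateOp (n + 1) α f x * g x ∂equilibrium (n + 1) α := by
  simp only [updateOp, Finset.mul_sum, Finset.sum_mul]
  rw [lintegral_finsetSum, lintegral_finsetSum]
  · exact Finset.sum_congr rfl fun i _ => lintegral_mul_resample_comm hα n i hf hg
  · exact fun i _ => (measurable_lintegral_resample (n + 1) hα i hf).mul hg
  · exact fun i _ => hf.mul (measurable_lintegral_resample (n + 1) hα i hg)

theorem lintegral_iterate_mul_iterate {α : ℝ} (hα : 0 < α) (n : ℕ)
    {f g : (Fin n → ℝ) → ℝ≥0∞} (hf : Measurable f) (hg : Measurable g) (k l : ℕ) :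
    ∫⁻ x, (updateOp (n + 1) α)^[k] f x * (updateOp (n + 1) α)^[l] g x ∂equilibrium (n + 1) α =
      ∫⁻ x, f x * (updateOp (n + 1) α)^[k + l] g x ∂equilibrium (n + 1) α := by
  induction k generalizing l with
  | zero => simp
  | succ k ih =>
    rw [Function.iterate_succ_apply']
    refine (lintegral_mul_updateOp_comm hα n (measurable_iterate_updateOp (n + 1) hα hf k)
      (measurable_iterate_updateOp (n + 1) hα hg l)).symm.trans ?_
    have h := ih (l + 1)
    rw [Function.iterate_succ_apply'] at h
    rw [h, show k + (l + 1) = k + 1 + l by ring]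

/-- Reversibility and the semigroup property: `⟨f, P_{2s} g⟩ = ⟨P_s f, P_s g⟩` in `L²(π)`. -/
theorem lintegral_mul_law_two_mul {α : ℝ} (hα : 0 < α) (n : ℕ) {f g : (Fin n → ℝ) → ℝ≥0∞}
    (hf : Measurable f) (hg : Measurable g) {s : ℝ} (hs : 0 ≤ s) :
    ∫⁻ x, f x * (∫⁻ y, g y ∂law (n + 1) α (2 * s) x) ∂equilibrium (n + 1) α =
      ∫⁻ x, (∫⁻ y, f y ∂law (n + 1) α s x) * (∫⁻ y, g y ∂law (n + 1) α s x)
        ∂equilibrium (n + 1) α := by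
  have mf := fun k => measurable_iterate_updateOp (n + 1) hα hf k
  have mg := fun k => measurable_iterate_updateOp (n + 1) hα hg k
  set I : ℕ → ℝ≥0∞ := fun k =>
    ∫⁻ x, f x * (updateOp (n + 1) α)^[k] g x ∂equilibrium (n + 1) α with hI
  set w := poissonWeight (n + 1) s with hw
  have hL : ∫⁻ x, f x * (∫⁻ y, g y ∂law (n + 1) α (2 * s) x) ∂equilibrium (n + 1) α =
      ∑' k, poissonWeight (n + 1) (2 * s) k * I k := by
    have e : ∀ x : Fin n → ℝ, f x * (∫⁻ y, g y ∂law (n + 1) α (2 * s) x) =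
        ∑' k, poissonWeight (n + 1) (2 * s) k * (f x * (updateOp (n + 1) α)^[k] g x) := by
      intro x
      rw [lintegral_law (n + 1) hα hg, ← ENNReal.tsum_mul_left]
      exact tsum_congr fun k => by ring
    refine (lintegral_congr e).trans ?_
    have m1 : ∀ k, Measurable fun x : Fin n → ℝ =>
        poissonWeight (n + 1) (2 * s) k * (f x * (updateOp (n + 1) α)^[k] g x) :=
      fun k => (hf.mul (mg k)).const_mul _
    rw [lintegral_tsum fun k => (m1 k).aemeasurable]
    exact tsum_congr fun k => lintegral_const_mul _ (hf.mul (mg k))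
  have hR : ∫⁻ x, (∫⁻ y, f y ∂law (n + 1) α s x) * (∫⁻ y, g y ∂law (n + 1) α s x)
        ∂equilibrium (n + 1) α = ∑' k, ∑' l, w k * w l * I (k + l) := by
    have e : ∀ x : Fin n → ℝ, (∫⁻ y, f y ∂law (n + 1) α s x) * (∫⁻ y, g y ∂law (n + 1) α s x) =
        ∑' k, ∑' l, w k * w l *
          ((updateOp (n + 1) α)^[k] f x * (updateOp (n + 1) α)^[l] g x) := by
      intro x
      rw [lintegral_law (n + 1) hα hg, lintegral_law (n + 1) hα hf, ← ENNReal.tsum_mul_right]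
      refine tsum_congr fun k => ?_
      rw [← ENNReal.tsum_mul_left]
      exact tsum_congr fun l => by ring
    refine (lintegral_congr e).trans ?_
    have m2 : ∀ k l, Measurable fun x : Fin n → ℝ => w k * w l *
        ((updateOp (n + 1) α)^[k] f x * (updateOp (n + 1) α)^[l] g x) :=
      fun k l => ((mf k).mul (mg l)).const_mul _
    rw [lintegral_tsum fun k => (Measurable.tsum fun l => m2 k l).aemeasurable]
    refine tsum_congr fun k => ?_
    rw [lintegral_tsum fun l => (m2 k l).aemeasurable]
    refine tsum_congr fun l => ?_
    exact (lintegral_const_mul _ ((mf k).mul (mg l))).trans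
      (congrArg _ (lintegral_iterate_mul_iterate hα n hf hg k l))
  rw [hL, hR, ← ENNReal.tsum_prod (f := fun k l => w k * w l * I (k + l)),
    ← Finset.HasAntidiagonal.sigmaAntidiagonalEquivProd.tsum_eq, ENNReal.tsum_sigma']
  refine tsum_congr fun k => ?_
  rw [← sum_antidiagonal_poissonWeight (n + 1) hs, Finset.sum_mul, tsum_fintype,
    ← Finset.sum_coe_sort]
  refine Finset.sum_congr rfl fun p _ => ?_
  have hp := Finset.HasAntidiagonal.mem_antidiagonal.1 p.2
  simp only [Finset.HasAntidiagonal.sigmaAntidiagonalEquivProd_apply, hp, hw]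

/-! ### Monotonicity -/

theorem height_mono (N : ℕ) {x y : Fin (N - 1) → ℝ} (h : x ≤ y) (k : ℕ) :
    height N x k ≤ height N y k := by
  unfold height
  split_ifs
  · exact le_rfl
  · exact h _
  · exact le_rfl

theorem resample_mono (N : ℕ) {x y : Fin (N - 1) → ℝ} (h : x ≤ y) (i : Fin (N - 1)) {u : ℝ}
    (hu : u ∈ Set.Ioo (0 : ℝ) 1) : resample N x i u ≤ resample N y i u := by
  refine update_le_update_iff.2 ⟨?_, fun j _ => h j⟩
  have h0 := height_mono N h i
  have h2 := height_mono N h (i + 2)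
  nlinarith [hu.1, hu.2]

theorem updateOp_mono (N : ℕ) (α : ℝ) {f : (Fin (N - 1) → ℝ) → ℝ≥0∞} (hf : Monotone f) :
    Monotone (updateOp N α f) := fun _ _ h => Finset.sum_le_sum fun i _ =>
  lintegral_mono_ae <| (ae_mem_Ioo_betaMeasure α α).mono fun _ hu => hf (resample_mono N h i hu)

theorem updateOp_anti (N : ℕ) (α : ℝ) {f : (Fin (N - 1) → ℝ) → ℝ≥0∞} (hf : Antitone f) :
    Antitone (updateOp N α f) := fun _ _ h => Finset.sum_le_sum fun i _ =>
  lintegral_mono_ae <| (ae_mem_Ioo_betaMeasure α α).mono fun _ hu => hf (resample_mono N h i hu)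

theorem lintegral_law_mono (N : ℕ) {α : ℝ} (hα : 0 < α) {f : (Fin (N - 1) → ℝ) → ℝ≥0∞}
    (hfm : Measurable f) (hf : Monotone f) (t : ℝ) :
    Monotone fun x => ∫⁻ y, f y ∂law N α t x := by
  intro x y h
  simp only [lintegral_law N hα hfm]
  refine ENNReal.tsum_le_tsum fun n => mul_le_mul_right ?_ _
  have : Monotone ((updateOp N α)^[n] f) := by
    induction n with
    | zero => exact hf
    | succ n ih => rw [Function.iterate_succ_apply']; exact updateOp_mono N α ih
  exact this h

theorem lintegral_law_anti (N : ℕ) {α : ℝ} (hα : 0 < α) {f : (Fin (N - 1) → ℝ) → ℝ≥0∞}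
    (hfm : Measurable f) (hf : Antitone f) (t : ℝ) :
    Antitone fun x => ∫⁻ y, f y ∂law N α t x := by
  intro x y h
  simp only [lintegral_law N hα hfm]
  refine ENNReal.tsum_le_tsum fun n => mul_le_mul_right ?_ _
  have : Antitone ((updateOp N α)^[n] f) := by
    induction n with
    | zero => exact hf
    | succ n ih => rw [Function.iterate_succ_apply']; exact updateOp_anti N α ih
  exact this h

theorem resample_mem_simplex {N : ℕ} {x : Fin (N - 1) → ℝ} (hx : x ∈ simplex N)
    (i : Fin (N - 1)) {u : ℝ} (hu : u ∈ Set.Ioo (0 : ℝ) 1) : resample N x i u ∈ simplex N := by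
  intro k hk
  have hi := i.isLt
  have h0 := hx i (by omega)
  have h1 := hx (i + 1) (by omega)
  simp only [height_resample]
  by_cases e1 : k = i + 1
  · rw [if_pos e1, if_neg (by omega), show k + 1 = i + 2 by omega]
    nlinarith [hu.1, hu.2]
  by_cases e2 : k + 1 = i + 1
  · rw [if_neg e1, if_pos e2, show k = i by omega]
    nlinarith [hu.1, hu.2]
  · rw [if_neg e1, if_neg e2]
    exact hx k hk

theorem iterate_updateOp_congr (N : ℕ) (α : ℝ) {f g : (Fin (N - 1) → ℝ) → ℝ≥0∞}
    (h : ∀ x ∈ simplex N, f x = g x) (n : ℕ) {x : Fin (N - 1) → ℝ} (hx : x ∈ simplex N) :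
    (updateOp N α)^[n] f x = (updateOp N α)^[n] g x := by
  induction n generalizing x with
  | zero => exact h x hx
  | succ n ih =>
    rw [Function.iterate_succ_apply', Function.iterate_succ_apply']
    refine Finset.sum_congr rfl fun i _ => lintegral_congr_ae ?_
    filter_upwards [ae_mem_Ioo_betaMeasure α α] with u hu
    exact ih (resample_mem_simplex hx i hu)

/-- The chain started in the simplex only sees the values of `f` on the simplex. -/
theorem lintegral_law_congr (N : ℕ) {α : ℝ} (hα : 0 < α) {f g : (Fin (N - 1) → ℝ) → ℝ≥0∞}
    (hf : Measurable f) (hg : Measurable g) (h : ∀ x ∈ simplex N, f x = g x) (t : ℝ)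
    {x : Fin (N - 1) → ℝ} (hx : x ∈ simplex N) :
    ∫⁻ y, f y ∂law N α t x = ∫⁻ y, g y ∂law N α t x := by
  rw [lintegral_law N hα hf, lintegral_law N hα hg]
  exact tsum_congr fun n => congrArg _ (iterate_updateOp_congr N α h n hx)

theorem ae_mem_simplex (N : ℕ) (α : ℝ) : ∀ᵐ x ∂equilibrium N α, x ∈ simplex N := by
  refine (withDensity_absolutelyContinuous _ _).ae_le ?_
  exact ae_restrict_mem (measurableSet_simplex N)

/-! ### Moments of heights and increments -/

theorem height_zero (N : ℕ) (x : Fin (N - 1) → ℝ) : height N x 0 = 0 := by simp [height]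

theorem height_self {N : ℕ} (hN : 1 ≤ N) (x : Fin (N - 1) → ℝ) : height N x N = N := by
  unfold height
  rw [if_neg (by omega), dif_neg (by omega)]

theorem height_mem_Icc {N : ℕ} (hN : 1 ≤ N) {x : Fin (N - 1) → ℝ} (hx : x ∈ simplex N) {k : ℕ}
    (hk : k ≤ N) : height N x k ∈ Set.Icc (0 : ℝ) N := by
  have hup : ∀ j, k + j ≤ N → height N x k ≤ height N x (k + j) := by
    intro j hj
    induction j with
    | zero => exact le_rfl
    | succ j ih => exact (ih (by omega)).trans (hx (k + j) (by omega))
  have hlow : ∀ j, j ≤ N → 0 ≤ height N x j := by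
    intro j hj
    induction j with
    | zero => rw [height_zero]
    | succ j ih => exact (ih (by omega)).trans (hx j (by omega))
  refine ⟨hlow k hk, ?_⟩
  have h := hup (N - k) (by omega)
  rwa [show k + (N - k) = N by omega, height_self hN] at h

/-- The height of particle `k` relative to its equilibrium mean. -/
noncomputable def centeredHeight (N k : ℕ) (x : Fin (N - 1) → ℝ) : ℝ := height N x k - k

@[fun_prop]
theorem measurable_centeredHeight (N k : ℕ) : Measurable (centeredHeight N k) :=
  (measurable_height N k).sub_const _

theorem abs_centeredHeight_le {N : ℕ} (hN : 1 ≤ N) {x : Fin (N - 1) → ℝ} (hx : x ∈ simplex N)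
    {k : ℕ} (hk : k ≤ N) : |centeredHeight N k x| ≤ N := by
  have h := height_mem_Icc hN hx hk
  have hk' : (k : ℝ) ≤ N := by exact_mod_cast hk
  have hk0 : (0 : ℝ) ≤ k := Nat.cast_nonneg k
  rw [centeredHeight, abs_le]
  constructor <;> linarith [h.1, h.2]

/-- The increment between particles `k` and `k + 1`. -/
noncomputable def increment (N k : ℕ) (x : Fin (N - 1) → ℝ) : ℝ :=
  height N x (k + 1) - height N x k

@[fun_prop]
theorem measurable_increment (N k : ℕ) : Measurable (increment N k) :=
  (measurable_height N _).sub (measurable_height N _)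

theorem abs_increment_le {N : ℕ} (hN : 1 ≤ N) {x : Fin (N - 1) → ℝ} (hx : x ∈ simplex N)
    {k : ℕ} (hk : k < N) : |increment N k x| ≤ N := by
  have h := height_mem_Icc hN hx hk.le
  have h' := height_mem_Icc hN hx (show k + 1 ≤ N from hk)
  rw [increment, abs_le]
  constructor <;> linarith [h.1, h.2, h'.1, h'.2]

theorem centeredHeight_resample (N : ℕ) (x : Fin (N - 1) → ℝ) (i : Fin (N - 1)) (u : ℝ) (k : ℕ) :
    centeredHeight N k (resample N x i u) =
      if k = i + 1 then
        centeredHeight N (i + 2) x + 1 - u * (increment N i x + increment N (i + 1) x)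
      else centeredHeight N k x := by
  unfold centeredHeight increment
  rw [height_resample]
  split_ifs with h
  · rw [h]; push_cast; ring
  · rfl

theorem increment_resample (N : ℕ) (x : Fin (N - 1) → ℝ) (i : Fin (N - 1)) (u : ℝ) (k : ℕ) :
    increment N k (resample N x i u) =
      if k = i then (1 - u) * (increment N i x + increment N (i + 1) x)
      else if k = i + 1 then u * (increment N i x + increment N (i + 1) x)
      else increment N k x := by
  unfold increment
  rw [height_resample, height_resample]
  by_cases h1 : k = i
  · rw [if_pos h1, if_pos (by omega), if_neg (by omega), h1]; ring
  · by_cases h2 : k = i + 1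
    · rw [if_neg h1, if_pos h2, if_pos h2, if_neg (by omega), h2]; ring
    · rw [if_neg h1, if_neg h2, if_neg h2, if_neg (by omega)]

theorem integral_quadratic_betaMeasure {α : ℝ} (hα : 0 < α) (A B C : ℝ) :
    ∫ u, (A + B * u + C * u ^ 2) ∂betaMeasure α α =
      A + B / 2 + C * ((α + 1) / (2 * (2 * α + 1))) := by
  have := isProbabilityMeasureBeta hα hα
  have hb : ∀ n : ℕ, Integrable (fun u : ℝ => u ^ n) (betaMeasure α α) := fun n =>
    Integrable.of_bound (by fun_prop) 1 <| (ae_mem_Ioo_betaMeasure α α).mono fun u hu => by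
      rw [Real.norm_eq_abs, abs_of_nonneg (pow_nonneg hu.1.le n)]
      exact pow_le_one₀ hu.1.le hu.2.le
  have h1 : Integrable (fun u : ℝ => u) (betaMeasure α α) := by simpa using hb 1
  have h1' : Integrable (fun u : ℝ => B * u) (betaMeasure α α) := h1.const_mul B
  have h2' : Integrable (fun u : ℝ => C * u ^ 2) (betaMeasure α α) := (hb 2).const_mul C
  have h3 : Integrable (fun u : ℝ => A + B * u) (betaMeasure α α) := (integrable_const A).add h1'
  rw [integral_add h3 h2', integral_add (integrable_const A) h1',
    integral_const_mul, integral_const_mul, integral_id_betaMeasure hα hα,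
    integral_sq_betaMeasure hα hα]
  simp only [integral_const, probReal_univ, one_smul]
  field_simp
  ring

section Moments

variable {N : ℕ} {α : ℝ} {x : Fin (N - 1) → ℝ}

theorem isFiniteMeasure_updateKernel (hα : 0 < α) (n : ℕ) (x : Fin (N - 1) → ℝ) :
    IsFiniteMeasure (updateKernel N α n x) :=
  ⟨by rw [updateKernel_univ N α hα]; exact ENNReal.pow_lt_top (ENNReal.natCast_lt_top _)⟩

theorem updateKernel_real_univ (hα : 0 < α) (n : ℕ) (x : Fin (N - 1) → ℝ) :
    (updateKernel N α n x).real Set.univ = ((N - 1 : ℕ) : ℝ) ^ n := by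
  rw [Measure.real, updateKernel_univ N α hα, ENNReal.toReal_pow, ENNReal.toReal_natCast]

theorem ae_mem_simplex_updateKernel (hα : 0 < α) (hx : x ∈ simplex N) (n : ℕ) :
    ∀ᵐ y ∂updateKernel N α n x, y ∈ simplex N := by
  have hm := (measurableSet_simplex N).compl
  have h0 : updateKernel N α n x (simplex N)ᶜ = 0 := by
    rw [← lintegral_indicator_one hm, lintegral_updateKernel N hα (measurable_one.indicator hm),
      iterate_updateOp_congr N α (g := fun _ => 0) _ n hx]
    · rw [← lintegral_updateKernel N hα measurable_const, lintegral_zero]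
    · intro y hy
      rw [Set.indicator_of_notMem (by simpa using hy)]
  exact h0

theorem integrable_updateKernel (hα : 0 < α) (hx : x ∈ simplex N) {f : (Fin (N - 1) → ℝ) → ℝ}
    (hf : Measurable f) {K : ℝ} (hK : ∀ y ∈ simplex N, |f y| ≤ K) (n : ℕ) :
    Integrable f (updateKernel N α n x) := by
  have := isFiniteMeasure_updateKernel (N := N) hα n x
  exact Integrable.of_bound hf.aestronglyMeasurable K
    ((ae_mem_simplex_updateKernel hα hx n).mono hK)

/-- One more update, for functions that are bounded on the simplex. -/
theorem integral_updateKernel_succ_of_simplex (hα : 0 < α) (hx : x ∈ simplex N)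
    {f : (Fin (N - 1) → ℝ) → ℝ} (hf : Measurable f) {K : ℝ} (hK : ∀ y ∈ simplex N, |f y| ≤ K)
    (n : ℕ) :
    ∫ y, f y ∂updateKernel N α (n + 1) x =
      ∑ i, ∫ y, ∫ u, f (resample N y i u) ∂betaMeasure α α ∂updateKernel N α n x := by
  have hβ := isProbabilityMeasureBeta hα hα
  have hfin := isFiniteMeasure_updateKernel (N := N) hα n x
  have hK0 : 0 ≤ K := (abs_nonneg _).trans (hK x hx)
  set g : (Fin (N - 1) → ℝ) → ℝ := (simplex N).indicator f with hg
  have hgm : Measurable g := hf.indicator (measurableSet_simplex N)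
  have hgK : ∀ y, |g y| ≤ K := by
    intro y
    by_cases hy : y ∈ simplex N
    · rw [hg, Set.indicator_of_mem hy]; exact hK y hy
    · rw [hg, Set.indicator_of_notMem hy, abs_zero]; exact hK0
  have hgf : ∀ y ∈ simplex N, g y = f y := fun y hy => Set.indicator_of_mem hy f
  have hgr : ∀ y i, Integrable (fun u => g (resample N y i u)) (betaMeasure α α) := fun y i =>
    Integrable.of_bound (hgm.comp (measurable_resample_right N y i)).aestronglyMeasurable K
      (Filter.Eventually.of_forall fun u => hgK _)
  have e1 : ∫ y, f y ∂updateKernel N α (n + 1) x = ∫ y, g y ∂updateKernel N α (n + 1) x :=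
    integral_congr_ae ((ae_mem_simplex_updateKernel hα hx (n + 1)).mono fun y hy => (hgf y hy).symm)
  have e2 : ∀ y, generator N α g y + ((N - 1 : ℕ) : ℝ) * g y =
      ∑ i, ∫ u, g (resample N y i u) ∂betaMeasure α α := by
    intro y
    simp_rw [generator, integral_sub (hgr y _) (integrable_const _)]
    rw [Finset.sum_sub_distrib]
    simp
  have hmg : ∀ i, StronglyMeasurable fun y => ∫ u, g (resample N y i u) ∂betaMeasure α α := fun i =>
    StronglyMeasurable.integral_prod_right' (f := fun p : (Fin (N - 1) → ℝ) × ℝ =>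
      g (resample N p.1 i p.2)) (hgm.comp (measurable_resample N i)).stronglyMeasurable
  rw [e1, integral_updateKernel_succ N α hα g hgm K hgK]
  simp_rw [e2]
  rw [integral_finsetSum]
  · refine Finset.sum_congr rfl fun i _ => integral_congr_ae ?_
    filter_upwards [ae_mem_simplex_updateKernel hα hx n] with y hy
    refine integral_congr_ae ?_
    filter_upwards [ae_mem_Ioo_betaMeasure α α] with u hu
    exact hgf _ (resample_mem_simplex hy i hu)
  · intro i _
    refine Integrable.of_bound (hmg i).aestronglyMeasurable K (Filter.Eventually.of_forall fun y => ?_)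
    have h := norm_integral_le_of_norm_le_const (μ := betaMeasure α α)
      (f := fun u => g (resample N y i u)) (C := K) (Filter.Eventually.of_forall fun u => hgK _)
    simpa using h

theorem integrable_centeredHeight (hN : 1 ≤ N) (hα : 0 < α) (hx : x ∈ simplex N) {k : ℕ}
    (hk : k ≤ N) (n : ℕ) : Integrable (fun y => centeredHeight N k y) (updateKernel N α n x) :=
  integrable_updateKernel hα hx (by fun_prop) (fun _ hy => abs_centeredHeight_le hN hy hk) n

theorem integrable_centeredHeight_mul (hN : 1 ≤ N) (hα : 0 < α) (hx : x ∈ simplex N) {k l : ℕ}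
    (hk : k ≤ N) (hl : l ≤ N) (n : ℕ) :
    Integrable (fun y => centeredHeight N k y * centeredHeight N l y) (updateKernel N α n x) := by
  refine integrable_updateKernel hα hx (by fun_prop) (K := (N : ℝ) * N) (fun y hy => ?_) n
  rw [abs_mul]
  exact mul_le_mul (abs_centeredHeight_le hN hy hk) (abs_centeredHeight_le hN hy hl)
    (abs_nonneg _) (Nat.cast_nonneg N)

theorem integrable_increment_mul (hN : 1 ≤ N) (hα : 0 < α) (hx : x ∈ simplex N) {k l : ℕ}
    (hk : k < N) (hl : l < N) (n : ℕ) :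
    Integrable (fun y => increment N k y * increment N l y) (updateKernel N α n x) := by
  refine integrable_updateKernel hα hx (by fun_prop) (K := (N : ℝ) * N) (fun y hy => ?_) n
  rw [abs_mul]
  exact mul_le_mul (abs_increment_le hN hy hk) (abs_increment_le hN hy hl)
    (abs_nonneg _) (Nat.cast_nonneg N)

theorem sum_eq_of_eq_off {ι : Type*} [Fintype ι] [DecidableEq ι] (g : ι → ℝ) (A : ℝ)
    (s : Finset ι) (h : ∀ i, i ∉ s → g i = A) :
    ∑ i, g i = ((Fintype.card ι : ℝ) - s.card) * A + ∑ i ∈ s, g i := by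
  have h1 : ∑ i, g i = ∑ _i : ι, A + ∑ i, (g i - A) := by
    rw [← Finset.sum_add_distrib]; simp
  have h2 : ∑ i, (g i - A) = ∑ i ∈ s, (g i - A) :=
    (Finset.sum_subset (Finset.subset_univ s) fun i _ hi => by rw [h i hi, sub_self]).symm
  rw [h1, h2, Finset.sum_sub_distrib]
  simp only [Finset.sum_const, Finset.card_univ, nsmul_eq_mul]
  ring

/-- The mean heights solve a discrete heat equation. -/
theorem integral_centeredHeight_succ (hN : 1 ≤ N) (hα : 0 < α) (hx : x ∈ simplex N)
    (i : Fin (N - 1)) (n : ℕ) :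
    ∫ y, centeredHeight N (i + 1) y ∂updateKernel N α (n + 1) x =
      ((N : ℝ) - 2) * ∫ y, centeredHeight N (i + 1) y ∂updateKernel N α n x +
        1 / 2 * (∫ y, centeredHeight N i y ∂updateKernel N α n x +
          ∫ y, centeredHeight N (i + 2) y ∂updateKernel N α n x) := by
  have hβ := isProbabilityMeasureBeta hα hα
  have hi := i.isLt
  rw [integral_updateKernel_succ_of_simplex hα hx (by fun_prop)
    (fun _ hy => abs_centeredHeight_le hN hy (show (i : ℕ) + 1 ≤ N by omega)),
    sum_eq_of_eq_off _ (∫ y, centeredHeight N (i + 1) y ∂updateKernel N α n x) {i}]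
  · rw [Finset.sum_singleton, Fintype.card_fin, Finset.card_singleton, Nat.cast_sub hN]
    congr 1
    · push_cast; ring
    · rw [← integral_add (integrable_centeredHeight hN hα hx (by omega) n)
        (integrable_centeredHeight hN hα hx (by omega) n), ← integral_const_mul]
      refine integral_congr_ae (Filter.Eventually.of_forall fun y => ?_)
      simp only [centeredHeight_resample, if_true]
      have h := integral_quadratic_betaMeasure hα (centeredHeight N (i + 2) y + 1)
        (-(increment N i y + increment N (i + 1) y)) 0
      have e : ∀ u : ℝ, centeredHeight N (i + 2) y + 1 -
          u * (increment N i y + increment N (i + 1) y) = centeredHeight N (i + 2) y + 1 +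
          -(increment N i y + increment N (i + 1) y) * u + 0 * u ^ 2 := fun u => by ring
      simp_rw [e]
      rw [h]
      unfold centeredHeight increment
      push_cast
      ring
  · intro j hj
    have hj' : ¬((i : ℕ) + 1 = j + 1) := by
      simp only [Finset.mem_singleton, Fin.ext_iff] at hj
      omega
    simp only [centeredHeight_resample, if_neg hj']
    simp

/-- The covariances of distinct particles also solve a discrete heat equation. -/
theorem integral_centeredHeight_mul_succ (hN : 1 ≤ N) (hα : 0 < α) (hx : x ∈ simplex N)
    {i j : Fin (N - 1)} (hij : i ≠ j) (n : ℕ) :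
    ∫ y, centeredHeight N (i + 1) y * centeredHeight N (j + 1) y ∂updateKernel N α (n + 1) x =
      ((N : ℝ) - 3) *
        ∫ y, centeredHeight N (i + 1) y * centeredHeight N (j + 1) y ∂updateKernel N α n x +
      1 / 2 * (∫ y, centeredHeight N i y * centeredHeight N (j + 1) y ∂updateKernel N α n x +
        ∫ y, centeredHeight N (i + 2) y * centeredHeight N (j + 1) y ∂updateKernel N α n x) +
      1 / 2 * (∫ y, centeredHeight N (i + 1) y * centeredHeight N j y ∂updateKernel N α n x +
        ∫ y, centeredHeight N (i + 1) y * centeredHeight N (j + 2) y ∂updateKernel N α n x) := by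
  have hβ := isProbabilityMeasureBeta hα hα
  have hi := i.isLt
  have hj := j.isLt
  have hij' : (i : ℕ) ≠ j := fun h => hij (Fin.ext h)
  have hij1 : ¬((i : ℕ) + 1 = j + 1) := by omega
  have hji1 : ¬((j : ℕ) + 1 = i + 1) := by omega
  have hb : ∀ y ∈ simplex N, |centeredHeight N (i + 1) y * centeredHeight N (j + 1) y| ≤
      (N : ℝ) * N := fun y hy => by
    rw [abs_mul]
    exact mul_le_mul (abs_centeredHeight_le hN hy (by omega))
      (abs_centeredHeight_le hN hy (by omega)) (abs_nonneg _) (Nat.cast_nonneg N)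
  -- the resampling of `k` averages `c_{k+1} c` into `(c_k + c_{k+2}) c / 2`
  have avg : ∀ (k : Fin (N - 1)) (c : ℝ) (y : Fin (N - 1) → ℝ),
      ∫ u, (centeredHeight N (k + 2) y + 1 - u * (increment N k y + increment N (k + 1) y)) * c
        ∂betaMeasure α α = 1 / 2 * (centeredHeight N k y * c + centeredHeight N (k + 2) y * c) := by
    intro k c y
    have e : ∀ u : ℝ, (centeredHeight N (k + 2) y + 1 -
        u * (increment N k y + increment N (k + 1) y)) * c = (centeredHeight N (k + 2) y + 1) * c +
        (-(increment N k y + increment N (k + 1) y) * c) * u + 0 * u ^ 2 := fun u => by ring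
    simp_rw [e]
    rw [integral_quadratic_betaMeasure hα]
    unfold centeredHeight increment
    push_cast
    ring
  rw [integral_updateKernel_succ_of_simplex hα hx (by fun_prop) hb,
    sum_eq_of_eq_off _ (∫ y, centeredHeight N (i + 1) y * centeredHeight N (j + 1) y
      ∂updateKernel N α n x) {i, j}]
  · rw [Finset.sum_pair hij, Fintype.card_fin, Finset.card_pair hij, Nat.cast_sub hN, ← add_assoc]
    congr 1
    · congr 1
      · push_cast; ring
      · rw [← integral_add (integrable_centeredHeight_mul hN hα hx (by omega) (by omega) n)
          (integrable_centeredHeight_mul hN hα hx (by omega) (by omega) n), ← integral_const_mul]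
        refine integral_congr_ae (Filter.Eventually.of_forall fun y => ?_)
        simp only [centeredHeight_resample, if_true, if_neg hji1]
        exact avg i _ y
    · rw [← integral_add (integrable_centeredHeight_mul hN hα hx (by omega) (by omega) n)
        (integrable_centeredHeight_mul hN hα hx (by omega) (by omega) n), ← integral_const_mul]
      refine integral_congr_ae (Filter.Eventually.of_forall fun y => ?_)
      simp only [centeredHeight_resample, if_true, if_neg hij1]
      simp_rw [mul_comm (centeredHeight N (i + 1) y)]
      exact avg j _ y
  · intro k hk
    simp only [Finset.mem_insert, Finset.mem_singleton, Fin.ext_iff, not_or] at hk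
    have h1 : ¬((i : ℕ) + 1 = k + 1) := by omega
    have h2 : ¬((j : ℕ) + 1 = k + 1) := by omega
    simp only [centeredHeight_resample, if_neg h1, if_neg h2]
    simp

/-- On the diagonal a resampling averages the two neighbours and adds the variance of a Beta variable
scaled by their distance. -/
theorem integral_centeredHeight_sq_succ (hN : 1 ≤ N) (hα : 0 < α) (hx : x ∈ simplex N)
    (i : Fin (N - 1)) (n : ℕ) :
    ∫ y, centeredHeight N (i + 1) y * centeredHeight N (i + 1) y ∂updateKernel N α (n + 1) x =
      ((N : ℝ) - 2) *
        ∫ y, centeredHeight N (i + 1) y * centeredHeight N (i + 1) y ∂updateKernel N α n x +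
      1 / 4 * (∫ y, centeredHeight N i y * centeredHeight N i y ∂updateKernel N α n x +
        2 * ∫ y, centeredHeight N i y * centeredHeight N (i + 2) y ∂updateKernel N α n x +
        ∫ y, centeredHeight N (i + 2) y * centeredHeight N (i + 2) y ∂updateKernel N α n x) +
      1 / (4 * (2 * α + 1)) * (∫ y, increment N i y * increment N i y ∂updateKernel N α n x +
        2 * ∫ y, increment N i y * increment N (i + 1) y ∂updateKernel N α n x +
        ∫ y, increment N (i + 1) y * increment N (i + 1) y ∂updateKernel N α n x) := by
  have hβ := isProbabilityMeasureBeta hα hα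
  have hi := i.isLt
  have hb : ∀ y ∈ simplex N, |centeredHeight N (i + 1) y * centeredHeight N (i + 1) y| ≤
      (N : ℝ) * N := fun y hy => by
    rw [abs_mul]
    exact mul_le_mul (abs_centeredHeight_le hN hy (by omega))
      (abs_centeredHeight_le hN hy (by omega)) (abs_nonneg _) (Nat.cast_nonneg N)
  have c00 := integrable_centeredHeight_mul hN hα hx (k := i) (l := i) (by omega) (by omega) n
  have c02 := integrable_centeredHeight_mul hN hα hx (k := i) (l := i + 2) (by omega) (by omega) n
  have c22 := integrable_centeredHeight_mul hN hα hx (k := i + 2) (l := i + 2) (by omega)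
    (by omega) n
  have i00 := integrable_increment_mul hN hα hx (k := i) (l := i) (by omega) (by omega) n
  have i01 := integrable_increment_mul hN hα hx (k := i) (l := i + 1) (by omega) (by omega) n
  have i11 := integrable_increment_mul hN hα hx (k := i + 1) (l := i + 1) (by omega)
    (by omega) n
  rw [integral_updateKernel_succ_of_simplex hα hx (by fun_prop) hb,
    sum_eq_of_eq_off _ (∫ y, centeredHeight N (i + 1) y * centeredHeight N (i + 1) y
      ∂updateKernel N α n x) {i}]
  · rw [Finset.sum_singleton, Fintype.card_fin, Finset.card_singleton, Nat.cast_sub hN, add_assoc]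
    congr 1
    · push_cast; ring
    · rw [← integral_const_mul 2, ← integral_const_mul 2, ← integral_add (by fun_prop) (by fun_prop),
        ← integral_add (by fun_prop) (by fun_prop), ← integral_add (by fun_prop) (by fun_prop),
        ← integral_add (by fun_prop) (by fun_prop), ← integral_const_mul, ← integral_const_mul,
        ← integral_add (by fun_prop) (by fun_prop)]
      refine integral_congr_ae (Filter.Eventually.of_forall fun y => ?_)
      simp only [centeredHeight_resample, if_true]
      set S := increment N i y + increment N (i + 1) y with hS
      have e : ∀ u : ℝ, (centeredHeight N (i + 2) y + 1 - u * S) *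
          (centeredHeight N (i + 2) y + 1 - u * S) = (centeredHeight N (i + 2) y + 1) ^ 2 +
          (-2 * (centeredHeight N (i + 2) y + 1) * S) * u + S ^ 2 * u ^ 2 := fun u => by ring
      simp_rw [e]
      rw [integral_quadratic_betaMeasure hα]
      have hc : centeredHeight N (i + 2) y = centeredHeight N i y + S - 2 := by
        rw [hS]; unfold centeredHeight increment; push_cast; ring
      have hS2 : increment N i y * increment N i y + 2 * (increment N i y * increment N (i + 1) y) +
          increment N (i + 1) y * increment N (i + 1) y = S ^ 2 := by rw [hS]; ring
      rw [hS2, hc]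
      field_simp
      ring
  · intro j hj
    have hj' : ¬((i : ℕ) + 1 = j + 1) := by
      simp only [Finset.mem_singleton, Fin.ext_iff] at hj
      omega
    simp only [centeredHeight_resample, if_neg hj']
    simp

/-- Up to a factor, the second moments of the increments stay below those of independent Gamma
variables. This is the maximum principle for the pair of dual particles. -/
theorem integral_increment_mul_le (hN : 1 ≤ N) (hα : 0 < α) (hx : x ∈ simplex N) {K : ℝ}
    (hK : ∀ k l, k < N → l < N →
      increment N k x * increment N l x ≤ K * (if k = l then α + 1 else α)) (n : ℕ) {k l : ℕ}
    (hk : k < N) (hl : l < N) :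
    ∫ y, increment N k y * increment N l y ∂updateKernel N α n x ≤
      K * (if k = l then α + 1 else α) * ((N - 1 : ℕ) : ℝ) ^ n := by
  have hβ := isProbabilityMeasureBeta hα hα
  induction n generalizing k l with
  | zero =>
    rw [updateKernel, Kernel.id_apply, integral_dirac']
    · simpa using hK k l hk hl
    · exact (Measurable.mul (by fun_prop) (by fun_prop)).stronglyMeasurable
  | succ n ih =>
    have hb : ∀ y ∈ simplex N, |increment N k y * increment N l y| ≤ (N : ℝ) * N := fun y hy => by
      rw [abs_mul]
      exact mul_le_mul (abs_increment_le hN hy hk) (abs_increment_le hN hy hl) (abs_nonneg _)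
        (Nat.cast_nonneg N)
    rw [integral_updateKernel_succ_of_simplex hα hx (by fun_prop) hb]
    set M : ℝ := ((N - 1 : ℕ) : ℝ) ^ n with hM
    have hterm : ∀ i : Fin (N - 1), ∫ y, ∫ u, increment N k (resample N y i u) *
        increment N l (resample N y i u) ∂betaMeasure α α ∂updateKernel N α n x ≤
        K * (if k = l then α + 1 else α) * M := by
      intro i
      have hi := i.isLt
      set S : (Fin (N - 1) → ℝ) → ℝ := fun y => increment N i y + increment N (i + 1) y with hS
      have hSm : ∀ m, m < N → Integrable (fun y => S y * increment N m y) (updateKernel N α n x) ∧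
          ∫ y, S y * increment N m y ∂updateKernel N α n x =
            ∫ y, increment N i y * increment N m y ∂updateKernel N α n x +
            ∫ y, increment N (i + 1) y * increment N m y ∂updateKernel N α n x := by
        intro m hm
        have h1 := integrable_increment_mul hN hα hx (k := i) (l := m) (by omega) hm n
        have h2 := integrable_increment_mul hN hα hx (k := i + 1) (l := m) (by omega) hm n
        simp only [hS, add_mul]
        exact ⟨h1.add h2, integral_add h1 h2⟩
      have hSS : ∫ y, S y * S y ∂updateKernel N α n x ≤ K * (2 * (2 * α + 1)) * M := by
        have e : ∀ y, S y * S y = S y * increment N i y + S y * increment N (i + 1) y := fun y => by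
          simp only [hS]; ring
        simp_rw [e]
        rw [integral_add (hSm i (by omega)).1 (hSm (i + 1) (by omega)).1, (hSm i (by omega)).2,
          (hSm (i + 1) (by omega)).2]
        have a := ih (k := i) (l := i) (by omega) (by omega)
        have b := ih (k := i + 1) (l := i) (by omega) (by omega)
        have c := ih (k := i) (l := i + 1) (by omega) (by omega)
        have d := ih (k := i + 1) (l := i + 1) (by omega) (by omega)
        rw [if_pos rfl] at a d
        rw [if_neg (by omega)] at b c
        linarith
      have hSl : ∀ m, m < N → m ≠ i → m ≠ i + 1 →
          1 / 2 * ∫ y, S y * increment N m y ∂updateKernel N α n x ≤ K * α * M := by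
        intro m hm h1 h2
        rw [(hSm m hm).2]
        have a := ih (k := i) (l := m) (by omega) hm
        have b := ih (k := i + 1) (l := m) (by omega) hm
        rw [if_neg (Ne.symm h1)] at a
        rw [if_neg (Ne.symm h2)] at b
        linarith
      have hsq : (α + 1) / (2 * (2 * α + 1)) * ∫ y, S y * S y ∂updateKernel N α n x ≤
          K * (α + 1) * M := by
        calc (α + 1) / (2 * (2 * α + 1)) * ∫ y, S y * S y ∂updateKernel N α n x
            ≤ (α + 1) / (2 * (2 * α + 1)) * (K * (2 * (2 * α + 1)) * M) := by gcongr
          _ = _ := by field_simp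
      have hcr : α / (2 * (2 * α + 1)) * ∫ y, S y * S y ∂updateKernel N α n x ≤ K * α * M := by
        calc α / (2 * (2 * α + 1)) * ∫ y, S y * S y ∂updateKernel N α n x
            ≤ α / (2 * (2 * α + 1)) * (K * (2 * (2 * α + 1)) * M) := by gcongr
          _ = _ := by field_simp
      simp only [increment_resample]
      change ∫ y, ∫ u, (if k = i then (1 - u) * S y else if k = i + 1 then u * S y
        else increment N k y) * (if l = i then (1 - u) * S y else if l = i + 1 then u * S y
        else increment N l y) ∂betaMeasure α α ∂updateKernel N α n x ≤ _
      by_cases hk1 : k = i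
      · by_cases hl1 : l = i
        · simp only [if_pos hk1, if_pos hl1]
          rw [if_pos (by omega)]
          refine le_trans (le_of_eq ?_) hsq
          rw [← integral_const_mul]
          refine integral_congr_ae (Filter.Eventually.of_forall fun y => ?_)
          have e : ∀ u : ℝ, (1 - u) * S y * ((1 - u) * S y) =
            S y * S y + (-2 * (S y * S y)) * u + (S y * S y) * u ^ 2 := fun u => by ring
          simp_rw [e]
          rw [integral_quadratic_betaMeasure hα]
          ring
        · by_cases hl2 : l = i + 1
          · simp only [if_pos hk1, if_neg hl1, if_pos hl2]
            rw [if_neg (by omega)]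
            refine le_trans (le_of_eq ?_) hcr
            rw [← integral_const_mul]
            refine integral_congr_ae (Filter.Eventually.of_forall fun y => ?_)
            have e : ∀ u : ℝ, (1 - u) * S y * (u * S y) =
              0 + (S y * S y) * u + (-(S y * S y)) * u ^ 2 := fun u => by ring
            simp_rw [e]
            rw [integral_quadratic_betaMeasure hα]
            field_simp
            ring
          · simp only [if_pos hk1, if_neg hl1, if_neg hl2]
            rw [if_neg (by omega)]
            refine le_trans (le_of_eq ?_) (hSl l hl hl1 hl2)
            rw [← integral_const_mul]
            refine integral_congr_ae (Filter.Eventually.of_forall fun y => ?_)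
            have e : ∀ u : ℝ, (1 - u) * S y * increment N l y =
              S y * increment N l y + (-(S y * increment N l y)) * u + 0 * u ^ 2 := fun u => by ring
            simp_rw [e]
            rw [integral_quadratic_betaMeasure hα]
            ring
      · by_cases hk2 : k = i + 1
        · by_cases hl1 : l = i
          · simp only [if_neg hk1, if_pos hk2, if_pos hl1]
            rw [if_neg (by omega)]
            refine le_trans (le_of_eq ?_) hcr
            rw [← integral_const_mul]
            refine integral_congr_ae (Filter.Eventually.of_forall fun y => ?_)
            have e : ∀ u : ℝ, u * S y * ((1 - u) * S y) =
              0 + (S y * S y) * u + (-(S y * S y)) * u ^ 2 := fun u => by ring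
            simp_rw [e]
            rw [integral_quadratic_betaMeasure hα]
            field_simp
            ring
          · by_cases hl2 : l = i + 1
            · simp only [if_neg hk1, if_pos hk2, if_neg hl1, if_pos hl2]
              rw [if_pos (by omega)]
              refine le_trans (le_of_eq ?_) hsq
              rw [← integral_const_mul]
              refine integral_congr_ae (Filter.Eventually.of_forall fun y => ?_)
              have e : ∀ u : ℝ, u * S y * (u * S y) =
                0 + 0 * u + (S y * S y) * u ^ 2 := fun u => by ring
              simp_rw [e]
              rw [integral_quadratic_betaMeasure hα]
              ring
            · simp only [if_neg hk1, if_pos hk2, if_neg hl1, if_neg hl2]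
              rw [if_neg (by omega)]
              refine le_trans (le_of_eq ?_) (hSl l hl hl1 hl2)
              rw [← integral_const_mul]
              refine integral_congr_ae (Filter.Eventually.of_forall fun y => ?_)
              have e : ∀ u : ℝ, u * S y * increment N l y =
                0 + (S y * increment N l y) * u + 0 * u ^ 2 := fun u => by ring
              simp_rw [e]
              rw [integral_quadratic_betaMeasure hα]
              ring
        · by_cases hl1 : l = i
          · simp only [if_neg hk1, if_neg hk2, if_pos hl1]
            rw [if_neg (by omega)]
            refine le_trans (le_of_eq ?_) (hSl k hk hk1 hk2)
            rw [← integral_const_mul]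
            refine integral_congr_ae (Filter.Eventually.of_forall fun y => ?_)
            have e : ∀ u : ℝ, increment N k y * ((1 - u) * S y) =
              S y * increment N k y + (-(S y * increment N k y)) * u + 0 * u ^ 2 := fun u => by ring
            simp_rw [e]
            rw [integral_quadratic_betaMeasure hα]
            ring
          · by_cases hl2 : l = i + 1
            · simp only [if_neg hk1, if_neg hk2, if_neg hl1, if_pos hl2]
              rw [if_neg (by omega)]
              refine le_trans (le_of_eq ?_) (hSl k hk hk1 hk2)
              rw [← integral_const_mul]
              refine integral_congr_ae (Filter.Eventually.of_forall fun y => ?_)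
              have e : ∀ u : ℝ, increment N k y * (u * S y) =
                0 + (S y * increment N k y) * u + 0 * u ^ 2 := fun u => by ring
              simp_rw [e]
              rw [integral_quadratic_betaMeasure hα]
              ring
            · simp only [if_neg hk1, if_neg hk2, if_neg hl1, if_neg hl2]
              simpa using ih hk hl
    calc _ ≤ ∑ _i : Fin (N - 1), K * (if k = l then α + 1 else α) * M :=
          Finset.sum_le_sum fun i _ => hterm i
      _ = _ := by
          rw [Finset.sum_const, Finset.card_univ, Fintype.card_fin, nsmul_eq_mul, pow_succ, hM]
          ring

end Moments

/-! ### Relaxation of sine profiles -/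

/-- The first Dirichlet eigenfunction of the discrete Laplacian on `{0, …, N}`. -/
noncomputable def sineMode (N k : ℕ) : ℝ := Real.sin (Real.pi * k / N)

/-- The spectral gap of the adjacent walk: `sineMode` decays at this rate. -/
noncomputable def gap (N : ℕ) : ℝ := 1 - Real.cos (Real.pi / N)

theorem sineMode_zero (N : ℕ) : sineMode N 0 = 0 := by simp [sineMode]

theorem sineMode_self {N : ℕ} (hN : 1 ≤ N) : sineMode N N = 0 := by
  have : (N : ℝ) ≠ 0 := by positivity
  rw [sineMode, mul_div_assoc, div_self this, mul_one, Real.sin_pi]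

theorem sineMode_add_sineMode (N k : ℕ) :
    sineMode N k + sineMode N (k + 2) = 2 * (1 - gap N) * sineMode N (k + 1) := by
  have h1 : Real.pi * k / N = Real.pi * (k + 1 : ℕ) / N - Real.pi / N := by push_cast; ring
  have h2 : Real.pi * (k + 2 : ℕ) / N = Real.pi * (k + 1 : ℕ) / N + Real.pi / N := by
    push_cast; ring
  rw [sineMode, sineMode, sineMode, gap, h1, h2, Real.sin_add, Real.sin_sub]
  ring

theorem gap_nonneg (N : ℕ) : 0 ≤ gap N := sub_nonneg.2 (Real.cos_le_one _)

theorem gap_le (N : ℕ) : gap N ≤ Real.pi ^ 2 / (2 * (N : ℝ) ^ 2) := by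
  have h := Real.one_sub_sq_div_two_le_cos (x := Real.pi / N)
  have e : Real.pi ^ 2 / (2 * (N : ℝ) ^ 2) = (Real.pi / N) ^ 2 / 2 := by rw [div_pow]; ring
  rw [gap, e]
  linarith

theorem gap_le_one {N : ℕ} (hN : 3 ≤ N) : gap N ≤ 1 := by
  have : (3 : ℝ) ≤ N := by exact_mod_cast hN
  have h := gap_le N
  have hp := Real.pi_lt_four
  have hp0 := Real.pi_pos
  have : Real.pi ^ 2 / (2 * (N : ℝ) ^ 2) ≤ 1 := by
    rw [div_le_one (by positivity)]
    nlinarith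
  linarith

section Relaxation

variable {N : ℕ} {α : ℝ} {x : Fin (N - 1) → ℝ}

theorem centeredHeight_zero (N : ℕ) (y : Fin (N - 1) → ℝ) : centeredHeight N 0 y = 0 := by
  simp [centeredHeight, height_zero]

theorem centeredHeight_self (hN : 1 ≤ N) (y : Fin (N - 1) → ℝ) : centeredHeight N N y = 0 := by
  simp [centeredHeight, height_self hN]

/-- Started from a sine profile, the mean profile stays proportional to it. -/
theorem integral_centeredHeight_updateKernel (hN : 3 ≤ N) (hα : 0 < α) (hx : x ∈ simplex N)
    {θ : ℝ} (hθ : ∀ k ≤ N, centeredHeight N k x = θ * sineMode N k) (n : ℕ) {k : ℕ} (hk : k ≤ N) :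
    ∫ y, centeredHeight N k y ∂updateKernel N α n x =
      θ * ((N : ℝ) - 1 - gap N) ^ n * sineMode N k := by
  induction n generalizing k with
  | zero =>
    rw [updateKernel, Kernel.id_apply, integral_dirac' _ _ (by fun_prop), hθ k hk, pow_zero,
      mul_one]
  | succ n ih =>
    by_cases h0 : k = 0
    · subst h0
      simp [centeredHeight_zero, sineMode_zero]
    by_cases h1 : k = N
    · subst h1
      simp [centeredHeight_self (show 1 ≤ k by omega), sineMode_self (show 1 ≤ k by omega)]
    obtain ⟨i, hi⟩ : ∃ i : Fin (N - 1), k = i + 1 := ⟨⟨k - 1, by omega⟩, by simp; omega⟩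
    have hi' := i.isLt
    rw [hi, integral_centeredHeight_succ (by omega) hα hx, ih (by omega), ih (by omega),
      ih (by omega), pow_succ]
    have h := sineMode_add_sineMode N i
    linear_combination (1 / 2 * θ * ((N : ℝ) - 1 - gap N) ^ n) * h

/-- Second moments are at most those of the deterministic sine profile plus a multiple of the Green
function `k (N - l) / N`, which absorbs the noise produced by the resamplings. -/
theorem integral_centeredHeight_mul_le (hN : 3 ≤ N) (hα : 0 < α) (hx : x ∈ simplex N)
    {θ K : ℝ} (hθ : ∀ k ≤ N, centeredHeight N k x = θ * sineMode N k)
    (hθ1 : (θ * gap N) ^ 2 ≤ 1) (hK0 : 0 ≤ K)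
    (hK : ∀ k l, k < N → l < N →
      increment N k x * increment N l x ≤ K * (if k = l then α + 1 else α)) (n : ℕ) {k l : ℕ}
    (hkl : k ≤ l) (hl : l ≤ N) :
    ∫ y, centeredHeight N k y * centeredHeight N l y ∂updateKernel N α n x ≤
      ((N : ℝ) - 1) ^ n * ((K + 2) * (k * (N - l) / N)) +
        θ ^ 2 * ((N : ℝ) - 1 - 2 * gap N) ^ n * (sineMode N k * sineMode N l) := by
  have hN3 : (3 : ℝ) ≤ N := by exact_mod_cast hN
  have hN0 : (0 : ℝ) < N := by linarith
  have hg0 := gap_nonneg N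
  have hg1 := gap_le_one hN
  induction n generalizing k l with
  | zero =>
    have hl' : (l : ℝ) ≤ N := by exact_mod_cast hl
    have : 0 ≤ (K + 2) * ((k : ℝ) * (N - l) / N) :=
      mul_nonneg (by linarith) (div_nonneg (mul_nonneg (Nat.cast_nonneg k) (by linarith)) hN0.le)
    have hmeas : Measurable fun y => centeredHeight N k y * centeredHeight N l y := by fun_prop
    rw [updateKernel, Kernel.id_apply, integral_dirac' _ _ hmeas.stronglyMeasurable,
      hθ k (by omega), hθ l hl, pow_zero, pow_zero]
    linarith
  | succ n ih =>
    by_cases h0 : k = 0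
    · subst h0
      simp [centeredHeight_zero, sineMode_zero]
    by_cases h1 : l = N
    · subst h1
      simp [centeredHeight_self (show 1 ≤ l by omega), sineMode_self (show 1 ≤ l by omega)]
    obtain ⟨i, hi⟩ : ∃ i : Fin (N - 1), k = i + 1 := ⟨⟨k - 1, by omega⟩, by simp; omega⟩
    obtain ⟨j, hj⟩ : ∃ j : Fin (N - 1), l = j + 1 := ⟨⟨l - 1, by omega⟩, by simp; omega⟩
    have hi' := i.isLt
    have hj' := j.isLt
    set M : ℝ := ((N : ℝ) - 1) ^ n with hM
    set μ : ℝ := (N : ℝ) - 1 - 2 * gap N with hμ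
    have hp1 : ((N : ℝ) - 1) ^ (n + 1) = M * ((N : ℝ) - 1) := by rw [hM, pow_succ]
    have hp2 : μ ^ (n + 1) = μ ^ n * μ := pow_succ _ _
    have hM0 : 0 ≤ M := by rw [hM]; exact pow_nonneg (by linarith) n
    have hsi := sineMode_add_sineMode N i
    have hsj := sineMode_add_sineMode N j
    by_cases hij : i = j
    · subst hij
      rw [hi, hj, integral_centeredHeight_sq_succ (by omega) hα hx]
      have q11 := ih (k := i + 1) (l := i + 1) le_rfl (by omega)
      have q00 := ih (k := i) (l := i) le_rfl (by omega)
      have q02 := ih (k := i) (l := i + 2) (by omega) (by omega)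
      have q22 := ih (k := i + 2) (l := i + 2) le_rfl (by omega)
      have e00 := integral_increment_mul_le (by omega) hα hx hK n (k := i) (l := i) (by omega)
        (by omega)
      have e01 := integral_increment_mul_le (by omega) hα hx hK n (k := i) (l := i + 1) (by omega)
        (by omega)
      have e11 := integral_increment_mul_le (by omega) hα hx hK n (k := i + 1) (l := i + 1)
        (by omega) (by omega)
      rw [if_pos rfl] at e00 e11
      rw [if_neg (by omega)] at e01
      rw [Nat.cast_sub (by omega), Nat.cast_one, ← hM] at e00 e01 e11
      have hnoise : 1 / (4 * (2 * α + 1)) *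
          (∫ y, increment N i y * increment N i y ∂updateKernel N α n x +
          2 * ∫ y, increment N i y * increment N (i + 1) y ∂updateKernel N α n x +
          ∫ y, increment N (i + 1) y * increment N (i + 1) y ∂updateKernel N α n x) ≤ M * K / 2 := by
        calc _ ≤ 1 / (4 * (2 * α + 1)) * (2 * K * M * (2 * α + 1)) := by
              gcongr
              linarith
          _ = M * K / 2 := by field_simp; ring
      have hμ0 : 0 ≤ μ := by rw [hμ]; linarith
      have hμM : μ ^ n ≤ M := by
        rw [hM, hμ]
        exact pow_le_pow_left₀ hμ0 (by linarith) n
      have hs1 : sineMode N (i + 1) ^ 2 ≤ 1 := by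
        rw [sineMode]; exact Real.sin_sq_le_one _
      have hdrift : θ ^ 2 * μ ^ n * gap N ^ 2 * sineMode N (i + 1) ^ 2 ≤ M := by
        calc θ ^ 2 * μ ^ n * gap N ^ 2 * sineMode N (i + 1) ^ 2
            = μ ^ n * ((θ * gap N) ^ 2 * sineMode N (i + 1) ^ 2) := by ring
          _ ≤ M * (1 * 1) := by gcongr
          _ = M := by ring
      have hN2 : (0 : ℝ) ≤ (N : ℝ) - 2 := by linarith
      have q11' := mul_le_mul_of_nonneg_left q11 hN2
      have hquad : (sineMode N i + sineMode N (i + 2)) ^ 2 =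
          4 * (1 - gap N) ^ 2 * sineMode N (i + 1) ^ 2 := by rw [hsi]; ring
      have hsum := add_le_add (add_le_add q00 (mul_le_mul_of_nonneg_left q02 zero_le_two)) q22
      have hsum' := mul_le_mul_of_nonneg_left hsum (show (0 : ℝ) ≤ 1 / 4 by norm_num)
      refine (add_le_add (add_le_add q11' hsum') hnoise).trans ?_
      rw [hp1, hp2]
      -- the Green function loses exactly `1 / 2` on the diagonal
      have hG : 1 / 4 * ((K + 2) * ((i : ℕ) * (N - (i : ℕ)) / N) +
          2 * ((K + 2) * ((i : ℕ) * (N - ((i + 2 : ℕ) : ℝ)) / N)) +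
          (K + 2) * (((i + 2 : ℕ) : ℝ) * (N - ((i + 2 : ℕ) : ℝ)) / N)) =
          (K + 2) * (((i + 1 : ℕ) : ℝ) * (N - ((i + 1 : ℕ) : ℝ)) / N) - (K + 2) / 2 := by
        push_cast
        field_simp
        ring
      have hfin : M * (N - 1) * ((K + 2) * (((i + 1 : ℕ) : ℝ) * (N - ((i + 1 : ℕ) : ℝ)) / N)) +
          θ ^ 2 * (μ ^ n * μ) * (sineMode N (i + 1) * sineMode N (i + 1)) -
          (((N : ℝ) - 2) * (M * ((K + 2) * (((i + 1 : ℕ) : ℝ) * (N - ((i + 1 : ℕ) : ℝ)) / N)) +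
            θ ^ 2 * μ ^ n * (sineMode N (i + 1) * sineMode N (i + 1))) +
          1 / 4 * (M * ((K + 2) * ((i : ℕ) * (N - (i : ℕ)) / N)) +
            θ ^ 2 * μ ^ n * (sineMode N i * sineMode N i) +
            2 * (M * ((K + 2) * ((i : ℕ) * (N - ((i + 2 : ℕ) : ℝ)) / N)) +
              θ ^ 2 * μ ^ n * (sineMode N i * sineMode N (i + 2))) +
            (M * ((K + 2) * (((i + 2 : ℕ) : ℝ) * (N - ((i + 2 : ℕ) : ℝ)) / N)) +
              θ ^ 2 * μ ^ n * (sineMode N (i + 2) * sineMode N (i + 2)))) + M * K / 2) =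
          M - θ ^ 2 * μ ^ n * gap N ^ 2 * sineMode N (i + 1) ^ 2 := by
        set s := sineMode N (i + 1)
        have hμN : ((N : ℝ) - 2) = μ + 2 * gap N - 1 := by rw [hμ]; ring
        rw [hμN]
        have hN1 : (N : ℝ) - 1 = μ + 2 * gap N - 1 + 1 := by rw [hμ]; ring
        linear_combination (-M) * hG - (1 / 4 * θ ^ 2 * μ ^ n) * hquad +
          (M * ((K + 2) * (((i + 1 : ℕ) : ℝ) * (N - ((i + 1 : ℕ) : ℝ)) / N))) * hN1
      linarith
    · have hij' : (i : ℕ) ≠ j := fun h => hij (Fin.ext h)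
      rw [hi, hj, integral_centeredHeight_mul_succ (by omega) hα hx hij]
      have q11 := ih (k := i + 1) (l := j + 1) (by omega) (by omega)
      have q01 := ih (k := i) (l := j + 1) (by omega) (by omega)
      have q21 := ih (k := i + 2) (l := j + 1) (by omega) (by omega)
      have q10 := ih (k := i + 1) (l := j) (by omega) (by omega)
      have q12 := ih (k := i + 1) (l := j + 2) (by omega) (by omega)
      have hN2 : (0 : ℝ) ≤ (N : ℝ) - 3 := by linarith
      have hh : (0 : ℝ) ≤ 1 / 2 := by norm_num
      refine (add_le_add (add_le_add (mul_le_mul_of_nonneg_left q11 hN2)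
        (mul_le_mul_of_nonneg_left (add_le_add q01 q21) hh))
        (mul_le_mul_of_nonneg_left (add_le_add q10 q12) hh)).trans (le_of_eq ?_)
      rw [hp1, hp2]
      push_cast
      have hNμ : (N : ℝ) - 1 = μ + 2 * gap N := by rw [hμ]; ring
      have hg : 2 * gap N = (N : ℝ) - 1 - μ := by rw [hμ]; ring
      have hsi' : sineMode N i + sineMode N (i + 2) = (2 - ((N : ℝ) - 1 - μ)) * sineMode N (i + 1) := by
        rw [hsi, ← hg]; ring
      have hsj' : sineMode N j + sineMode N (j + 2) = (2 - ((N : ℝ) - 1 - μ)) * sineMode N (j + 1) := by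
        rw [hsj, ← hg]; ring
      linear_combination (1 / 2 * θ ^ 2 * μ ^ n * sineMode N (j + 1)) * hsi' +
        (1 / 2 * θ ^ 2 * μ ^ n * sineMode N (i + 1)) * hsj'

/-- Chebyshev's inequality for the position of one particle, started from a sine profile. -/
theorem law_deviation_le (hN : 3 ≤ N) (hα : 0 < α) (hx : x ∈ simplex N)
    {θ K : ℝ} (hθ : ∀ k ≤ N, centeredHeight N k x = θ * sineMode N k)
    (hθ1 : (θ * gap N) ^ 2 ≤ 1) (hK0 : 0 ≤ K)
    (hK : ∀ k l, k < N → l < N →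
      increment N k x * increment N l x ≤ K * (if k = l then α + 1 else α)) {m : ℕ} (hm : m ≤ N)
    {t : ℝ} (ht : 0 ≤ t) {δ : ℝ} (hδ : 0 < δ) :
    law N α t x {y | δ ≤ |centeredHeight N m y - θ * Real.exp (-(gap N * t)) * sineMode N m|} ≤
      ENNReal.ofReal ((K + 2) * N / (4 * δ ^ 2)) := by
  have hN3 : (3 : ℝ) ≤ N := by exact_mod_cast hN
  have hN0 : (0 : ℝ) < N := by linarith
  set A : ℝ := θ * Real.exp (-(gap N * t)) * sineMode N m with hA
  set s := sineMode N m with hs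
  set V : ℝ := (K + 2) * (m * (N - m) / N) with hV
  set R : ℕ → ℝ := fun n => ((N : ℝ) - 1) ^ n * (V + A ^ 2) +
    θ ^ 2 * ((N : ℝ) - 1 - 2 * gap N) ^ n * (s * s) -
    2 * A * (θ * ((N : ℝ) - 1 - gap N) ^ n * s) with hR
  have hmN : ((N - 1 : ℕ) : ℝ) = N - 1 := by rw [Nat.cast_sub (by omega), Nat.cast_one]
  have hint : ∀ n, ∫ y, (centeredHeight N m y - A) ^ 2 ∂updateKernel N α n x ≤ R n := by
    intro n
    have := isFiniteMeasure_updateKernel (N := N) hα n x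
    have h1 := integrable_centeredHeight (N := N) (by omega) hα hx hm n
    have h2 := integrable_centeredHeight_mul (N := N) (by omega) hα hx hm hm n
    have e : ∀ y, (centeredHeight N m y - A) ^ 2 = centeredHeight N m y * centeredHeight N m y -
        2 * A * centeredHeight N m y + A ^ 2 := fun y => by ring
    simp_rw [e]
    have h1c : Integrable (fun y => 2 * A * centeredHeight N m y) (updateKernel N α n x) :=
      h1.const_mul _
    have h12 : Integrable (fun y => centeredHeight N m y * centeredHeight N m y -
        2 * A * centeredHeight N m y) (updateKernel N α n x) := h2.sub h1c
    rw [integral_add h12 (integrable_const _), integral_sub h2 h1c, integral_const_mul, integral_const,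
      updateKernel_real_univ hα,
      integral_centeredHeight_updateKernel hN hα hx hθ n hm, hmN, smul_eq_mul]
    have h := integral_centeredHeight_mul_le hN hα hx hθ hθ1 hK0 hK n (le_refl m) hm
    simp only [hR]
    linarith
  have hR0 : ∀ n, 0 ≤ R n := fun n =>
    (integral_nonneg fun y => sq_nonneg _).trans (hint n)
  set Ev : Set (Fin (N - 1) → ℝ) := {y | δ ≤ |centeredHeight N m y - A|} with hEv
  have hmE : MeasurableSet Ev := measurableSet_le measurable_const (by fun_prop)
  have hE : ∀ n, updateKernel N α n x Ev ≤ ENNReal.ofReal (R n / δ ^ 2) := by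
    intro n
    have := isFiniteMeasure_updateKernel (N := N) hα n x
    have h2 : Integrable (fun y => (centeredHeight N m y - A) ^ 2) (updateKernel N α n x) := by
      refine integrable_updateKernel hα hx (by fun_prop) (K := ((N : ℝ) + |A|) ^ 2) (fun y hy => ?_) n
      rw [abs_pow]
      refine pow_le_pow_left₀ (abs_nonneg _) ((abs_sub _ _).trans ?_) 2
      linarith [abs_centeredHeight_le (by omega) hy hm]
    have h := mul_meas_ge_le_integral_of_nonneg (Filter.Eventually.of_forall fun y =>
      sq_nonneg (centeredHeight N m y - A)) h2 (δ ^ 2)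
    have hset : {y | δ ^ 2 ≤ (centeredHeight N m y - A) ^ 2} = Ev := by
      ext y
      simp only [Set.mem_ofPred_eq, hEv]
      rw [← sq_abs (centeredHeight N m y - A), sq_le_sq₀ hδ.le (abs_nonneg _)]
    rw [hset] at h
    rw [← ENNReal.ofReal_toReal (measure_ne_top (updateKernel N α n x) Ev)]
    refine ENNReal.ofReal_le_ofReal ?_
    rw [le_div_iff₀ (by positivity), mul_comm]
    exact h.trans (hint n)
  have hexp : ∀ c : ℝ, HasSum (fun n : ℕ => t ^ n / (n.factorial : ℝ) * c ^ n)
      (Real.exp (t * c)) := by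
    intro c
    have h := NormedSpace.expSeries_div_hasSum_exp (𝔸 := ℝ) (t * c)
    rw [← Real.exp_eq_exp_ℝ] at h
    refine h.congr_fun fun n => ?_
    rw [mul_pow]; ring
  set w : ℕ → ℝ := fun n => Real.exp (-(((N - 1 : ℕ) : ℝ) * t)) * (t ^ n / (n.factorial : ℝ))
    with hw
  have hw0 : ∀ n, 0 ≤ w n := fun n => by positivity
  have hsum : HasSum (fun n => w n * (R n / δ ^ 2)) (V / δ ^ 2) := by
    have h := (((hexp ((N : ℝ) - 1)).mul_right (V + A ^ 2)).add
      ((hexp ((N : ℝ) - 1 - 2 * gap N)).mul_right (θ ^ 2 * (s * s)))).sub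
      ((hexp ((N : ℝ) - 1 - gap N)).mul_right (2 * A * θ * s))
    have h' := (h.mul_left (Real.exp (-(((N - 1 : ℕ) : ℝ) * t)))).mul_right (1 / δ ^ 2)
    have hval : Real.exp (-(((N - 1 : ℕ) : ℝ) * t)) *
        (Real.exp (t * ((N : ℝ) - 1)) * (V + A ^ 2) +
          Real.exp (t * ((N : ℝ) - 1 - 2 * gap N)) * (θ ^ 2 * (s * s)) -
          Real.exp (t * ((N : ℝ) - 1 - gap N)) * (2 * A * θ * s)) * (1 / δ ^ 2) = V / δ ^ 2 := by
      have x1 : Real.exp (-(((N : ℝ) - 1) * t)) * Real.exp (t * ((N : ℝ) - 1)) = 1 := by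
        rw [← Real.exp_add]; ring_nf; exact Real.exp_zero
      have x2 : Real.exp (-(((N : ℝ) - 1) * t)) * Real.exp (t * ((N : ℝ) - 1 - gap N)) =
          Real.exp (-(gap N * t)) := by
        rw [← Real.exp_add]; ring_nf
      have x3 : Real.exp (-(((N : ℝ) - 1) * t)) * Real.exp (t * ((N : ℝ) - 1 - 2 * gap N)) =
          Real.exp (-(gap N * t)) ^ 2 := by
        rw [← Real.exp_add, ← Real.exp_nat_mul]; push_cast; ring_nf
      rw [hmN]
      linear_combination ((V + A ^ 2) * x1 + θ ^ 2 * (s * s) * x3 - 2 * A * θ * s * x2) / δ ^ 2 +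
        (A - θ * Real.exp (-(gap N * t)) * s) / δ ^ 2 * hA
    rw [hval] at h'
    refine h'.congr_fun fun n => ?_
    simp only [hw, hR]
    ring
  have hV4 : V ≤ (K + 2) * N / 4 := by
    have : (m : ℝ) * (N - m) / N ≤ N / 4 := by
      rw [div_le_iff₀ hN0]
      nlinarith [sq_nonneg ((N : ℝ) - 2 * m)]
    calc V ≤ (K + 2) * (N / 4) := by rw [hV]; gcongr
      _ = _ := by ring
  calc law N α t x Ev = ∑' n, ENNReal.ofReal (w n) * updateKernel N α n x Ev := by
        rw [law, Measure.sum_apply _ hmE]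
        rfl
    _ ≤ ∑' n, ENNReal.ofReal (w n * (R n / δ ^ 2)) := by
        refine ENNReal.tsum_le_tsum fun n => ?_
        rw [ENNReal.ofReal_mul (hw0 n)]
        exact mul_le_mul_right (hE n) _
    _ = ENNReal.ofReal (V / δ ^ 2) := by
        rw [← ENNReal.ofReal_tsum_of_nonneg (fun n => mul_nonneg (hw0 n)
          (div_nonneg (hR0 n) (sq_nonneg _))) hsum.summable, hsum.tsum_eq]
    _ ≤ _ := by
        refine ENNReal.ofReal_le_ofReal ?_
        calc V / δ ^ 2 ≤ ((K + 2) * N / 4) / δ ^ 2 := by gcongr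
          _ = _ := by rw [div_div]

end Relaxation

/-! ### Flow between an upper and a lower set -/

section FlowBound

variable {N : ℕ} {α : ℝ}

theorem lintegral_mul_law_two_mul' (hN : 1 ≤ N) (hα : 0 < α) {f g : (Fin (N - 1) → ℝ) → ℝ≥0∞}
    (hf : Measurable f) (hg : Measurable g) {s : ℝ} (hs : 0 ≤ s) :
    ∫⁻ x, f x * (∫⁻ y, g y ∂law N α (2 * s) x) ∂equilibrium N α =
      ∫⁻ x, (∫⁻ y, f y ∂law N α s x) * (∫⁻ y, g y ∂law N α s x) ∂equilibrium N α := by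
  obtain ⟨n, rfl⟩ : ∃ n, N = n + 1 := ⟨N - 1, by omega⟩
  exact lintegral_mul_law_two_mul hα n hf hg hs

theorem measurable_law_apply (hα : 0 < α) {C : Set (Fin (N - 1) → ℝ)} (hC : MeasurableSet C)
    (t : ℝ) : Measurable fun x => law N α t x C := by
  have h := measurable_lintegral_law N hα (measurable_one.indicator hC) t
  simpa only [lintegral_indicator_one hC] using h

theorem law_apply_mono (hα : 0 < α) {C : Set (Fin (N - 1) → ℝ)} (hC : MeasurableSet C)
    (hCu : IsUpperSet C) (t : ℝ) : Monotone fun x => law N α t x C := by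
  have h := lintegral_law_mono N hα (f := C.indicator 1) (measurable_one.indicator hC)
    (fun x y hxy => by
      by_cases hx : x ∈ C
      · simp [hx, hCu hxy hx]
      · simp [hx]) t
  simpa only [lintegral_indicator_one hC] using h

theorem law_apply_anti (hα : 0 < α) {C : Set (Fin (N - 1) → ℝ)} (hC : MeasurableSet C)
    (hCl : IsLowerSet C) (t : ℝ) : Antitone fun x => law N α t x C := by
  have h := lintegral_law_anti N hα (f := C.indicator 1) (measurable_one.indicator hC)
    (fun x y hxy => by
      by_cases hy : y ∈ C
      · simp [hy, hCl hxy hy]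
      · simp [hy]) t
  simpa only [lintegral_indicator_one hC] using h

/-- Half of the time from `A` to `B` can be spent on each side. -/
theorem setLIntegral_law_two_mul (hN : 1 ≤ N) (hα : 0 < α) {A B : Set (Fin (N - 1) → ℝ)}
    (hA : MeasurableSet A) (hB : MeasurableSet B) {s : ℝ} (hs : 0 ≤ s) :
    ∫⁻ x in A, law N α (2 * s) x B ∂equilibrium N α =
      ∫⁻ x, law N α s x A * law N α s x B ∂equilibrium N α := by
  have h := lintegral_mul_law_two_mul' hN hα (measurable_one.indicator hA)
    (measurable_one.indicator hB) hs
  simp only [lintegral_indicator_one hA, lintegral_indicator_one hB] at h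
  rw [← h, ← lintegral_indicator hA]
  refine lintegral_congr fun x => ?_
  by_cases hx : x ∈ A <;> simp [hx]

/-- Reversibility: `P_t` is symmetric with respect to the equilibrium distribution. -/
theorem setLIntegral_law_comm (hN : 1 ≤ N) (hα : 0 < α) {A B : Set (Fin (N - 1) → ℝ)}
    (hA : MeasurableSet A) (hB : MeasurableSet B) {t : ℝ} (ht : 0 ≤ t) :
    ∫⁻ x in A, law N α t x B ∂equilibrium N α = ∫⁻ x in B, law N α t x A ∂equilibrium N α := by
  obtain ⟨s, rfl⟩ : ∃ s, t = 2 * s := ⟨t / 2, by ring⟩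
  have hs : 0 ≤ s := by linarith
  rw [setLIntegral_law_two_mul hN hα hA hB hs, setLIntegral_law_two_mul hN hα hB hA hs]
  simp_rw [mul_comm]

theorem lintegral_law_apply (hN : 1 ≤ N) (hα : 0 < α) {C : Set (Fin (N - 1) → ℝ)}
    (hC : MeasurableSet C) {t : ℝ} (ht : 0 ≤ t) :
    ∫⁻ x, law N α t x C ∂equilibrium N α = equilibrium N α C := by
  have := isProbabilityMeasure_law N α hα t ht
  simpa using setLIntegral_law_comm hN hα MeasurableSet.univ hC ht

theorem setLIntegral_law_le (hN : 1 ≤ N) (hα : 0 < α) {C D : Set (Fin (N - 1) → ℝ)}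
    (hC : MeasurableSet C) (hD : MeasurableSet D) {t : ℝ} (ht : 0 ≤ t) {η : ℝ≥0∞}
    (h : ∀ x ∈ C, law N α t x D ≤ η) :
    ∫⁻ x in D, law N α t x C ∂equilibrium N α ≤ η * equilibrium N α C := by
  rw [setLIntegral_law_comm hN hα hD hC ht, ← setLIntegral_const]
  exact setLIntegral_mono measurable_const h

/-- Suppose that two events `D` and `E` cover the space, that each of them has probability at least
`1 / 2` at equilibrium and preserves association, but that `D` is unlikely from every point of the
lower set `B` and `E` is unlikely from every point of the upper set `A`. Then the flow from `A` to
`B` is a small fraction of `π(A) π(B)`: on each of `D` and `E`, the increasing function `P_s 1_A`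
and the decreasing function `P_s 1_B` are negatively correlated. -/
theorem setLIntegral_law_two_mul_le (hN : 1 ≤ N) (hα : 0 < α) {s : ℝ} (hs : 0 ≤ s)
    {A B D E : Set (Fin (N - 1) → ℝ)} (hA : MeasurableSet A) (hB : MeasurableSet B)
    (hAu : IsUpperSet A) (hBl : IsLowerSet B) (hD : MeasurableSet D) (hE : MeasurableSet E)
    (hDE : D ∪ E = Set.univ) (hDa : Associated ((equilibrium N α).restrict D))
    (hEa : Associated ((equilibrium N α).restrict E)) (hD2 : 1 / 2 ≤ equilibrium N α D)
    (hE2 : 1 / 2 ≤ equilibrium N α E) {η : ℝ≥0∞} (hDB : ∀ x ∈ B, law N α s x D ≤ η)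
    (hEA : ∀ x ∈ A, law N α s x E ≤ η) :
    ∫⁻ x in A, law N α (2 * s) x B ∂equilibrium N α ≤
      4 * η * (equilibrium N α A * equilibrium N α B) := by
  set π := equilibrium N α with hπ
  have hAm := measurable_law_apply hα hA s
  have hBm := measurable_law_apply hα hB s
  have monoA := law_apply_mono hα hA hAu s
  have antiB := law_apply_anti hα hB hBl s
  have twice : ∀ {a b c : ℝ≥0∞}, 1 / 2 ≤ c → c * a ≤ b → a ≤ 2 * b := by
    intro a b c hc h
    calc a = 2 * (1 / 2 * a) := by
          rw [← mul_assoc, one_div, ENNReal.mul_inv_cancel two_ne_zero ENNReal.ofNat_ne_top, one_mul]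
      _ ≤ 2 * b := by gcongr; exact (by gcongr : 1 / 2 * a ≤ c * a).trans h
  have onD : ∫⁻ x in D, law N α s x A * law N α s x B ∂π ≤ 2 * (π A * (η * π B)) := by
    have h := hDa _ _ hAm hBm monoA antiB
    rw [Measure.restrict_apply_univ] at h
    refine twice hD2 (h.trans ?_)
    gcongr
    · exact (setLIntegral_le_lintegral _ _).trans (lintegral_law_apply hN hα hA hs).le
    · exact setLIntegral_law_le hN hα hB hD hs hDB
  have onE : ∫⁻ x in E, law N α s x A * law N α s x B ∂π ≤ 2 * (η * π A * π B) := by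
    have h := hEa _ _ hAm hBm monoA antiB
    rw [Measure.restrict_apply_univ] at h
    refine twice hE2 (h.trans ?_)
    gcongr
    · exact setLIntegral_law_le hN hα hA hE hs hEA
    · exact (setLIntegral_le_lintegral _ _).trans (lintegral_law_apply hN hα hB hs).le
  calc ∫⁻ x in A, law N α (2 * s) x B ∂π
      = ∫⁻ x in D ∪ E, law N α s x A * law N α s x B ∂π := by
        rw [setLIntegral_law_two_mul hN hα hA hB hs, hDE, Measure.restrict_univ]
    _ ≤ (∫⁻ x in D, law N α s x A * law N α s x B ∂π) +
        ∫⁻ x in E, law N α s x A * law N α s x B ∂π := lintegral_union_le _ _ _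
    _ ≤ 2 * (π A * (η * π B)) + 2 * (η * π A * π B) := add_le_add onD onE
    _ = 4 * η * (π A * π B) := by ring

/-- The events in the definition of the separation distance have to lie in the simplex; cutting them
down to it does not change the flow, since the walk started in the simplex stays there. -/
theorem flow_inter_simplex (hα : 0 < α) (t : ℝ) {A B : Set (Fin (N - 1) → ℝ)}
    (hA : MeasurableSet A) (hB : MeasurableSet B) :
    flow N α t (A ∩ simplex N) (B ∩ simplex N) =
      (∫⁻ x in A, law N α t x B ∂equilibrium N α).toReal := by
  have hΩ := measurableSet_simplex N
  rw [flow, ← lintegral_indicator (hA.inter hΩ), ← lintegral_indicator hA]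
  congr 1
  refine lintegral_congr_ae ?_
  filter_upwards [ae_mem_simplex N α] with x hx
  have h := lintegral_law_congr N hα
    (f := (B ∩ simplex N).indicator 1) (g := B.indicator 1)
    (measurable_one.indicator (hB.inter hΩ)) (measurable_one.indicator hB)
    (fun y hy => by by_cases hyB : y ∈ B <;> simp [hy, hyB]) t hx
  rw [lintegral_indicator_one (hB.inter hΩ), lintegral_indicator_one hB] at h
  by_cases hxA : x ∈ A
  · simp [hx, hxA, h]
  · simp [hxA]

theorem equilibrium_inter_simplex (A : Set (Fin (N - 1) → ℝ)) :
    equilibrium N α (A ∩ simplex N) = equilibrium N α A :=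
  measure_congr <| (ae_mem_simplex N α).mono fun _ hx => propext
    ⟨fun h => h.1, fun h => ⟨h, hx⟩⟩

/-- Two events whose flow is at most `1 - ε` times its equilibrium value bound the separation
distance from below. -/
theorem le_sepDist {t ε : ℝ} {A B : Set (Fin (N - 1) → ℝ)} (hA : A ⊆ simplex N)
    (hAm : MeasurableSet A) (hA0 : 0 < volume A) (hB : B ⊆ simplex N) (hBm : MeasurableSet B)
    (hB0 : 0 < volume B) (hε : ε ≤ 1)
    (h : flow N α t A B ≤ (1 - ε) * ((equilibrium N α).real A * (equilibrium N α).real B)) :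
    ε ≤ sepDist N α t := by
  rw [sepDist, le_sub_comm]
  have hbdd : BddBelow {r : ℝ | ∃ A B : Set (Fin (N - 1) → ℝ),
      A ⊆ simplex N ∧ MeasurableSet A ∧ 0 < volume A ∧
      B ⊆ simplex N ∧ MeasurableSet B ∧ 0 < volume B ∧
      r = flow N α t A B / ((equilibrium N α).real A * (equilibrium N α).real B)} := by
    refine ⟨0, ?_⟩
    rintro r ⟨A, B, -, -, -, -, -, -, rfl⟩
    exact div_nonneg ENNReal.toReal_nonneg (mul_nonneg measureReal_nonneg measureReal_nonneg)
  refine (csInf_le hbdd ⟨A, B, hA, hAm, hA0, hB, hBm, hB0, rfl⟩).trans ?_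
  exact div_le_of_le_mul₀ (mul_nonneg measureReal_nonneg measureReal_nonneg) (by linarith) h

end FlowBound

/-! ### Sine profiles -/

section Profiles

variable {N : ℕ}

/-- The configuration `x_k = k + θ sin(π k / N)`. -/
noncomputable def sineProfile (N : ℕ) (θ : ℝ) : Fin (N - 1) → ℝ :=
  fun i => ((i : ℕ) + 1 : ℕ) + θ * sineMode N ((i : ℕ) + 1)

theorem centeredHeight_sineProfile (hN : 1 ≤ N) (θ : ℝ) {k : ℕ} (hk : k ≤ N) :
    centeredHeight N k (sineProfile N θ) = θ * sineMode N k := by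
  by_cases h0 : k = 0
  · rw [h0, centeredHeight_zero, sineMode_zero, mul_zero]
  by_cases h1 : k = N
  · rw [h1, centeredHeight_self hN, sineMode_self hN, mul_zero]
  have h2 : k - 1 < N - 1 := by omega
  have h3 : k - 1 + 1 = k := by omega
  simp only [centeredHeight, height, if_neg h0, dif_pos h2, sineProfile, h3]
  ring

theorem abs_sineMode_succ_sub_le (N k : ℕ) :
    |sineMode N (k + 1) - sineMode N k| ≤ Real.pi / N := by
  have h := Real.abs_sin_sub_sin_le (Real.pi * (k + 1 : ℕ) / N) (Real.pi * k / N)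
  refine h.trans (le_of_eq ?_)
  rw [show Real.pi * (k + 1 : ℕ) / N - Real.pi * k / N = Real.pi / N by push_cast; ring,
    abs_of_nonneg (by positivity)]

theorem increment_sineProfile_mem (hN : 1 ≤ N) {θ : ℝ} (hθ : |θ| ≤ N / 8) {k : ℕ} (hk : k < N) :
    increment N k (sineProfile N θ) ∈ Set.Icc (1 / 2 : ℝ) (3 / 2) := by
  have hN0 : (0 : ℝ) < N := by exact_mod_cast hN
  have h0 := centeredHeight_sineProfile hN θ hk.le
  have h1 := centeredHeight_sineProfile hN θ (show k + 1 ≤ N from hk)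
  have e : increment N k (sineProfile N θ) = 1 + θ * (sineMode N (k + 1) - sineMode N k) := by
    rw [centeredHeight] at h0 h1
    push_cast at h1
    rw [increment]
    linarith
  have h : |θ * (sineMode N (k + 1) - sineMode N k)| ≤ 1 / 2 := by
    rw [abs_mul]
    calc _ ≤ (N : ℝ) / 8 * (Real.pi / N) := by
          gcongr
          exact abs_sineMode_succ_sub_le N k
      _ = Real.pi / 8 := by field_simp
      _ ≤ 1 / 2 := by linarith [Real.pi_lt_four]
  rw [abs_le] at h
  rw [e]
  constructor <;> linarith [h.1, h.2]

theorem mem_simplex_of_abs_sub_le {x y : Fin (N - 1) → ℝ}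
    (hx : ∀ k < N, 1 / 2 ≤ increment N k x) (hxy : ∀ i, |y i - x i| ≤ 1 / 4) : y ∈ simplex N := by
  have h : ∀ k, |height N y k - height N x k| ≤ 1 / 4 := by
    intro k
    unfold height
    split_ifs
    · simp
    · exact hxy _
    · simp
  intro k hk
  have h0 := abs_le.1 (h k)
  have h1 := abs_le.1 (h (k + 1))
  have h2 := hx k hk
  rw [increment] at h2
  linarith [h0.1, h0.2, h1.1, h1.2]

theorem volume_Icc_pos {n : ℕ} {a b : Fin n → ℝ} (h : ∀ i, a i < b i) :
    0 < volume (Set.Icc a b) := by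
  rw [Real.volume_Icc_pi]
  exact pos_iff_ne_zero.2 (Finset.prod_ne_zero_iff.2 fun i _ => by simpa using h i)

theorem sineProfile_mem_simplex (hN : 1 ≤ N) {θ : ℝ} (hθ : |θ| ≤ N / 8) :
    sineProfile N θ ∈ simplex N :=
  mem_simplex_of_abs_sub_le (fun _ hk => (increment_sineProfile_mem hN hθ hk).1) (by simp)

theorem volume_Ici_inter_simplex_pos (hN : 1 ≤ N) {θ : ℝ} (hθ : |θ| ≤ N / 8) :
    0 < volume (Set.Ici (sineProfile N θ) ∩ simplex N) := by
  refine (volume_Icc_pos (a := sineProfile N θ) (b := fun i => sineProfile N θ i + 1 / 4)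
    fun i => by linarith).trans_le (measure_mono fun y hy => ⟨hy.1, ?_⟩)
  refine mem_simplex_of_abs_sub_le (fun _ hk => (increment_sineProfile_mem hN hθ hk).1)
    fun i => abs_le.2 ⟨?_, ?_⟩
  · linarith [hy.1 i]
  · linarith [hy.2 i]

theorem volume_Iic_inter_simplex_pos (hN : 1 ≤ N) {θ : ℝ} (hθ : |θ| ≤ N / 8) :
    0 < volume (Set.Iic (sineProfile N θ) ∩ simplex N) := by
  refine (volume_Icc_pos (a := fun i => sineProfile N θ i - 1 / 4) (b := sineProfile N θ)
    fun i => by linarith).trans_le (measure_mono fun y hy => ⟨hy.2, ?_⟩)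
  refine mem_simplex_of_abs_sub_le (fun _ hk => (increment_sineProfile_mem hN hθ hk).1)
    fun i => abs_le.2 ⟨?_, ?_⟩
  · linarith [hy.1 i]
  · linarith [hy.2 i]

/-- Chebyshev's inequality for the walk started from one of the two extremal sine profiles. -/
theorem law_sineProfile_deviation_le (hN : 3 ≤ N) {α : ℝ} (hα : 0 < α) {θ : ℝ} (hθ : |θ| ≤ N / 8)
    {m : ℕ} (hm : m ≤ N) {t : ℝ} (ht : 0 ≤ t) {δ : ℝ} (hδ : 0 < δ) :
    law N α t (sineProfile N θ)
        {y | δ ≤ |centeredHeight N m y - θ * Real.exp (-(gap N * t)) * sineMode N m|} ≤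
      ENNReal.ofReal ((4 / α + 2) * N / (4 * δ ^ 2)) := by
  have hN0 : (0 : ℝ) < N := by positivity
  refine law_deviation_le hN hα (sineProfile_mem_simplex (by omega) hθ)
    (fun k hk => centeredHeight_sineProfile (by omega) θ hk) ?_ (by positivity) ?_ hm ht hδ
  · have hN3 : (3 : ℝ) ≤ N := by exact_mod_cast hN
    have hpi := Real.pi_lt_four
    have hpi0 := Real.pi_pos
    rw [sq_le_one_iff_abs_le_one, abs_mul, abs_of_nonneg (gap_nonneg N)]
    calc |θ| * gap N ≤ N / 8 * (Real.pi ^ 2 / (2 * (N : ℝ) ^ 2)) := by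
          gcongr
          · exact gap_nonneg N
          · exact gap_le N
      _ = Real.pi ^ 2 / (16 * N) := by field_simp; ring
      _ ≤ 1 := by
          rw [div_le_one (by positivity)]
          nlinarith
  · intro k l hk hl
    have h1 := increment_sineProfile_mem (by omega) hθ hk
    have h2 := increment_sineProfile_mem (by omega) hθ hl
    have h3 : increment N k (sineProfile N θ) * increment N l (sineProfile N θ) ≤ 4 := by
      nlinarith [h1.1, h1.2, h2.1, h2.2]
    have h4 : 4 ≤ 4 / α * (if k = l then α + 1 else α) := by
      calc 4 = 4 / α * α := by field_simp
        _ ≤ _ := by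
          gcongr
          split_ifs <;> linarith
    exact h3.trans h4

end Profiles

/-! ### Lower bound on the separation distance -/

/-- Chebyshev's inequality at equilibrium: the `(p + 1)`-th of the `p + 1 + q` particles is within
`√(N / α)` of its mean with probability at least `3 / 4`. -/
theorem equilibrium_deviation_le {α : ℝ} (hα : 0 < α) (p q : ℕ) :
    equilibrium (p + 1 + q + 1) α {x | √(((p + 1 + q + 1 : ℕ) : ℝ) / α) ≤
      |centeredHeight (p + 1 + q + 1) (p + 1) x|} ≤ ENNReal.ofReal (1 / 4) := by
  set N : ℝ := ((p + 1 + q + 1 : ℕ) : ℝ) with hN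
  have hNpq : N = (p + 1) + (q + 1) := by rw [hN]; push_cast; ring
  have hN0 : 0 < N := by rw [hNpq]; positivity
  have hp : 0 < ((p : ℝ) + 1) * α := by positivity
  have hq : 0 < ((q : ℝ) + 1) * α := by positivity
  have h1 := isProbabilityMeasure_chainLaw hα p
  have h2 := isProbabilityMeasure_chainLaw hα q
  have h3 := isProbabilityMeasureBeta hp hq
  set β := betaMeasure (((p : ℝ) + 1) * α) ((q + 1) * α) with hβ
  have hI : ∀ k : ℕ, Integrable (fun u : ℝ => u ^ k) β := by
    intro k
    refine Integrable.of_bound (by fun_prop) 1 ?_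
    filter_upwards [ae_mem_Ioo_betaMeasure (((p : ℝ) + 1) * α) ((q + 1) * α)] with u hu
    rw [norm_pow, Real.norm_eq_abs, abs_of_pos hu.1]
    exact pow_le_one₀ hu.1.le hu.2.le
  have hI1 : Integrable (fun u : ℝ => u) β := by simpa using hI 1
  have hvar : ∫ u, (N * u - (p + 1)) ^ 2 ∂β ≤ N / (4 * α) := by
    have e : ∀ u : ℝ, (N * u - (p + 1)) ^ 2 = N ^ 2 * u ^ 2 - 2 * N * (p + 1) * u + (p + 1) ^ 2 :=
      fun u => by ring
    simp_rw [e]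
    have i2 : Integrable (fun u : ℝ => N ^ 2 * u ^ 2) β := (hI 2).const_mul _
    have i1 : Integrable (fun u : ℝ => 2 * N * (p + 1) * u) β := hI1.const_mul _
    have i12 : Integrable (fun u : ℝ => N ^ 2 * u ^ 2 - 2 * N * (p + 1) * u) β := i2.sub i1
    rw [integral_add i12 (integrable_const _), integral_sub i2 i1, integral_const_mul,
      integral_const_mul, integral_const, hβ, integral_id_betaMeasure hp hq,
      integral_sq_betaMeasure hp hq]
    simp only [probReal_univ, one_smul]
    have hs : ((p : ℝ) + 1) * α + (q + 1) * α = N * α := by rw [hNpq]; ring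
    rw [hs]
    have hval : N ^ 2 * (((p : ℝ) + 1) * α * ((p + 1) * α + 1) / (N * α * (N * α + 1))) -
        2 * N * (p + 1) * ((p + 1) * α / (N * α)) + (p + 1) ^ 2 =
        (p + 1) * (q + 1) / (N * α + 1) := by
      have hq1 : (q : ℝ) + 1 = N - (p + 1) := by rw [hNpq]; ring
      have : N * α + 1 ≠ 0 := by positivity
      rw [hq1]
      field_simp
      ring
    rw [hval, div_le_div_iff₀ (by positivity) (by positivity)]
    have h4 : 4 * (((p : ℝ) + 1) * (q + 1)) ≤ N ^ 2 := by
      rw [hNpq]; nlinarith [sq_nonneg ((p : ℝ) - q)]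
    nlinarith
  rw [equilibrium_eq_map hα]
  have hmeas : MeasurableSet {x | √(N / α) ≤ |centeredHeight (p + 1 + q + 1) (p + 1) x|} :=
    measurableSet_le measurable_const (by fun_prop)
  rw [Measure.map_apply (measurable_profileMap p q) hmeas]
  have hheight : ∀ x : Fin (p + 1 + q) → ℝ, centeredHeight (p + 1 + q + 1) (p + 1) x =
      x (Fin.castAdd q (Fin.last p)) - (p + 1) := by
    intro x
    rw [centeredHeight, height, if_neg (by omega), dif_pos (by omega)]
    push_cast
    rfl
  have hset : ∀ᵐ w ∂β.prod ((chainLaw α p).prod (chainLaw α q)),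
      w ∈ profileMap p q ⁻¹' {x | √(N / α) ≤ |centeredHeight (p + 1 + q + 1) (p + 1) x|} →
        w ∈ {u : ℝ | N / α ≤ (N * u - (p + 1)) ^ 2} ×ˢ Set.univ := by
    have hu := Measure.quasiMeasurePreserving_fst (μ := β)
      (ν := (chainLaw α p).prod (chainLaw α q)) |>.ae
        (ae_mem_Ioo_betaMeasure (((p : ℝ) + 1) * α) ((q + 1) * α))
    filter_upwards [hu] with w hw hmem
    refine ⟨?_, trivial⟩
    have hN' : ((p + 1 + q : ℕ) : ℝ) + 1 = N := by rw [hN]; push_cast; ring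
    simp only [Set.mem_preimage, Set.mem_ofPred_eq] at hmem ⊢
    rw [hheight, profileMap_apply, between_eq (by positivity) hw, hN',
      Real.sqrt_le_left (abs_nonneg _), sq_abs] at hmem
    simpa using hmem
  have hle : β.prod ((chainLaw α p).prod (chainLaw α q)) (profileMap p q ⁻¹'
      {x | √(N / α) ≤ |centeredHeight (p + 1 + q + 1) (p + 1) x|}) ≤
      β.prod ((chainLaw α p).prod (chainLaw α q))
        ({u : ℝ | N / α ≤ (N * u - (p + 1)) ^ 2} ×ˢ Set.univ) := measure_mono_ae hset
  refine hle.trans ?_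
  rw [Measure.prod_prod, measure_univ, mul_one,
    ← ENNReal.ofReal_toReal (measure_ne_top β _)]
  refine ENNReal.ofReal_le_ofReal ?_
  have i : Integrable (fun u : ℝ => (N * u - (p + 1)) ^ 2) β := by
    have e : (fun u : ℝ => (N * u - (p + 1)) ^ 2) =
        fun u => N ^ 2 * u ^ 2 - 2 * N * (p + 1) * u + (p + 1) ^ 2 := by funext u; ring
    rw [e]
    exact (((hI 2).const_mul _).sub (hI1.const_mul _)).add (integrable_const _)
  have h := mul_meas_ge_le_integral_of_nonneg (Filter.Eventually.of_forall fun u =>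
    sq_nonneg (N * u - ((p : ℝ) + 1))) i (N / α)
  have h' := h.trans hvar
  rw [show N / (4 * α) = N / α * (1 / 4) by field_simp] at h'
  exact le_of_mul_le_mul_left h' (by positivity)

/-- A lower bound on the separation distance as long as the mean of the profile started from a sine
of amplitude `N / 8` exceeds the equilibrium fluctuations. -/
theorem le_sepDist_of_deviation {α : ℝ} (hα : 0 < α) (p q : ℕ) (hpq : 1 ≤ p + q) {s : ℝ}
    (hs : 0 ≤ s) {ε : ℝ} (hε : ε ≤ 1) {N : ℕ} (hN : N = p + 1 + q + 1) {δ : ℝ} (hδ : 0 < δ)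
    (hδ' : δ + √((N : ℝ) / α) ≤ N / 8 * Real.exp (-(gap N * s)) * sineMode N (p + 1))
    (hsmall : (4 / α + 2) * N / (4 * δ ^ 2) ≤ (1 - ε) / 4) :
    ε ≤ sepDist N α (2 * s) := by
  have hN3 : 3 ≤ N := by omega
  have hN1 : 1 ≤ N := by omega
  have hπ : IsProbabilityMeasure (equilibrium N α) := hN ▸ isProbabilityMeasure_equilibrium hα p q
  set L := √((N : ℝ) / α) with hL
  set a := (N : ℝ) / 8 * Real.exp (-(gap N * s)) * sineMode N (p + 1) with ha
  have hθ : |(N : ℝ) / 8| ≤ N / 8 := (abs_of_nonneg (by positivity)).le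
  have hθ' : |-((N : ℝ) / 8)| ≤ N / 8 := by rwa [abs_neg]
  set D : Set (Fin (N - 1) → ℝ) := {x | -L ≤ centeredHeight N (p + 1) x} with hD
  set E : Set (Fin (N - 1) → ℝ) := {x | centeredHeight N (p + 1) x ≤ L} with hE
  have hDm : MeasurableSet D := measurableSet_le measurable_const (by fun_prop)
  have hEm : MeasurableSet E := measurableSet_le (by fun_prop) measurable_const
  have hDE : D ∪ E = Set.univ := by
    refine Set.eq_univ_of_forall fun x => ?_
    rcases le_total (-L) (centeredHeight N (p + 1) x) with h | h
    · exact Or.inl h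
    · exact Or.inr (h.trans (by linarith [Real.sqrt_nonneg ((N : ℝ) / α)]))
  have hdev : equilibrium N α {x | L ≤ |centeredHeight N (p + 1) x|} ≤ ENNReal.ofReal (1 / 4) := by
    subst hN
    exact equilibrium_deviation_le hα p q
  have half : ∀ {C : Set (Fin (N - 1) → ℝ)}, MeasurableSet C →
      Cᶜ ⊆ {x | L ≤ |centeredHeight N (p + 1) x|} → 1 / 2 ≤ equilibrium N α C := by
    intro C hC h
    have h1 : equilibrium N α Cᶜ ≤ 1 / 2 := (measure_mono h).trans <| hdev.trans <| by
      rw [show (1 / 2 : ℝ≥0∞) = ENNReal.ofReal (1 / 2) by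
        rw [ENNReal.ofReal_div_of_pos two_pos]; simp]
      exact ENNReal.ofReal_le_ofReal (by norm_num)
    rw [prob_compl_eq_one_sub hC, tsub_le_iff_right] at h1
    have h2 : (1 : ℝ≥0∞) / 2 + 1 / 2 ≤ 1 / 2 + equilibrium N α C := by
      rwa [ENNReal.add_halves]
    exact (ENNReal.add_le_add_iff_left (by simp)).1 h2
  have hD2 : 1 / 2 ≤ equilibrium N α D := half hDm fun x hx => by
    have hx' : centeredHeight N (p + 1) x < -L := not_le.1 hx
    exact (by linarith : L ≤ -centeredHeight N (p + 1) x).trans (neg_le_abs _)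
  have hE2 : 1 / 2 ≤ equilibrium N α E := half hEm fun x hx => by
    have hx' : L < centeredHeight N (p + 1) x := not_le.1 hx
    exact hx'.le.trans (le_abs_self _)
  have hassoc : ∀ S : Set ℝ, MeasurableSet S →
      Associated ((equilibrium N α).restrict {x | centeredHeight N (p + 1) x ∈ S}) := by
    intro S hS
    subst hN
    have hset : {x : Fin (p + 1 + q) → ℝ | centeredHeight (p + 1 + q + 1) (p + 1) x ∈ S} =
        {x | x (Fin.castAdd q (Fin.last p)) ∈ (fun r : ℝ => r - (p + 1)) ⁻¹' S} := by
      ext x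
      have hx : centeredHeight (p + 1 + q + 1) (p + 1) x =
          x (Fin.castAdd q (Fin.last p)) - (p + 1) := by
        rw [centeredHeight, height, if_neg (by omega), dif_pos (by omega)]
        push_cast
        rfl
      simp only [Set.mem_ofPred_eq, Set.mem_preimage, hx]
    have h := associated_equilibrium_restrict hα p q
      (S := (fun r : ℝ => r - (p + 1)) ⁻¹' S) (hS.preimage (by fun_prop))
    rw [← hset] at h
    exact h
  have hDa : Associated ((equilibrium N α).restrict D) := hassoc _ measurableSet_Ici
  have hEa : Associated ((equilibrium N α).restrict E) := hassoc _ measurableSet_Iic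
  have hmono : ∀ {x y : Fin (N - 1) → ℝ}, x ≤ y →
      centeredHeight N (p + 1) x ≤ centeredHeight N (p + 1) y := fun h =>
    sub_le_sub_right (height_mono N h _) _
  have hDu : IsUpperSet D := fun x y hxy (hx : -L ≤ _) => hx.trans (hmono hxy)
  have hEl : IsLowerSet E := fun x y hxy (hx : _ ≤ L) => (hmono hxy).trans hx
  have hDB : ∀ x ∈ Set.Iic (sineProfile N (-((N : ℝ) / 8))),
      law N α s x D ≤ ENNReal.ofReal ((1 - ε) / 4) := by
    intro x hx
    refine (law_apply_mono hα hDm hDu s hx).trans <| (measure_mono fun y hy => ?_).trans <|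
      (law_sineProfile_deviation_le hN3 hα hθ' (show p + 1 ≤ N by omega) hs hδ).trans
        (ENNReal.ofReal_le_ofReal hsmall)
    have hy' : -L ≤ centeredHeight N (p + 1) y := hy
    refine le_trans (?_ : δ ≤ centeredHeight N (p + 1) y -
      -((N : ℝ) / 8) * Real.exp (-(gap N * s)) * sineMode N (p + 1)) (le_abs_self _)
    linarith
  have hEA : ∀ x ∈ Set.Ici (sineProfile N ((N : ℝ) / 8)),
      law N α s x E ≤ ENNReal.ofReal ((1 - ε) / 4) := by
    intro x hx
    refine (law_apply_anti hα hEm hEl s hx).trans <| (measure_mono fun y hy => ?_).trans <|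
      (law_sineProfile_deviation_le hN3 hα hθ (show p + 1 ≤ N by omega) hs hδ).trans
        (ENNReal.ofReal_le_ofReal hsmall)
    have hy' : centeredHeight N (p + 1) y ≤ L := hy
    refine le_trans (?_ : δ ≤ -(centeredHeight N (p + 1) y -
      (N : ℝ) / 8 * Real.exp (-(gap N * s)) * sineMode N (p + 1))) (neg_le_abs _)
    linarith
  have key := setLIntegral_law_two_mul_le hN1 hα hs measurableSet_Ici measurableSet_Iic
    (isUpperSet_Ici _) (isLowerSet_Iic _) hDm hEm hDE hDa hEa hD2 hE2 hDB hEA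
  refine le_sepDist Set.inter_subset_right (measurableSet_Ici.inter (measurableSet_simplex N))
    (volume_Ici_inter_simplex_pos hN1 hθ) Set.inter_subset_right
    (measurableSet_Iic.inter (measurableSet_simplex N)) (volume_Iic_inter_simplex_pos hN1 hθ') hε ?_
  rw [flow_inter_simplex hα _ measurableSet_Ici measurableSet_Iic, measureReal_def, measureReal_def,
    equilibrium_inter_simplex, equilibrium_inter_simplex]
  refine (ENNReal.toReal_mono ?_ key).trans (le_of_eq ?_)
  · exact ENNReal.mul_ne_top (ENNReal.mul_ne_top (by simp) ENNReal.ofReal_ne_top)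
      (ENNReal.mul_ne_top (measure_ne_top _ _) (measure_ne_top _ _))
  · rw [ENNReal.toReal_mul, ENNReal.toReal_mul, ENNReal.toReal_mul,
      ENNReal.toReal_ofReal (by linarith)]
    simp only [ENNReal.toReal_ofNat]
    ring

theorem two_thirds_le_sineMode {N : ℕ} (hN : 3 ≤ N) : 2 / 3 ≤ sineMode N (N / 2) := by
  have hN0 : (0 : ℝ) < N := by positivity
  have h2 : ((N / 2 : ℕ) : ℝ) ≤ N / 2 := by exact_mod_cast Nat.cast_div_le
  have h3 : (N : ℝ) ≤ 3 * ((N / 2 : ℕ) : ℝ) := by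
    exact_mod_cast (by omega : N ≤ 3 * (N / 2))
  have h := Real.mul_le_sin (x := Real.pi * (N / 2 : ℕ) / N) (by positivity) (by
    rw [div_le_iff₀ hN0]
    nlinarith [Real.pi_pos])
  refine le_trans ?_ h
  rw [show 2 / Real.pi * (Real.pi * (N / 2 : ℕ) / N) = 2 * ((N / 2 : ℕ) : ℝ) / N by
    field_simp, le_div_iff₀ hN0]
  linarith

theorem one_lt_log_of_three_le {x : ℝ} (hx : 3 ≤ x) : 1 < Real.log x := by
  rw [Real.lt_log_iff_exp_lt (by linarith)]
  linarith [Real.exp_one_lt_d9]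

end AdjacentWalk

open AdjacentWalk in
theorem proposition4p1 :
    ∀ ε : ℝ, 0 < ε → ε < 1 → ∃ N₀ : ℕ, 2 ≤ N₀ ∧ ∀ α : ℝ, 0 < α → ∃ C : ℝ, 0 < C ∧ ∀ N : ℕ, N₀ ≤ N →
      (((N : ℝ) ^ 2 * (2 / Real.pi ^ 2 * Real.log N - C * Real.log (Real.log N)) : ℝ) : EReal)
        ≤ AdjacentWalk.sepMixingTime N α ε := by
  intro ε _ hε
  refine ⟨3, by norm_num, fun α hα => ?_⟩
  set ρ := √((4 / α + 2) / (1 - ε)) with hρ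
  have hρ0 : 0 < ρ := Real.sqrt_pos.2 (div_pos (by positivity) (by linarith))
  have hρ2 : ρ ^ 2 = (4 / α + 2) / (1 - ε) :=
    Real.sq_sqrt (div_nonneg (by positivity) (by linarith))
  -- below the scale `exp R` the constant `C` makes the bound trivial
  set R := 12 * (1 / √α + ρ) with hR
  have hl3 : 0 < Real.log (Real.log 3) := Real.log_pos (one_lt_log_of_three_le le_rfl)
  have hpi := Real.pi_pos
  set C := max 1 (2 / Real.pi ^ 2 * R / Real.log (Real.log 3)) with hC
  have hC1 : 1 ≤ C := le_max_left _ _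
  refine ⟨C, by linarith, fun N hN => ?_⟩
  have hN3 : (3 : ℝ) ≤ N := by exact_mod_cast hN
  have hN0 : (0 : ℝ) < N := by linarith
  have hlog := one_lt_log_of_three_le hN3
  have hlog3 := one_lt_log_of_three_le (le_refl (3 : ℝ))
  have hll : Real.log (Real.log 3) ≤ Real.log (Real.log N) :=
    Real.log_le_log (by linarith) (Real.log_le_log (by norm_num) hN3)
  refine le_sInf ?_
  rintro _ ⟨t, ⟨ht0, ht⟩, rfl⟩
  refine EReal.coe_le_coe_iff.2 ?_
  by_contra! hlt
  have hpos : 0 < 2 / Real.pi ^ 2 * Real.log N - C * Real.log (Real.log N) :=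
    pos_of_mul_pos_right (ht0.trans_lt hlt) (sq_nonneg _)
  have hlogR : R ≤ Real.log N := by
    have h1 : 2 / Real.pi ^ 2 * R ≤ C * Real.log (Real.log N) := by
      calc 2 / Real.pi ^ 2 * R
          = 2 / Real.pi ^ 2 * R / Real.log (Real.log 3) * Real.log (Real.log 3) := by field_simp
        _ ≤ C * Real.log (Real.log N) := by
          gcongr
          exact le_max_right _ _
    have h2 : 2 / Real.pi ^ 2 * R < 2 / Real.pi ^ 2 * Real.log N := by linarith
    exact (lt_of_mul_lt_mul_left h2 (by positivity)).le
  refine absurd ht (not_lt.2 ?_)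
  have hp2 : N = (N / 2 - 1) + 1 + (N - N / 2 - 1) + 1 := by omega
  have hsin : 2 / 3 ≤ sineMode N (N / 2 - 1 + 1) := by
    rw [show N / 2 - 1 + 1 = N / 2 by omega]
    exact two_thirds_le_sineMode hN
  -- up to the time `t` the sine profile has only decayed to the scale `√N log N`
  have hexp : Real.log N / √N ≤ Real.exp (-(gap N * (t / 2))) := by
    have h1 : gap N * (t / 2) ≤ Real.log N / 2 - Real.log (Real.log N) := by
      have hpi2 : 4 ≤ Real.pi ^ 2 := by nlinarith [Real.pi_gt_three]
      calc gap N * (t / 2) ≤ Real.pi ^ 2 / (2 * (N : ℝ) ^ 2) *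
            ((N : ℝ) ^ 2 * (2 / Real.pi ^ 2 * Real.log N - C * Real.log (Real.log N)) / 2) := by
            gcongr
            exact gap_le N
        _ = Real.log N / 2 - Real.pi ^ 2 / 4 * C * Real.log (Real.log N) := by
            field_simp
            ring
        _ ≤ Real.log N / 2 - 1 * 1 * Real.log (Real.log N) := by
            gcongr
            · linarith
            · linarith
        _ = _ := by ring
    calc Real.log N / √N = Real.exp (Real.log (Real.log N) - Real.log N / 2) := by
          rw [Real.exp_sub, Real.exp_log (by linarith), ← Real.log_sqrt hN0.le,
            Real.exp_log (Real.sqrt_pos.2 hN0)]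
      _ ≤ _ := Real.exp_le_exp.2 (by linarith)
  have hsq0 : 0 < √(N : ℝ) := Real.sqrt_pos.2 hN0
  have h := le_sepDist_of_deviation hα (N / 2 - 1) (N - N / 2 - 1) (by omega) (s := t / 2)
    (by linarith) hε.le hp2 (δ := √N * ρ) (by positivity) ?_ ?_
  · rwa [mul_div_cancel₀ _ two_ne_zero] at h
  · calc √N * ρ + √(N / α) = √N * (R / 12) := by
          rw [Real.sqrt_div' _ hα.le, hR]; ring
      _ ≤ √N * (Real.log N / 12) := by gcongr
      _ = N / 8 * (Real.log N / √N) * (2 / 3) := by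
          rw [show (N : ℝ) / 8 * (Real.log N / √N) * (2 / 3) = N / √N * (Real.log N / 12) by ring,
            Real.div_sqrt]
      _ ≤ N / 8 * Real.exp (-(gap N * (t / 2))) * sineMode N (N / 2 - 1 + 1) := by
          have : 0 ≤ Real.log N / √N := div_nonneg (by linarith) hsq0.le
          gcongr
  · rw [mul_pow, Real.sq_sqrt hN0.le, hρ2]
    have : (1 - ε) ≠ 0 := by linarith
    have h2 : 4 / α + 2 ≠ 0 := by positivity
    refine le_of_eq ?_
    field_simp
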